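/- **Setting.** Let $\beta,\theta>0$ and $g_\beta(m,\theta)=\frac12\tanh\beta(m+\theta)+\frac12\tanh\beta(m-\theta)$, $\theta_{1,c}(\beta)=\frac1\beta\operatorname{artanh}\sqrt{1-\beta^{-1}}$. Assume that either $1<\beta\le 3/2$ and $0<\theta<\theta_{1,c}(\beta)$, or $\beta>3/2$ and $0<\theta\le\theta_{1,c}(\beta)$. Let $\tilde m_\beta>0$ be the largest solution of $m=g_\beta(m,\theta)$, $m_{\beta,1}=\tanh\beta(\tilde m_\beta+\theta)$, $m_{\beta,2}=\tanh\beta(\tilde m_\beta-\theta)$; the $+$ phase is $m_\beta=(m_{\beta,1},m_{\beta,2})$ and the $-$ phase is $Tm_\beta=(-m_{\beta,2},-m_{\beta,1})$. Put $\alpha(\beta,\theta,\zeta)=-\log\frac{\partial g_\beta}{\partial m}(\tilde m_\beta-\frac\zeta2,\theta)$. With $\mathcal I(m)=\frac{1+m}2\log\frac{1+m}2+\frac{1-m}2\log\frac{1-m}2$ let $$f_{\beta,\theta}(m_1,m_2)=-\tfrac{(m_1+m_2)^2}8-\tfrac\theta2(m_1-m_2)+\tfrac1{2\beta}(\mathcal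 I(m_1)+\mathcal I(m_2)),$$ and let $\kappa>0$ denote a constant with $f_{\beta,\theta}(m)-f_{\beta,\theta}(m_\beta)\ge\kappa\min\{\|m-m_\beta\|_1^2,\|m-Tm_\beta\|_1^2\}$ for all $m\in[-1,1]^2$. Let $h=(h_i)_{i\in\mathbb Z}$ be i.i.d. with $\mathbb P[h_i=1]=\mathbb P[h_i=-1]=\frac12$ on a probability space $(\Omega,\mathcal A,\mathbb P)$. For $\sigma\in\{-1,1\}^{\mathbb Z}$ and finite $\Lambda\subset\mathbb Z$ let $$H_\gamma(\sigma_\Lambda)=-\tfrac12\sum_{i,j\in\Lambda}\gamma\,1_{\{\gamma|i-j|\le 1/2\}}\sigma_i\sigma_j-\theta\sum_{i\in\Lambda}h_i\sigma_i .$$ The finite volume Gibbs measure is proportional to $e^{-\beta H_\gamma(\sigma_\Lambda)}$, and $\mu_{\beta,\theta,\gamma}$ (depending on $h$) is its weak limit along $\Lambda=[-L,L]\cap\mathbb Z$, $L\to\infty$. Assume $\gamma=2^{-n}$ with $n\in\mathbb N$, that $\delta^*/\gamma$ is an even positive integer, and that $\delta=k\delta^*$ for an integer $k\ge2$ with $1/\delta\in\mathbb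 N$. For $x\in\mathbb Z$ let $A(x)=\{i\in\mathbb Z:\gamma i\in((x-1)\delta^*,x\delta^*]\}$, $A^\pm(x)=\{i\in A(x):h_i=\pm1\}$, and $K=\delta^*/(2\gamma)=|A(x)|/2$. If $|A^+(x)|\ge K$, let $B^+(x)$ be the set of the first $K$ elements of $A^+(x)$ and $B^-(x)=A(x)\setminus B^+(x)$; otherwise let $B^-(x)$ be the set of the first $K$ elements of $A^-(x)$ and $B^+(x)=A(x)\setminus B^-(x)$. Put $m^{\delta^*}(x)=\big(\frac{2\gamma}{\delta^*}\sum_{i\in B^+(x)}\sigma_i,\ \frac{2\gamma}{\delta^*}\sum_{i\in B^-(x)}\sigma_i\big)$. For $\ell\in\mathbb Z$ and $\zeta>0$ set $\eta^{\delta,\zeta}(\ell)=1$ if for every $u\in\mathbb Z$ with $((u-1)\delta,u\delta]\subset(\ell-1,\ell]$ $$\frac{\delta^*}\delta\sum_{x:\,((x-1)\delta^*,x\delta^*]\subset((u-1)\delta,u\delta]}\|m^{\delta^*}(x)-m_\beta\|_1\le\zeta ;$$ $\eta^{\delta,\zeta}(\ell)=-1$ if the same holds with $Tm_\beta$ in place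 of $m_\beta$; and $\eta^{\delta,\zeta}(\ell)=0$ otherwise. For $\bar\eta\in\{-1,1\}$ and integers $\ell_1<\ell_2$, $\ell_0\ge0$ let $$R_{1,4}(\bar\eta,[\ell_1,\ell_2])=\{\eta^{\delta,\zeta_1}(\ell_1)=\eta^{\delta,\zeta_1}(\ell_2)=\bar\eta,\ \eta^{\delta,\zeta_4}(\ell)=\bar\eta\ \ \forall\,\ell_1<\ell<\ell_2\},$$ $$R_{1,4,5}(\bar\eta,[\ell_1,\ell_2])(\ell_0)=R_{1,4}(\bar\eta,[\ell_1,\ell_2])\cap\{\eta^{\delta,\zeta_5}(\ell)=\bar\eta\ \ \forall\,\ell_1+\ell_0\le\ell\le\ell_2-\ell_0\}.$$ For an event $F$ depending on the spins in $\Lambda=\{i:\gamma i\in(\ell_1-1,\ell_2]\}$ let $Z^{0,0}_{[\ell_1,\ell_2]}(F)=\sum_{\sigma_\Lambda\in F}e^{-\beta H_\gamma(\sigma_\Lambda)}$. **Theorem 6.4.** Given $(\beta,\theta)$ as above there exist $\gamma_0,d_0,\zeta_0\in(0,1)$, depending only on $\beta,\theta$, with $\alpha(\beta,\theta,\zeta_0)>0$,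 such that for all $\gamma,\delta^*$ as above with $0<\gamma\le\gamma_0$, $\gamma/\delta^*\le d_0$, and all $p\in\mathbb N$ with $(p+2)\delta^*\log\frac1\gamma\le\frac1{64}$, there is an event $\Omega_{RE}=\Omega_{RE}(\gamma,\delta^*,p)$ with $\mathbb P[\Omega_{RE}]\ge1-\gamma^2$ such that for every $\omega\in\Omega_{RE}$ the infinite volume Gibbs measure $\mu_{\beta,\theta,\gamma}$ exists and, for every $\kappa$ as above, every $\bar\eta\in\{-1,1\}$, every integer $\ell_0\ge0$, every $\delta$ as above with $1>\delta>\delta^*$, and all $\zeta_0\ge\zeta_4>\zeta_1>\zeta_5\ge8\gamma/\delta^*$, the following holds with $$\mathcal E=\frac\kappa2\,\delta\zeta_5^3-2\zeta_4e^{-2\alpha(\beta,\theta,\zeta_0)\ell_0}-12(1+\theta)(4\ell_0+10)\Big[\delta^*\vee\sqrt{\tfrac\gamma{\delta^*}}\Big].$$ For all integers $\ell_1,\ell_2$ with $[\ell_1,\ell_2]\subset[-\gamma^{-p},\gamma^{-p}]$ and $\ell_2-\ell_1\ge4\ell_0+10$, $$\mu_{\beta,\theta,\gamma}\Big(R_{1,4}(\bar\eta,[\ell_1,\ell_2])\cap\big(R_{1,4,5}(\bar\eta,[\ell_1,\ell_2])(\ell_0)\big)^c\Big)\le\frac2{\gamma^p}e^{-\frac\beta\gamma\mathcal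 E}.$$ Moreover, if $\mathcal E\ge0$, then for the same intervals $Z^{0,0}_{[\ell_1,\ell_2]}\big(R_{1,4,5}(\bar\eta,[\ell_1,\ell_2])(\ell_0)\big)>0$ and $$\frac{Z^{0,0}_{[\ell_1,\ell_2]}\big(R_{1,4}(\bar\eta,[\ell_1,\ell_2])\cap(R_{1,4,5}(\bar\eta,[\ell_1,\ell_2])(\ell_0))^c\big)}{Z^{0,0}_{[\ell_1,\ell_2]}\big(R_{1,4,5}(\bar\eta,[\ell_1,\ell_2])(\ell_0)\big)}\le\frac2{\gamma^p}e^{-\frac\beta\gamma\mathcal E}.$$ -/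

import Mathlib

open MeasureTheory ProbabilityTheory Filter Topology

namespace RFKac

noncomputable section

/-! ### Random field Curie-Weiss model: phases and free energy -/

/-- The mean field map `g_β(m, θ)`. -/
def gMap (β θ m : ℝ) : ℝ :=
  (1 / 2) * Real.tanh (β * (m + θ)) + (1 / 2) * Real.tanh (β * (m - θ))

/-- The threshold `θ_{1,c}(β) = β⁻¹ artanh ((1 - β⁻¹)^{1/2})`. -/
def theta1c (β : ℝ) : ℝ := (1 / β) * Real.artanh (Real.sqrt (1 - β⁻¹))

/-- The region of the parameters `(β, θ)` with exactly two phases. -/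
def TwoPhaseRegion (β θ : ℝ) : Prop :=
  (1 < β ∧ β ≤ 3 / 2 ∧ 0 < θ ∧ θ < theta1c β) ∨ (3 / 2 < β ∧ 0 < θ ∧ θ ≤ theta1c β)

/-- `m̃_β`: the largest solution of `m = g_β(m, θ)`. All solutions lie in `[-1, 1]`; in the two-phase
region they are `-m̃_β, 0, m̃_β` with `m̃_β > 0`. -/
def mTilde (β θ : ℝ) : ℝ := sSup {m : ℝ | m = gMap β θ m}

/-- First component `m_{β,1}` of the `+` phase `m_β`. -/
def mPhase1 (β θ : ℝ) : ℝ := Real.tanh (β * (mTilde β θ + θ))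

/-- Second component `m_{β,2}` of the `+` phase `m_β`. -/
def mPhase2 (β θ : ℝ) : ℝ := Real.tanh (β * (mTilde β θ - θ))

/-- `α(β, θ, ζ) = - log (∂g_β/∂m) (m̃_β - ζ/2, θ)`. -/
def alphaRate (β θ ζ : ℝ) : ℝ := - Real.log (deriv (gMap β θ) (mTilde β θ - ζ / 2))

/-- The entropy function `𝓘(m)` (with `0 log 0 = 0`). -/
def entropyI (m : ℝ) : ℝ :=
  (1 + m) / 2 * Real.log ((1 + m) / 2) + (1 - m) / 2 * Real.log ((1 - m) / 2)

/-- The canonical free energy `f_{β,θ}(m₁, m₂)`. -/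
def freeEnergy (β θ m₁ m₂ : ℝ) : ℝ :=
  -(m₁ + m₂) ^ 2 / 8 - θ / 2 * (m₁ - m₂) + 1 / (2 * β) * (entropyI m₁ + entropyI m₂)

/-- `ℓ¹` distance of `(m₁, m₂)` from the `+` phase `m_β = (m_{β,1}, m_{β,2})`. -/
def distPlus (β θ m₁ m₂ : ℝ) : ℝ := |m₁ - mPhase1 β θ| + |m₂ - mPhase2 β θ|

/-- `ℓ¹` distance of `(m₁, m₂)` from the `-` phase `T m_β = (-m_{β,2}, -m_{β,1})`. -/
def distMinus (β θ m₁ m₂ : ℝ) : ℝ := |m₁ + mPhase2 β θ| + |m₂ + mPhase1 β θ|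

/-- `κ` is a constant of quadratic growth of the free energy around its two minimizers. -/
def IsGrowthConstant (β θ κ : ℝ) : Prop :=
  0 < κ ∧ ∀ m₁ ∈ Set.Icc (-1 : ℝ) 1, ∀ m₂ ∈ Set.Icc (-1 : ℝ) 1,
    κ * min (distPlus β θ m₁ m₂ ^ 2) (distMinus β θ m₁ m₂ ^ 2) ≤
      freeEnergy β θ m₁ m₂ - freeEnergy β θ (mPhase1 β θ) (mPhase2 β θ)

/-! ### The random field Kac model -/

/-- The signs `h_i` are i.i.d. symmetric Bernoulli variables with values `±1`. -/
structure IsBernoulliField {Ω : Type*} [MeasurableSpace Ω] (P : Measure Ω) (h : ℤ → Ω → ℝ) :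
    Prop where
  measurable : ∀ i, Measurable (h i)
  indep : iIndepFun h P
  prob_one : ∀ i, P.real {ω | h i ω = 1} = 1 / 2
  prob_neg_one : ∀ i, P.real {ω | h i ω = -1} = 1 / 2

/-- Spin configurations on `ℤ`; `true` stands for `+1` and `false` for `-1`. -/
abbrev Config : Type := ℤ → Bool

/-- The value `±1` of a spin. -/
def spin (b : Bool) : ℝ := if b then 1 else -1

/-- The interaction profile `J(r) = 1_{|r| ≤ 1/2}`. -/
def kacJ (r : ℝ) : ℝ := if |r| ≤ 1 / 2 then 1 else 0

/-- The Hamiltonian `H_γ(σ_Λ)` in the finite volume `Λ` with free boundary condition; it depends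
only on the spins in `Λ`. -/
def hamiltonian (θ γ : ℝ) (h : ℤ → ℝ) (Λ : Finset ℤ) (σ : Config) : ℝ :=
  -(1 / 2) * ∑ i ∈ Λ, ∑ j ∈ Λ, γ * kacJ (γ * ((i : ℝ) - (j : ℝ))) * spin (σ i) * spin (σ j)
    - θ * ∑ i ∈ Λ, h i * spin (σ i)

/-- Extension of a configuration on `Λ` to `ℤ` (by a fixed value outside `Λ`). -/
def extend (Λ : Finset ℤ) (s : Λ → Bool) : Config :=
  fun i => if hi : i ∈ Λ then s ⟨i, hi⟩ else true

open Classical in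
/-- The partition function in `Λ` with free boundary condition, restricted to an event `F`
that depends on the spins in `Λ` only. -/
def partitionFn (β θ γ : ℝ) (h : ℤ → ℝ) (Λ : Finset ℤ) (F : Set Config) : ℝ :=
  ∑ s : Λ → Bool,
    if extend Λ s ∈ F then Real.exp (-β * hamiltonian θ γ h Λ (extend Λ s)) else 0

lemma partitionFn_univ_pos (β θ γ : ℝ) (h : ℤ → ℝ) (Λ : Finset ℤ) :
    0 < partitionFn β θ γ h Λ Set.univ := by
  unfold partitionFn
  simp only [Set.mem_univ, if_true]
  exact Finset.sum_pos (fun s _ => Real.exp_pos _) Finset.univ_nonempty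

/-- The finite volume Gibbs measure with free boundary condition, as a measure on configurations
on `ℤ` (the spins outside `Λ` are frozen). -/
def gibbsMeasure (β θ γ : ℝ) (h : ℤ → ℝ) (Λ : Finset ℤ) : Measure Config :=
  ∑ s : Λ → Bool,
    ENNReal.ofReal (Real.exp (-β * hamiltonian θ γ h Λ (extend Λ s)) /
      partitionFn β θ γ h Λ Set.univ) • Measure.dirac (extend Λ s)

instance gibbsMeasure_isProbabilityMeasure (β θ γ : ℝ) (h : ℤ → ℝ) (Λ : Finset ℤ) :
    IsProbabilityMeasure (gibbsMeasure β θ γ h Λ) := by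
  constructor
  have hZ := partitionFn_univ_pos β θ γ h Λ
  unfold gibbsMeasure
  simp only [Measure.coe_finsetSum, Finset.sum_apply, Measure.smul_apply, measure_univ,
    smul_eq_mul, mul_one]
  rw [← ENNReal.ofReal_sum_of_nonneg (fun s _ => div_nonneg (Real.exp_pos _).le hZ.le),
    ← Finset.sum_div]
  have : ∑ s : Λ → Bool, Real.exp (-β * hamiltonian θ γ h Λ (extend Λ s)) =
      partitionFn β θ γ h Λ Set.univ := by
    simp [partitionFn]
  rw [this, div_self hZ.ne', ENNReal.ofReal_one]

/-- `gibbsMeasure`, bundled. -/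
def gibbs (β θ γ : ℝ) (h : ℤ → ℝ) (Λ : Finset ℤ) : ProbabilityMeasure Config :=
  ⟨gibbsMeasure β θ γ h Λ, inferInstance⟩

/-- `μ` is the infinite volume Gibbs measure: the weak limit of the finite volume Gibbs measures
along `[-L, L] ∩ ℤ`, `L → ∞`. -/
def IsInfiniteVolumeGibbs (β θ γ : ℝ) (h : ℤ → ℝ) (μ : ProbabilityMeasure Config) : Prop :=
  Tendsto (fun L : ℕ => gibbs β θ γ h (Finset.Icc (-(L : ℤ)) (L : ℤ))) atTop (𝓝 μ)

/-! ### Coarse graining -/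

/-- The sites `i` whose macroscopic position `γ i` lies in `(a, b]`. -/
def sites (γ a b : ℝ) : Finset ℤ := Finset.Ioc ⌊a / γ⌋ ⌊b / γ⌋

lemma mem_sites {γ : ℝ} (hγ : 0 < γ) (a b : ℝ) (i : ℤ) :
    i ∈ sites γ a b ↔ γ * i ∈ Set.Ioc a b := by
  simp only [sites, Finset.mem_Ioc, Int.floor_lt, Int.le_floor, Set.mem_Ioc, div_lt_iff₀ hγ,
    le_div_iff₀ hγ, mul_comm γ]

/-- `𝒞_δ((a, b])`: the `x ∈ ℤ` such that the cell `((x - 1) δ, x δ]` is contained in `(a, b]`. -/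
def cells (δ a b : ℝ) : Finset ℤ := Finset.Icc (⌈a / δ⌉ + 1) ⌊b / δ⌋

lemma mem_cells {δ : ℝ} (hδ : 0 < δ) (a b : ℝ) (x : ℤ) :
    x ∈ cells δ a b ↔ Set.Ioc (((x : ℝ) - 1) * δ) (x * δ) ⊆ Set.Ioc a b := by
  have hlt : ((x : ℝ) - 1) * δ < x * δ := by nlinarith
  rw [Set.Ioc_subset_Ioc_iff hlt, cells, Finset.mem_Icc, Int.le_floor, le_div_iff₀ hδ,
    ← le_sub_iff_add_le, Int.ceil_le, div_le_iff₀ hδ]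
  push_cast
  tauto

/-- The block `A(x)`: sites `i` with `γ i ∈ ((x - 1) δ*, x δ*]`. -/
def block (γ δs : ℝ) (x : ℤ) : Finset ℤ := sites γ (((x : ℝ) - 1) * δs) (x * δs)

open Classical in
/-- `A^±(x)`: the sites of the block `A(x)` where the field equals `τ = ±1`. -/
def blockField (γ δs : ℝ) (h : ℤ → ℝ) (τ : ℝ) (x : ℤ) : Finset ℤ :=
  (block γ δs x).filter (fun i => h i = τ)

/-- The first (leftmost) `k` elements of a finite set of sites. -/
def firstElements (k : ℕ) (S : Finset ℤ) : Finset ℤ :=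
  S.filter (fun i => (S.filter (fun j => j ≤ i)).card ≤ k)

open Classical in
/-- `B^+(x)`. Let `K = δ*γ⁻¹/2` be half of the size of `A(x)`. If `|A^+(x)| ≥ K`
(that is `λ(x) ∈ {0, 1}`), then `B^+(x)` consists of the first `K` elements of `A^+(x)`
(all of it if `λ(x) = 0`); if `|A^+(x)| < K` (that is `λ(x) = -1`), then `B^-(x)` consists of the
first `K` elements of `A^-(x)` and `B^+(x)` is the rest of the block. -/
def blockPlus (γ δs : ℝ) (h : ℤ → ℝ) (x : ℤ) : Finset ℤ :=
  if ⌊δs / γ / 2⌋₊ ≤ (blockField γ δs h 1 x).card then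
    firstElements ⌊δs / γ / 2⌋₊ (blockField γ δs h 1 x)
  else block γ δs x \ firstElements ⌊δs / γ / 2⌋₊ (blockField γ δs h (-1) x)

/-- `B^-(x) = A(x) \ B^+(x)`. -/
def blockMinus (γ δs : ℝ) (h : ℤ → ℝ) (x : ℤ) : Finset ℤ :=
  block γ δs x \ blockPlus γ δs h x

/-- `m^{δ*}(+, x, σ)`. -/
def mPlus (γ δs : ℝ) (h : ℤ → ℝ) (σ : Config) (x : ℤ) : ℝ :=
  2 * γ / δs * ∑ i ∈ blockPlus γ δs h x, spin (σ i)

/-- `m^{δ*}(-, x, σ)`. -/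
def mMinus (γ δs : ℝ) (h : ℤ → ℝ) (σ : Config) (x : ℤ) : ℝ :=
  2 * γ / δs * ∑ i ∈ blockMinus γ δs h x, spin (σ i)

open Classical in
/-- The phase indicator `η^{δ,ζ}(ℓ) ∈ {1, -1, 0}`. -/
def eta (β θ γ δs δ ζ : ℝ) (h : ℤ → ℝ) (σ : Config) (l : ℤ) : ℤ :=
  if ∀ u ∈ cells δ ((l : ℝ) - 1) l,
      δs / δ * ∑ x ∈ cells δs (((u : ℝ) - 1) * δ) (u * δ),
        distPlus β θ (mPlus γ δs h σ x) (mMinus γ δs h σ x) ≤ ζ then 1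
  else if ∀ u ∈ cells δ ((l : ℝ) - 1) l,
      δs / δ * ∑ x ∈ cells δs (((u : ℝ) - 1) * δ) (u * δ),
        distMinus β θ (mPlus γ δs h σ x) (mMinus γ δs h σ x) ≤ ζ then -1
  else 0

/-- `R_{1,4}(η̄, [ℓ₁, ℓ₂])`: the profile is `ζ₁`-close to the phase `η̄` at the two end points
and `ζ₄`-close to it in between. -/
def R14 (β θ γ δs δ ζ₁ ζ₄ : ℝ) (h : ℤ → ℝ) (ηbar l₁ l₂ : ℤ) : Set Config :=
  {σ | eta β θ γ δs δ ζ₁ h σ l₁ = ηbar ∧ eta β θ γ δs δ ζ₁ h σ l₂ = ηbar ∧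
    ∀ l ∈ Set.Icc (l₁ + 1) (l₂ - 1), eta β θ γ δs δ ζ₄ h σ l = ηbar}

/-- `R_5(η̄, [ℓ₁, ℓ₂])`: the profile is `ζ₅`-close to the phase `η̄` throughout. -/
def R5 (β θ γ δs δ ζ₅ : ℝ) (h : ℤ → ℝ) (ηbar l₁ l₂ : ℤ) : Set Config :=
  {σ | ∀ l ∈ Set.Icc l₁ l₂, eta β θ γ δs δ ζ₅ h σ l = ηbar}

/-- `R_{1,4,5}(η̄, [ℓ₁, ℓ₂])(ℓ₀)`. -/
def R145 (β θ γ δs δ ζ₁ ζ₄ ζ₅ : ℝ) (h : ℤ → ℝ) (ηbar l₁ l₂ : ℤ) (l₀ : ℕ) : Set Config :=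
  R14 β θ γ δs δ ζ₁ ζ₄ h ηbar l₁ l₂ ∩ R5 β θ γ δs δ ζ₅ h ηbar (l₁ + l₀) (l₂ - l₀)

/-- The partition function `Z^{0,0}_{[ℓ₁, ℓ₂]}(F)`: the volume consists of the unit blocks
`(ℓ - 1, ℓ]`, `ℓ = ℓ₁, …, ℓ₂`, and there is no interaction with its complement. -/
def Z00 (β θ γ : ℝ) (h : ℤ → ℝ) (l₁ l₂ : ℤ) (F : Set Config) : ℝ :=
  partitionFn β θ γ h (sites γ ((l₁ : ℝ) - 1) l₂) F

/-- The expression in braces in the exponent of the estimate. -/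
def rateExponent (β θ κ ζ₀ γ δs δ ζ₄ ζ₅ : ℝ) (l₀ : ℕ) : ℝ :=
  κ / 2 * δ * ζ₅ ^ 3 - 2 * ζ₄ * Real.exp (-(alphaRate β θ ζ₀ * (2 * (l₀ : ℝ))))
    - 12 * (1 + θ) * (4 * (l₀ : ℝ) + 10) * max δs (Real.sqrt (γ / δs))

end

end RFKac

open RFKac

namespace RFKac

/-! ### The mean field map -/

/-! The argument is an energy–entropy comparison at the level of block magnetizations. Every block
is cut into two halves of `K` sites on which the field is, up to the imbalance of the block, equal
to +1 and to -1. A profile of half-block counts `n` is realized by a product of binomial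
coefficients `K.choose n`, which is an exponential of the entropy up to factors `K + 1`
(`choose_mul_exp_le_one`, `one_le_choose_mul_exp`). The Kac interaction is replaced by a block
kernel with an error governed by δ* (`hamiltonian_change_le`).

Take a configuration in the event of `R14` that fails to be ζ₅-close to the phase in some unit block
l, and change it only at unit blocks closer than l₀ to l. A half-block average m with phase value a
and mean field value T = tanh β(local field ± θ) is moved part of the way towards its projection p
onto the segment between a and T (`exists_move`). The distance |m - a| does not increase, so the
configuration stays in `R14`. Strong convexity of the entropy yields a gain of order (m - p)², even
after paying for the interaction of simultaneous moves. Counting configurations profile by profile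
turns the gain into a bound on partition functions (`HalfBlocks.partitionFn_le`).

The total gain is bounded below by a contraction argument. One has |m - a| ≤ |m - p| + |T - a|. The
mean field map has slope less than 1 at its largest fixed point (`deriv_gMap_mTilde_lt_one`), so |T
- a| is controlled by a contracted local average of the deviations. Iterating this half a unit at a
time from l outwards (`sum_sq_le_of_contraction`), the deviation at l is bounded by the accumulated
|m - p| plus a boundary term damped like ρ^(2 l₀ - 1). When the rate 𝓔 is nonnegative, the boundary
term is too small to explain a deviation of size ζ₅ (`damping`), so the sum of the (m - p)² is of
order k ζ₅². All error terms fit into the last term of 𝓔 (`exponent_bound`).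

A union over l bounds the bad partition function by a small multiple of the one of `R14`, and the
bad part of the latter is absorbed on the left. When 𝓔 is negative, the bound on the Gibbs measure
exceeds 1 and is trivial. The growth inequality for κ enters only through an upper bound on κ
(`IsGrowthConstant.exists_bound`), which allows ζ₀ to be chosen so small that κ ζ₀ is small.

Randomness matters only for the balance of the field in the blocks, which is a sub-Gaussian estimate
(`IsBernoulliField.exists_balanced`). The infinite volume limit exists for every field, because in
one dimension with finite range the influence of the boundary decays exponentially
(`exists_isInfiniteVolumeGibbs`). -/

lemma tanh_strictMono : StrictMono Real.tanh := by
  intro x y hxy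
  rw [Real.tanh_eq_sinh_div_cosh, Real.tanh_eq_sinh_div_cosh,
    div_lt_div_iff₀ (Real.cosh_pos x) (Real.cosh_pos y)]
  have h : 0 < Real.sinh (y - x) := Real.sinh_pos_iff.2 (by linarith)
  rw [Real.sinh_sub] at h
  linarith

/-- The addition theorems merge the two tangents into one quotient in the doubled angles. In this
form the sign of the derivative of `gMap β θ m / m` can be studied with cosh(2βθ) as the only
parameter. -/
lemma gMap_eq (β θ m : ℝ) :
    gMap β θ m =
      Real.sinh (2 * β * m) / (Real.cosh (2 * β * m) + Real.cosh (2 * β * θ)) := by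
  have e1 : Real.sinh (2 * β * m) = 2 * Real.sinh (β * m) * Real.cosh (β * m) := by
    rw [← Real.sinh_two_mul]; ring_nf
  have e2 : Real.cosh (2 * β * m) = Real.cosh (β * m) ^ 2 + Real.sinh (β * m) ^ 2 := by
    rw [← Real.cosh_two_mul]; ring_nf
  have e3 : Real.cosh (2 * β * θ) = Real.cosh (β * θ) ^ 2 + Real.sinh (β * θ) ^ 2 := by
    rw [← Real.cosh_two_mul]; ring_nf
  have h1 := Real.cosh_sq (β * m)
  have h2 := Real.cosh_sq (β * θ)
  have p1 : 0 < Real.cosh (β * m) * Real.cosh (β * θ) + Real.sinh (β * m) * Real.sinh (β * θ) := by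
    rw [← Real.cosh_add]; exact Real.cosh_pos _
  have p2 : 0 < Real.cosh (β * m) * Real.cosh (β * θ) - Real.sinh (β * m) * Real.sinh (β * θ) := by
    rw [← Real.cosh_sub]; exact Real.cosh_pos _
  unfold gMap
  rw [Real.tanh_eq_sinh_div_cosh, Real.tanh_eq_sinh_div_cosh, mul_add, mul_sub, Real.sinh_add,
    Real.cosh_add, Real.sinh_sub, Real.cosh_sub, e1, e2, e3, h1, h2]
  rw [mul_div_assoc', mul_div_assoc', div_add_div _ _ p1.ne' p2.ne', div_eq_div_iff
    (mul_pos p1 p2).ne' (by positivity)]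
  generalize Real.sinh (β * m) = S at *
  generalize Real.cosh (β * m) = C at *
  generalize Real.sinh (β * θ) = s at *
  generalize Real.cosh (β * θ) = c at *
  have h3 : (C * c + S * s) * (C * c - S * s) = 1 + S ^ 2 + s ^ 2 := by
    have : (C * c + S * s) * (C * c - S * s) = C ^ 2 * c ^ 2 - S ^ 2 * s ^ 2 := by ring
    rw [this, h1, h2]; ring
  rw [h3]
  have h4 : 1 * (S * c + C * s) * (2 * (C * c - S * s)) +
      2 * (C * c + S * s) * (1 * (S * c - C * s))
      = 4 * (S * C * (c ^ 2 - s ^ 2)) := by ring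
  rw [show (1 / 2 * (S * c + C * s) * (C * c - S * s) + (C * c + S * s) * (1 / 2 * (S * c - C * s)))
    = S * C * (c ^ 2 - s ^ 2) by ring, h2]
  ring

lemma hasDerivAt_gMap (β θ m : ℝ) :
    HasDerivAt (gMap β θ)
      (2 * β * (1 + Real.cosh (2 * β * θ) * Real.cosh (2 * β * m)) /
        (Real.cosh (2 * β * m) + Real.cosh (2 * β * θ)) ^ 2) m := by
  have hf : gMap β θ = fun m => Real.sinh (2 * β * m) /
      (Real.cosh (2 * β * m) + Real.cosh (2 * β * θ)) := funext (gMap_eq β θ)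
  rw [hf]
  have h0 : HasDerivAt (fun m : ℝ => 2 * β * m) (2 * β) m := by
    simpa using (hasDerivAt_id m).const_mul (2 * β)
  have hp : Real.cosh (2 * β * m) + Real.cosh (2 * β * θ) ≠ 0 :=
    (add_pos (Real.cosh_pos _) (Real.cosh_pos _)).ne'
  have := h0.sinh.div (h0.cosh.add_const (Real.cosh (2 * β * θ))) hp
  refine this.congr_deriv ?_
  congr 1
  have := Real.cosh_sq (2 * β * m)
  linear_combination (2 * β) * this

lemma deriv_gMap (β θ m : ℝ) :
    deriv (gMap β θ) m = 2 * β * (1 + Real.cosh (2 * β * θ) * Real.cosh (2 * β * m)) /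
        (Real.cosh (2 * β * m) + Real.cosh (2 * β * θ)) ^ 2 := (hasDerivAt_gMap β θ m).deriv

lemma deriv_gMap_pos {β : ℝ} (hβ : 0 < β) (θ m : ℝ) : 0 < deriv (gMap β θ) m := by
  rw [deriv_gMap]
  have := Real.cosh_pos (2 * β * m)
  have := Real.cosh_pos (2 * β * θ)
  positivity

lemma continuous_deriv_gMap (β θ : ℝ) : Continuous (deriv (gMap β θ)) := by
  rw [funext (deriv_gMap β θ)]
  refine Continuous.div ?_ ?_ fun m => ?_
  · fun_prop
  · fun_prop
  · exact pow_ne_zero _ (add_pos (Real.cosh_pos _) (Real.cosh_pos _)).ne'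

lemma continuous_gMap (β θ : ℝ) : Continuous (gMap β θ) :=
  continuous_iff_continuousAt.2 fun m => (hasDerivAt_gMap β θ m).continuousAt

lemma gMap_neg (β θ m : ℝ) : gMap β θ (-m) = -gMap β θ m := by
  rw [gMap_eq, gMap_eq, mul_neg, Real.sinh_neg, Real.cosh_neg, neg_div]

lemma gMap_lt_one (β θ m : ℝ) : gMap β θ m < 1 := by
  unfold gMap
  linarith [Real.tanh_lt_one (β * (m + θ)), Real.tanh_lt_one (β * (m - θ))]

/-! ### Monotonicity of the ratio g(m)/m -/

lemma sinh_lt_mul_cosh {x : ℝ} (hx : 0 < x) : Real.sinh x < x * Real.cosh x := by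
  have hmono : StrictMonoOn (fun x : ℝ => x * Real.cosh x - Real.sinh x) (Set.Ici 0) := by
    refine strictMonoOn_of_deriv_pos (convex_Ici 0) (by fun_prop) fun y hy => ?_
    rw [interior_Ici] at hy
    have : HasDerivAt (fun x : ℝ => x * Real.cosh x - Real.sinh x)
        (1 * Real.cosh y + y * Real.sinh y - Real.cosh y) y :=
      ((hasDerivAt_id y).mul (Real.hasDerivAt_cosh y)).sub (Real.hasDerivAt_sinh y)
    rw [this.deriv]
    have : 0 < y * Real.sinh y := mul_pos hy (Real.sinh_pos_iff.2 hy)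
    linarith
  have := hmono (Set.mem_Ici.2 le_rfl) (Set.mem_Ici.2 hx.le) hx
  simp at this
  linarith

/-- This is the strict growth of sinh x / x. The derivative of z ↦ x sinh z - z sinh x is x cosh z -
sinh x, which is positive for z > x since x cosh z > x cosh x > sinh x. -/
lemma mul_sinh_lt_mul_sinh {x y : ℝ} (hx : 0 < x) (hxy : x < y) :
    y * Real.sinh x < x * Real.sinh y := by
  have hmono : StrictMonoOn (fun z : ℝ => x * Real.sinh z - z * Real.sinh x) (Set.Ici x) := by
    refine strictMonoOn_of_deriv_pos (convex_Ici x) (by fun_prop) fun z hz => ?_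
    rw [interior_Ici] at hz
    have : HasDerivAt (fun z : ℝ => x * Real.sinh z - z * Real.sinh x)
        (x * Real.cosh z - 1 * Real.sinh x) z :=
      ((Real.hasDerivAt_sinh z).const_mul x).sub ((hasDerivAt_id z).mul_const _)
    rw [this.deriv]
    have h1 := sinh_lt_mul_cosh hx
    have h2 : Real.cosh x < Real.cosh z := by
      rw [Real.cosh_lt_cosh, abs_of_pos hx, abs_of_pos (hx.trans hz)]; exact hz
    nlinarith
  have := hmono (Set.mem_Ici.2 le_rfl) (Set.mem_Ici.2 hxy.le) hxy
  simp at this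
  linarith

/-- The numerator of the derivative of `A ↦ sinh A / (A * (cosh A + c))`. -/
noncomputable def ratioNum (c A : ℝ) : ℝ :=
  A * (1 + c * Real.cosh A) - Real.sinh A * (Real.cosh A + c)

/-- For A > 0 the sign is that of c A - 2 sinh A, which can change only from plus to minus because
sinh A / A increases. So `ratioNum c` vanishes at 0 and can only rise first and fall afterwards; the
next two lemmas exploit this shape. -/
lemma hasDerivAt_ratioNum (c A : ℝ) :
    HasDerivAt (ratioNum c) (Real.sinh A * (c * A - 2 * Real.sinh A)) A := by
  have := ((hasDerivAt_id A).mul (((Real.hasDerivAt_cosh A).const_mul c).const_add 1)).sub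
    ((Real.hasDerivAt_sinh A).mul ((Real.hasDerivAt_cosh A).add_const c))
  refine this.congr_deriv ?_
  have := Real.cosh_sq A
  simp only [id]
  linear_combination -this

lemma continuous_ratioNum (c : ℝ) : Continuous (ratioNum c) := by
  unfold ratioNum; fun_prop

lemma ratioNum_pos_of_slope {c A : ℝ} (hA : 0 < A) (h : 0 ≤ c * A - 2 * Real.sinh A) :
    0 < ratioNum c A := by
  have hmono : StrictMonoOn (ratioNum c) (Set.Icc 0 A) := by
    refine strictMonoOn_of_deriv_pos (convex_Icc 0 A) (continuous_ratioNum c).continuousOn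
      fun z hz => ?_
    rw [interior_Icc] at hz
    rw [(hasDerivAt_ratioNum c z).deriv]
    have h1 := mul_sinh_lt_mul_sinh hz.1 hz.2
    refine mul_pos (Real.sinh_pos_iff.2 hz.1) ?_
    by_contra hcon
    have h2 : A * (c * z) ≤ A * (2 * Real.sinh z) := by nlinarith
    nlinarith [hz.1]
  have := hmono (Set.left_mem_Icc.2 hA.le) (Set.right_mem_Icc.2 hA.le) hA
  simpa [ratioNum] using this

/-- A nonpositive value at A would place A on the falling branch, and the function would be negative
at every later point, in particular at B. -/
lemma ratioNum_pos {c A B : ℝ} (hA : 0 < A) (hAB : A < B) (hB : 0 ≤ ratioNum c B) :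
    0 < ratioNum c A := by
  by_contra hcon
  have hs : c * A - 2 * Real.sinh A < 0 := by
    by_contra h
    exact hcon (ratioNum_pos_of_slope hA (not_lt.1 h))
  have hanti : StrictAntiOn (ratioNum c) (Set.Icc A B) := by
    refine strictAntiOn_of_deriv_neg (convex_Icc A B) (continuous_ratioNum c).continuousOn
      fun z hz => ?_
    rw [interior_Icc] at hz
    rw [(hasDerivAt_ratioNum c z).deriv]
    have h1 := mul_sinh_lt_mul_sinh hA hz.1
    have hz0 : 0 < z := hA.trans hz.1
    refine mul_neg_of_pos_of_neg (Real.sinh_pos_iff.2 hz0) ?_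
    by_contra h
    have : z * (c * A) < z * (2 * Real.sinh A) := by nlinarith
    nlinarith
  have := hanti (Set.left_mem_Icc.2 hAB.le) (Set.right_mem_Icc.2 hAB.le) hAB
  linarith

lemma hasDerivAt_gMap_div {β θ m : ℝ} (hm : 0 < m) :
    ∃ C : ℝ, 0 < C ∧ HasDerivAt (fun m => gMap β θ m / m)
      (C * ratioNum (Real.cosh (2 * β * θ)) (2 * β * m)) m := by
  have hp : 0 < Real.cosh (2 * β * m) + Real.cosh (2 * β * θ) :=
    add_pos (Real.cosh_pos _) (Real.cosh_pos _)
  refine ⟨1 / ((Real.cosh (2 * β * m) + Real.cosh (2 * β * θ)) ^ 2 * m ^ 2), by positivity, ?_⟩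
  have := (hasDerivAt_gMap β θ m).div (hasDerivAt_id m) hm.ne'
  refine this.congr_deriv ?_
  rw [gMap_eq]
  unfold ratioNum
  simp only [id]
  field_simp

lemma strictMonoOn_gMap_div {β θ b : ℝ}
    (h : ∀ m ∈ Set.Ioo 0 b, 0 < ratioNum (Real.cosh (2 * β * θ)) (2 * β * m)) :
    StrictMonoOn (fun m => gMap β θ m / m) (Set.Ioc 0 b) := by
  refine strictMonoOn_of_deriv_pos (convex_Ioc 0 b) ?_ fun m hm => ?_
  · exact (continuous_gMap β θ).continuousOn.div continuousOn_id fun m hm => hm.1.ne'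
  · rw [interior_Ioc] at hm
    obtain ⟨C, hC, hd⟩ := hasDerivAt_gMap_div (β := β) (θ := θ) hm.1
    rw [hd.deriv]
    exact mul_pos hC (h m hm)

lemma tendsto_gMap_div (β θ : ℝ) :
    Tendsto (fun m => gMap β θ m / m) (𝓝[>] 0) (𝓝 (2 * β / (1 + Real.cosh (2 * β * θ)))) := by
  have h0 : gMap β θ 0 = 0 := by simp [gMap_eq]
  have h := (hasDerivAt_gMap β θ 0).tendsto_slope_zero_right
  have hp := Real.cosh_pos (2 * β * θ)
  simp only [zero_add, h0, sub_zero, smul_eq_mul, mul_zero, Real.cosh_zero, mul_one] at h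
  have e : 2 * β * (1 + Real.cosh (2 * β * θ)) / (1 + Real.cosh (2 * β * θ)) ^ 2 =
      2 * β / (1 + Real.cosh (2 * β * θ)) := by
    field_simp
  rw [e] at h
  refine h.congr fun m => ?_
  rw [div_eq_inv_mul]

/-! ### The two-phase region and the largest fixed point -/

lemma TwoPhaseRegion.one_lt {β θ : ℝ} (h : TwoPhaseRegion β θ) : 1 < β := by
  rcases h with ⟨h, -⟩ | ⟨h, -⟩ <;> linarith

lemma TwoPhaseRegion.theta_pos {β θ : ℝ} (h : TwoPhaseRegion β θ) : 0 < θ := by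
  rcases h with ⟨-, -, h, -⟩ | ⟨-, h, -⟩ <;> exact h

/-- Since tanh² = 1 - 1/cosh², the condition θ < θ_{1,c} says cosh²(βθ) < β, and doubling the angle
gives the first case. Equality is admitted only for β > 3/2, and then 2β - 1 > 2, which compensates
for the slope at 0 being exactly 1. -/
lemma TwoPhaseRegion.cosh_cases {β θ : ℝ} (h : TwoPhaseRegion β θ) :
    Real.cosh (2 * β * θ) < 2 * β - 1 ∨
      (Real.cosh (2 * β * θ) = 2 * β - 1 ∧ 2 < Real.cosh (2 * β * θ)) := by
  have hβ := h.one_lt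
  have hβ0 : 0 < β := by linarith
  have hinv : β⁻¹ < 1 := inv_lt_one_of_one_lt₀ hβ
  have hinv0 : 0 < β⁻¹ := inv_pos.2 hβ0
  have hs1 : Real.sqrt (1 - β⁻¹) < 1 := by
    rw [Real.sqrt_lt' one_pos]; linarith
  have hs0 : 0 ≤ Real.sqrt (1 - β⁻¹) := Real.sqrt_nonneg _
  have hta : Real.tanh (Real.artanh (Real.sqrt (1 - β⁻¹))) = Real.sqrt (1 - β⁻¹) :=
    Real.tanh_artanh ⟨by linarith, hs1⟩
  have hsq : Real.sqrt (1 - β⁻¹) ^ 2 = 1 - β⁻¹ := Real.sq_sqrt (by linarith)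
  have hβt : β * theta1c β = Real.artanh (Real.sqrt (1 - β⁻¹)) := by
    unfold theta1c; field_simp
  have hc2 : Real.cosh (2 * β * θ) = 2 * Real.cosh (β * θ) ^ 2 - 1 := by
    rw [mul_assoc, Real.cosh_two_mul, Real.sinh_sq]; ring
  have hcp : 0 < Real.cosh (β * θ) ^ 2 := by have := Real.cosh_pos (β * θ); positivity
  have htc : Real.tanh (β * θ) ^ 2 = 1 - (Real.cosh (β * θ) ^ 2)⁻¹ := by
    rw [Real.tanh_eq_sinh_div_cosh, div_pow, Real.sinh_sq]; field_simp
  have ht0 : 0 ≤ Real.tanh (β * θ) := by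
    have := tanh_strictMono.monotone (mul_pos hβ0 h.theta_pos).le
    simpa using this
  have hlt : θ < theta1c β → Real.cosh (2 * β * θ) < 2 * β - 1 := by
    intro hθ
    have h1 : Real.tanh (β * θ) < Real.sqrt (1 - β⁻¹) := by
      rw [← hta, ← hβt]; exact tanh_strictMono (by nlinarith)
    have h2 : Real.tanh (β * θ) ^ 2 < 1 - β⁻¹ := by rw [← hsq]; nlinarith
    rw [htc] at h2
    have h3 : β⁻¹ < (Real.cosh (β * θ) ^ 2)⁻¹ := by linarith
    rw [inv_lt_inv₀ hβ0 hcp] at h3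
    rw [hc2]; linarith
  rcases h with ⟨-, -, -, h⟩ | ⟨hb, -, h⟩
  · exact Or.inl (hlt h)
  · rcases h.lt_or_eq with h | h
    · exact Or.inl (hlt h)
    · right
      have h1 : Real.tanh (β * θ) = Real.sqrt (1 - β⁻¹) := by rw [← hta, ← hβt, h]
      have h2 : Real.tanh (β * θ) ^ 2 = 1 - β⁻¹ := by rw [← hsq, h1]
      rw [htc] at h2
      have h3 : β⁻¹ = (Real.cosh (β * θ) ^ 2)⁻¹ := by linarith
      have h4 : Real.cosh (β * θ) ^ 2 = β := (inv_injective h3).symm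
      rw [hc2, h4]
      exact ⟨rfl, by linarith⟩

lemma one_le_gMap_slope {β θ : ℝ} (h : TwoPhaseRegion β θ) :
    1 ≤ 2 * β / (1 + Real.cosh (2 * β * θ)) := by
  rw [le_div_iff₀ (add_pos one_pos (Real.cosh_pos _))]
  rcases h.cosh_cases with h | ⟨h, -⟩ <;> linarith

/-- Below the threshold the slope of g at 0 exceeds 1. At the threshold the slope equals 1, but
cosh(2βθ) > 2 makes g(m)/m strictly increasing near 0, so the ratio still exceeds 1 there. -/
lemma exists_lt_gMap {β θ : ℝ} (h : TwoPhaseRegion β θ) : ∃ m, 0 < m ∧ m < 1 ∧ m < gMap β θ m := by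
  have hβ : 0 < β := by linarith [h.one_lt]
  have hc := Real.cosh_pos (2 * β * θ)
  have key : ∃ᶠ m in 𝓝[>] (0 : ℝ), 1 < gMap β θ m / m := by
    rcases h.cosh_cases with hlt | ⟨heq, hgt⟩
    · have h1 : 1 < 2 * β / (1 + Real.cosh (2 * β * θ)) := by
        rw [lt_div_iff₀ (by linarith)]; linarith
      exact ((tendsto_gMap_div β θ).eventually_const_lt h1).frequently
    · have hslope : Tendsto (fun A : ℝ => Real.sinh A / A) (𝓝[>] 0) (𝓝 1) := by
        have := (Real.hasDerivAt_sinh 0).tendsto_slope_zero_right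
        simp only [zero_add, Real.sinh_zero, sub_zero, smul_eq_mul, Real.cosh_zero] at this
        exact this.congr fun m => (div_eq_inv_mul _ _).symm
      have hev : ∀ᶠ A in 𝓝[>] (0 : ℝ), Real.sinh A / A < Real.cosh (2 * β * θ) / 2 :=
        hslope.eventually_lt_const (by linarith)
      obtain ⟨b, hb, hb'⟩ := mem_nhdsGT_iff_exists_Ioo_subset.1 hev
      have hb0 : (0 : ℝ) < b := hb
      have hpos : ∀ A ∈ Set.Ioo 0 b, 0 < ratioNum (Real.cosh (2 * β * θ)) A := fun A hA => by
        refine ratioNum_pos_of_slope hA.1 ?_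
        have := hb' hA
        have h1 : Real.sinh A / A < Real.cosh (2 * β * θ) / 2 := this
        rw [div_lt_iff₀ hA.1] at h1
        linarith
      have hmono := strictMonoOn_gMap_div (b := b / (2 * β)) (β := β) (θ := θ) fun m hm =>
        hpos _ ⟨by have := hm.1; positivity, by
          have := hm.2; rw [lt_div_iff₀ (by positivity)] at this; linarith⟩
      have hbb : 0 < b / (2 * β) := by positivity
      have hev2 : ∀ m ∈ Set.Ioo 0 (b / (2 * β)), 1 < gMap β θ m / m := fun m hm => by
        -- The limit at 0 only gives a weak inequality; passing from m/2 to m makes it strict.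
        have h1 : gMap β θ (m / 2) / (m / 2) < gMap β θ m / m :=
          hmono ⟨by linarith [hm.1], by linarith [hm.1, hm.2]⟩ ⟨hm.1, hm.2.le⟩ (by linarith [hm.1])
        refine lt_of_le_of_lt ?_ h1
        have h2 : 2 * β / (1 + Real.cosh (2 * β * θ)) ≤ gMap β θ (m / 2) / (m / 2) := by
          refine le_of_tendsto (tendsto_gMap_div β θ) ?_
          filter_upwards [Ioo_mem_nhdsGT (show (0 : ℝ) < m / 2 by linarith [hm.1])] with z hz
          exact (hmono ⟨hz.1, by linarith [hz.2, hm.2, hm.1]⟩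
            ⟨by linarith [hm.1], by linarith [hm.1, hm.2]⟩ hz.2).le
        exact (one_le_gMap_slope h).trans h2
      exact (Filter.Eventually.frequently (by
        filter_upwards [Ioo_mem_nhdsGT hbb] using hev2))
  obtain ⟨m, hm, hm'⟩ := (key.and_eventually (Ioo_mem_nhdsGT one_pos)).exists
  refine ⟨m, hm'.1, hm'.2, ?_⟩
  rwa [lt_div_iff₀ hm'.1, one_mul] at hm

lemma isGreatest_mTilde (β θ : ℝ) : IsGreatest {m : ℝ | m = gMap β θ m} (mTilde β θ) := by
  have hbdd : BddAbove {m : ℝ | m = gMap β θ m} :=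
    ⟨1, fun m (hm : m = gMap β θ m) => by rw [hm]; exact (gMap_lt_one β θ m).le⟩
  have hclosed : IsClosed {m : ℝ | m = gMap β θ m} :=
    isClosed_eq continuous_id (continuous_gMap β θ)
  have hne : {m : ℝ | m = gMap β θ m}.Nonempty := ⟨0, by simp [gMap_eq]⟩
  exact ⟨hclosed.csSup_mem hne hbdd, fun m hm => le_csSup hbdd hm⟩

lemma gMap_mTilde (β θ : ℝ) : gMap β θ (mTilde β θ) = mTilde β θ :=
  (isGreatest_mTilde β θ).1.symm

lemma mTilde_pos {β θ : ℝ} (h : TwoPhaseRegion β θ) : 0 < mTilde β θ := by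
  obtain ⟨m, hm0, hm1, hm⟩ := exists_lt_gMap h
  have hcont : ContinuousOn (fun x => gMap β θ x - x) (Set.Icc m 1) :=
    ((continuous_gMap β θ).sub continuous_id).continuousOn
  obtain ⟨x, hx, hx0⟩ := intermediate_value_Icc' hm1.le hcont
    (show (0 : ℝ) ∈ Set.Icc (gMap β θ 1 - 1) (gMap β θ m - m) from
      ⟨by linarith [gMap_lt_one β θ 1], by linarith⟩)
  have : x ≤ mTilde β θ := (isGreatest_mTilde β θ).2 (show x = gMap β θ x by linarith)
  linarith [hx.1]

/-- If the slope were at least 1, `ratioNum` would be nonnegative at the fixed point, hence positive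
before it, and g(m)/m would increase strictly up to its value 1 there. Its limit at 0 would then be
less than 1, contrary to `one_le_gMap_slope`. This also covers the critical θ. -/
lemma deriv_gMap_mTilde_lt_one {β θ : ℝ} (h : TwoPhaseRegion β θ) :
    deriv (gMap β θ) (mTilde β θ) < 1 := by
  by_contra hcon
  rw [not_lt] at hcon
  have hβ : 0 < β := by linarith [h.one_lt]
  have hm := mTilde_pos h
  have hfix := gMap_mTilde β θ
  set m := mTilde β θ
  have hc := Real.cosh_pos (2 * β * θ)
  have hA := Real.cosh_pos (2 * β * m)
  have hN : 0 ≤ ratioNum (Real.cosh (2 * β * θ)) (2 * β * m) := by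
    have h1 : ratioNum (Real.cosh (2 * β * θ)) (2 * β * m) =
        (Real.cosh (2 * β * m) + Real.cosh (2 * β * θ)) ^ 2 *
          (m * deriv (gMap β θ) m - gMap β θ m) := by
      rw [deriv_gMap, gMap_eq]
      unfold ratioNum
      field_simp
    rw [h1, hfix]
    have : 0 ≤ m * deriv (gMap β θ) m - m := by nlinarith
    positivity
  have hmono := strictMonoOn_gMap_div (b := m) (β := β) (θ := θ) fun x hx =>
    ratioNum_pos (mul_pos (by positivity) hx.1) (by nlinarith [hx.2]) hN
  have h1 : gMap β θ (m / 2) / (m / 2) < gMap β θ m / m :=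
    hmono ⟨by linarith, by linarith⟩ ⟨hm, le_rfl⟩ (by linarith)
  rw [hfix, div_self hm.ne'] at h1
  have h2 : 2 * β / (1 + Real.cosh (2 * β * θ)) ≤ gMap β θ (m / 2) / (m / 2) := by
    refine le_of_tendsto (tendsto_gMap_div β θ) ?_
    filter_upwards [Ioo_mem_nhdsGT (show (0 : ℝ) < m / 2 by linarith)] with z hz
    exact (hmono ⟨hz.1, by linarith [hz.2]⟩ ⟨by linarith, by linarith⟩ hz.2).le
  linarith [one_le_gMap_slope h]

/-! ### Entropy -/

lemma continuous_entropyI : Continuous entropyI := by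
  unfold entropyI
  have h := Real.continuous_mul_log
  have h1 : Continuous fun m : ℝ => (1 + m) / 2 * Real.log ((1 + m) / 2) :=
    h.comp (show Continuous fun m : ℝ => (1 + m) / 2 by fun_prop)
  have h2 : Continuous fun m : ℝ => (1 - m) / 2 * Real.log ((1 - m) / 2) :=
    h.comp (show Continuous fun m : ℝ => (1 - m) / 2 by fun_prop)
  exact h1.add h2

lemma entropyI_neg (m : ℝ) : entropyI (-m) = entropyI m := by
  unfold entropyI; ring_nf

lemma artanh_eq_log_sub {x : ℝ} (hx : x ∈ Set.Ioo (-1 : ℝ) 1) :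
    Real.artanh x = (Real.log (1 + x) - Real.log (1 - x)) / 2 := by
  rw [Real.artanh_eq_half_log ⟨hx.1.le, hx.2.le⟩, Real.log_div (by linarith [hx.1])
    (by linarith [hx.2])]
  ring

lemma hasDerivAt_entropyI {x : ℝ} (hx : x ∈ Set.Ioo (-1 : ℝ) 1) :
    HasDerivAt entropyI (Real.artanh x) x := by
  have hp : (1 + x) / 2 ≠ 0 := by have := hx.1; apply ne_of_gt; linarith
  have hq : (1 - x) / 2 ≠ 0 := by have := hx.2; apply ne_of_gt; linarith
  have h1 : HasDerivAt (fun x : ℝ => (1 + x) / 2) (1 / 2) x :=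
    ((hasDerivAt_id x).const_add 1).div_const 2
  have h2 : HasDerivAt (fun x : ℝ => (1 - x) / 2) (-1 / 2) x :=
    ((hasDerivAt_id x).const_sub 1).div_const 2
  have := (h1.mul (h1.log hp)).add (h2.mul (h2.log hq))
  refine this.congr_deriv ?_
  have e1 : (1 + x) / 2 * (1 / 2 / ((1 + x) / 2)) = 1 / 2 := mul_div_cancel₀ _ hp
  have e2 : (1 - x) / 2 * (-1 / 2 / ((1 - x) / 2)) = -1 / 2 := mul_div_cancel₀ _ hq
  rw [e1, e2, artanh_eq_log_sub hx, Real.log_div (by linarith [hx.1]) two_ne_zero,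
    Real.log_div (by linarith [hx.2]) two_ne_zero]
  ring

/-- The derivative of artanh is 1/(1 - x²) ≥ 1. This gives the strong convexity of the entropy and
turns a distance from tanh h into a force of at least the same size. -/
lemma monotoneOn_artanh_sub_id : MonotoneOn (fun x => Real.artanh x - x) (Set.Ioo (-1) 1) := by
  have hd : ∀ x ∈ Set.Ioo (-1 : ℝ) 1, HasDerivAt
      (fun x => (Real.log (1 + x) - Real.log (1 - x)) / 2 - x)
      ((1 / (1 + x) - -1 / (1 - x)) / 2 - 1) x := fun x hx =>
    (((((hasDerivAt_id x).const_add 1).log (by have := hx.1; simp only [id]; linarith)).sub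
      (((hasDerivAt_id x).const_sub 1).log (by have := hx.2; simp only [id]; linarith))).div_const
        2).sub (hasDerivAt_id x)
  have : MonotoneOn (fun x => (Real.log (1 + x) - Real.log (1 - x)) / 2 - x)
      (Set.Ioo (-1 : ℝ) 1) := by
    refine monotoneOn_of_deriv_nonneg (convex_Ioo _ _)
      (fun x hx => (hd x hx).continuousAt.continuousWithinAt)
      (fun x hx => (hd x (interior_subset hx)).differentiableAt.differentiableWithinAt)
      fun x hx => ?_
    replace hx := interior_subset hx
    rw [(hd x hx).deriv]
    have h1 : 0 < 1 + x := by linarith [hx.1]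
    have h2 : 0 < 1 - x := by linarith [hx.2]
    have : (1 / (1 + x) - -1 / (1 - x)) / 2 - 1 = x ^ 2 / ((1 + x) * (1 - x)) := by
      field_simp; ring
    rw [this]; positivity
  exact this.congr fun x hx => by rw [artanh_eq_log_sub hx]

/-- Strong convexity of the entropy. -/
lemma entropyI_tangent {p m : ℝ} (hp : p ∈ Set.Ioo (-1 : ℝ) 1) (hm : m ∈ Set.Icc (-1 : ℝ) 1) :
    Real.artanh p * (m - p) + (m - p) ^ 2 / 2 ≤ entropyI m - entropyI p := by
  have hd : ∀ x ∈ Set.Ioo (-1 : ℝ) 1, HasDerivAt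
      (fun x => entropyI x - (Real.artanh p * (x - p) + (x - p) ^ 2 / 2))
      (Real.artanh x - Real.artanh p - (x - p)) x := fun x hx => by
    have h1 := (hasDerivAt_id x).sub_const p
    refine ((hasDerivAt_entropyI hx).sub ((h1.const_mul (Real.artanh p)).add
      ((h1.pow 2).div_const 2))).congr_deriv ?_
    simp; ring
  have hcont : Continuous (fun x => entropyI x - (Real.artanh p * (x - p) + (x - p) ^ 2 / 2)) :=
    continuous_entropyI.sub (by fun_prop)
  rcases le_total p m with hpm | hpm
  · have : MonotoneOn (fun x => entropyI x - (Real.artanh p * (x - p) + (x - p) ^ 2 / 2))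
        (Set.Icc p 1) := by
      refine monotoneOn_of_deriv_nonneg (convex_Icc _ _) hcont.continuousOn
        (fun x hx => ?_) fun x hx => ?_
      all_goals rw [interior_Icc] at hx
      all_goals have hx' : x ∈ Set.Ioo (-1 : ℝ) 1 := ⟨hp.1.trans hx.1, hx.2⟩
      · exact (hd x hx').differentiableAt.differentiableWithinAt
      · rw [(hd x hx').deriv]
        have := monotoneOn_artanh_sub_id hp hx' hx.1.le
        simp only at this; linarith
    have := this (Set.left_mem_Icc.2 hp.2.le) ⟨hpm, hm.2⟩ hpm
    simp at this; linarith
  · have : AntitoneOn (fun x => entropyI x - (Real.artanh p * (x - p) + (x - p) ^ 2 / 2))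
        (Set.Icc (-1) p) := by
      refine antitoneOn_of_deriv_nonpos (convex_Icc _ _) hcont.continuousOn
        (fun x hx => ?_) fun x hx => ?_
      all_goals rw [interior_Icc] at hx
      all_goals have hx' : x ∈ Set.Ioo (-1 : ℝ) 1 := ⟨hx.1, hx.2.trans hp.2⟩
      · exact (hd x hx').differentiableAt.differentiableWithinAt
      · rw [(hd x hx').deriv]
        have := monotoneOn_artanh_sub_id hx' hp hx.2.le
        simp only at this; linarith
    have := this ⟨hm.1, hpm⟩ (Set.right_mem_Icc.2 hp.1.le) hpm
    simp at this; linarith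

/-! ### Moving a half-block magnetization -/

lemma tanh_mem_Ioo (x : ℝ) : Real.tanh x ∈ Set.Ioo (-1 : ℝ) 1 :=
  ⟨Real.neg_one_lt_tanh x, Real.tanh_lt_one x⟩

/-- The mean of `K` spins, `n` of which are `+1`. -/
noncomputable def mag (K n : ℕ) : ℝ := (2 * (n : ℝ) - K) / K

lemma mag_mem_Icc {K n : ℕ} (hK : 0 < K) (hn : n ≤ K) : mag K n ∈ Set.Icc (-1 : ℝ) 1 := by
  have h1 : (0 : ℝ) < K := by exact_mod_cast hK
  have h2 : (n : ℝ) ≤ K := by exact_mod_cast hn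
  have h3 : (0 : ℝ) ≤ n := by positivity
  unfold mag
  constructor
  · rw [le_div_iff₀ h1]; linarith
  · rw [div_le_iff₀ h1]; linarith

lemma mag_sub {K n : ℕ} (hn : n ≤ K) : mag K (K - n) = -mag K n := by
  unfold mag
  rw [Nat.cast_sub hn]
  ring

/-- Below both `a` and tanh h, the tilted entropy I(x) - h x decreases with slope at least the
distance to `lo`. A move by r up to d/(2β), with d = lo - m, gains at least r d / 2 after
subtracting the interaction cost β r²/2. The term 2/K is the loss from rounding to the lattice of
possible averages. -/
lemma exists_move_up {K n : ℕ} (hK : 0 < K) (hn : n ≤ K) {β : ℝ} (hβ : 1 ≤ β) {a h lo : ℝ}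
    (hlo : mag K n < lo) (hloa : lo ≤ a) (hloT : lo ≤ Real.tanh h) :
    ∃ n' ≤ K, |mag K n' - a| ≤ |mag K n - a| ∧
      (mag K n - lo) ^ 2 / (8 * β) - 2 / K ≤
        (entropyI (mag K n) - h * mag K n) - (entropyI (mag K n') - h * mag K n')
          - β / 2 * (mag K n' - mag K n) ^ 2 := by
  have hK0 : (0 : ℝ) < K := by exact_mod_cast hK
  have hm := mag_mem_Icc hK hn
  have hT := tanh_mem_Ioo h
  set m := mag K n with hmdef
  set d := lo - m with hd
  have hd0 : 0 < d := by linarith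
  have hd2 : d ≤ 2 := by linarith [hm.1, hT.2]
  -- The fraction 1/(2β) of the distance keeps both r ≤ d/2 and β r ≤ d/2. The floor below accounts
  -- for the spacing 2/K of the values of `mag K`.
  set t : ℝ := 1 / (2 * β) with ht
  have ht0 : 0 < t := by positivity
  have htβ : t * β = 1 / 2 := by rw [ht]; field_simp
  have ht1 : t ≤ 1 / 2 := by nlinarith
  set j : ℕ := ⌊t * d * K / 2⌋₊ with hj
  have hj1 : (j : ℝ) ≤ t * d * K / 2 := Nat.floor_le (by positivity)
  have hj2 : t * d * K / 2 < j + 1 := Nat.lt_floor_add_one _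
  have hm' : mag K (n + j) = m + 2 * j / K := by
    rw [hmdef]; unfold mag; push_cast; ring
  set r : ℝ := 2 * j / K with hr
  have hr0 : 0 ≤ r := by positivity
  have hr1 : r ≤ t * d := by rw [hr, div_le_iff₀ hK0]; linarith
  have hr2 : t * d - 2 / K ≤ r := by
    rw [hr, sub_le_iff_le_add, ← add_div, le_div_iff₀ hK0]; linarith
  have hrd : r ≤ d / 2 := by nlinarith
  have hnj : n + j ≤ K := by
    have : m + r ≤ 1 := by linarith [hT.2]
    rw [← hm', mag, div_le_one hK0] at this
    push_cast at this
    have : ((n + j : ℕ) : ℝ) ≤ K := by push_cast; linarith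
    exact_mod_cast this
  refine ⟨n + j, hnj, ?_, ?_⟩
  · rw [hm', abs_of_nonpos (by linarith), abs_of_nonpos (by linarith)]
    linarith
  · rw [hm']
    have hdrop : r * d / 2 ≤ (entropyI m - h * m) - (entropyI (m + r) - h * (m + r))
        - β / 2 * (m + r - m) ^ 2 := by
      rcases hr0.eq_or_lt with h0 | h0
      · rw [← h0]; simp
      · have hpm : m + r ∈ Set.Ioo (-1 : ℝ) 1 := ⟨by linarith [hm.1], by linarith [hT.2]⟩
        -- The tangent is taken at the end point of the move, which is interior; the starting point
        -- may be -1.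
        have h1 := entropyI_tangent hpm hm
        have h2 := monotoneOn_artanh_sub_id hpm hT (by linarith : m + r ≤ Real.tanh h)
        simp only [Real.artanh_tanh] at h2
        have h3 : d - r ≤ h - Real.artanh (m + r) := by linarith
        have h4 : (d - r) * r ≤ (h - Real.artanh (m + r)) * r :=
          mul_le_mul_of_nonneg_right h3 hr0
        have h5 : β * r ^ 2 ≤ r * d / 2 := by
          have : β * r ≤ d / 2 := by
            calc β * r ≤ β * (t * d) := by gcongr
              _ = t * β * d := by ring
              _ = d / 2 := by rw [htβ]; ring
          nlinarith
        nlinarith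
    refine le_trans ?_ hdrop
    have h6 : (m - lo) ^ 2 = d ^ 2 := by rw [hd]; ring
    rw [h6]
    have h7 : (t * d - 2 / K) * d / 2 ≤ r * d / 2 := by gcongr
    refine le_trans ?_ h7
    have h8 : d ^ 2 / (8 * β) = t * d * d / 4 := by rw [ht]; field_simp; norm_num
    have h9 : (t * d - 2 / K) * d / 2 = t * d * d / 2 - d / K := by field_simp
    have h10 : d / K ≤ 2 / K := by gcongr
    have h11 : 0 ≤ t * d * d := by positivity
    rw [h8, h9]
    linarith

/-- A spin average can be moved towards a point `p` which lies between its position, `a` and the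
mean field value `tanh h`, such that the tilted entropy decreases. -/
lemma exists_move {K n : ℕ} (hK : 0 < K) (hn : n ≤ K) {β : ℝ} (hβ : 1 ≤ β) (a h : ℝ) :
    ∃ n' ≤ K, ∃ p, |p - a| ≤ |Real.tanh h - a| ∧ |mag K n' - a| ≤ |mag K n - a| ∧
      (mag K n - p) ^ 2 / (8 * β) - 2 / K ≤
        (entropyI (mag K n) - h * mag K n) - (entropyI (mag K n') - h * mag K n')
          - β / 2 * (mag K n' - mag K n) ^ 2 := by
  have hK0 : (0 : ℝ) < K := by exact_mod_cast hK
  -- The point p is the projection of the average onto the segment with end points `a` and tanh h.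
  -- The case to the right of the segment is the reflection of the one to the left; inside the
  -- segment nothing moves.
  rcases lt_or_ge (mag K n) (min a (Real.tanh h)) with hlo | hlo
  · obtain ⟨n', hn', h1, h2⟩ := exists_move_up hK hn hβ hlo (min_le_left _ _) (min_le_right _ _)
    refine ⟨n', hn', _, ?_, h1, h2⟩
    rcases min_choice a (Real.tanh h) with e | e <;> rw [e]
    simp
  rcases lt_or_ge (max a (Real.tanh h)) (mag K n) with hhi | hhi
  · have hn2 : K - n ≤ K := Nat.sub_le _ _
    have hhi' : mag K (K - n) < -max a (Real.tanh h) := by rw [mag_sub hn]; linarith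
    obtain ⟨n', hn', h1, h2⟩ := exists_move_up (h := -h) (a := -a) hK hn2 hβ hhi'
      (by linarith [le_max_left a (Real.tanh h)])
      (by rw [Real.tanh_neg]; linarith [le_max_right a (Real.tanh h)])
    refine ⟨K - n', Nat.sub_le _ _, max a (Real.tanh h), ?_, ?_, ?_⟩
    · rcases max_choice a (Real.tanh h) with e | e <;> rw [e]
      simp
    · rw [mag_sub hn] at h1
      rw [mag_sub hn', abs_sub_comm, show a - -mag K n' = mag K n' - -a by ring,
        abs_sub_comm (mag K n) a, show a - mag K n = -mag K n - -a by ring]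
      exact h1
    · rw [mag_sub hn] at h2
      rw [mag_sub hn']
      simp only [entropyI_neg] at h2 ⊢
      refine le_trans (le_of_eq ?_) (h2.trans (le_of_eq ?_)) <;> ring
  · refine ⟨n, hn, mag K n, ?_, le_rfl, ?_⟩
    · rcases le_total a (Real.tanh h) with e | e
      · rw [min_eq_left e] at hlo
        rw [max_eq_right e] at hhi
        rw [abs_of_nonneg (by linarith), abs_of_nonneg (by linarith)]
        linarith
      · rw [min_eq_right e] at hlo
        rw [max_eq_left e] at hhi
        rw [abs_of_nonpos (by linarith), abs_of_nonpos (by linarith)]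
        linarith
    · have : (0 : ℝ) ≤ 2 / K := by positivity
      simpa using this

/-! ### Binomial coefficients and entropy -/

/-- The binomial law with success probability n/K has its mode at n: the ratio of the terms i + 1
and i is (K - i) n / ((i + 1)(K - n)), which is at least 1 for i < n and at most 1 from i = n on. -/
lemma choose_mul_pow_le {K n i : ℕ} (hn : n ≤ K) (hi : i ≤ K) :
    K.choose i * n ^ i * (K - n) ^ (K - i) ≤ K.choose n * n ^ n * (K - n) ^ (K - n) := by
  rcases hn.eq_or_lt with rfl | hnK
  · rcases hi.eq_or_lt with rfl | hi
    · rfl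
    · simp [Nat.sub_ne_zero_of_lt hi]
  have step : ∀ i < K, (K.choose (i + 1) * n ^ (i + 1) * (K - n) ^ (K - (i + 1))) *
      ((i + 1) * (K - n)) = (K.choose i * n ^ i * (K - n) ^ (K - i)) * ((K - i) * n) := by
    intro i hi
    have h1 := Nat.choose_succ_right_eq K i
    have h2 : K - i = K - (i + 1) + 1 := by omega
    calc _ = (K.choose (i + 1) * (i + 1)) *
          (n ^ (i + 1) * ((K - n) ^ (K - (i + 1)) * (K - n))) := by
          ring
      _ = _ := by rw [h1, ← pow_succ, ← h2]; ring
  have up : ∀ i, i < n → K.choose i * n ^ i * (K - n) ^ (K - i) ≤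
      K.choose (i + 1) * n ^ (i + 1) * (K - n) ^ (K - (i + 1)) := by
    intro i hi
    refine Nat.le_of_mul_le_mul_right (c := (i + 1) * (K - n)) ?_
      (Nat.mul_pos (Nat.succ_pos _) (by omega))
    rw [step i (by omega)]
    refine Nat.mul_le_mul_left _ ?_
    zify [hnK.le, (show i ≤ K by omega)]
    have : (i : ℤ) + 1 ≤ n := by exact_mod_cast hi
    have : (n : ℤ) < K := by exact_mod_cast hnK
    nlinarith
  have down : ∀ i, n ≤ i → i < K → K.choose (i + 1) * n ^ (i + 1) * (K - n) ^ (K - (i + 1)) ≤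
      K.choose i * n ^ i * (K - n) ^ (K - i) := by
    intro i hi hiK
    refine Nat.le_of_mul_le_mul_right (c := (i + 1) * (K - n)) ?_
      (Nat.mul_pos (Nat.succ_pos _) (by omega))
    rw [step i hiK]
    refine Nat.mul_le_mul_left _ ?_
    zify [hnK.le, (show i ≤ K by omega)]
    have : (n : ℤ) ≤ i := by exact_mod_cast hi
    have : (n : ℤ) < K := by exact_mod_cast hnK
    nlinarith
  rcases le_total i n with hin | hin
  · exact Nat.decreasingInduction (motive := fun i _ => K.choose i * n ^ i * (K - n) ^ (K - i) ≤
      K.choose n * n ^ n * (K - n) ^ (K - n)) (fun i hi ih => (up i hi).trans ih) le_rfl hin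
  · induction i, hin using Nat.le_induction with
    | base => rfl
    | succ i hin ih => exact (down i hin (by omega)).trans (ih (by omega))

lemma pow_eq_sum_choose {K n : ℕ} (hn : n ≤ K) :
    K ^ K = ∑ i ∈ Finset.range (K + 1), K.choose i * n ^ i * (K - n) ^ (K - i) := by
  conv_lhs => rw [show K ^ K = (n + (K - n)) ^ K by rw [Nat.add_sub_cancel' hn], add_pow]
  refine Finset.sum_congr rfl fun i _ => by simp; ring

lemma exp_mul_entropyI {K n : ℕ} (hK : 0 < K) (hn : n ≤ K) :
    Real.exp (K * entropyI (mag K n)) = ((n ^ n * (K - n) ^ (K - n) : ℕ) : ℝ) / (K : ℝ) ^ K := by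
  have hK0 : (0 : ℝ) < K := by exact_mod_cast hK
  have key : ∀ j : ℕ, Real.exp (j * Real.log (j / K)) = ((j : ℝ) / K) ^ j := by
    intro j
    rcases Nat.eq_zero_or_pos j with rfl | hj
    · simp
    · have : (0 : ℝ) < j := by exact_mod_cast hj
      rw [Real.exp_nat_mul, Real.exp_log (by positivity)]
  have e1 : (1 + mag K n) / 2 = n / K := by unfold mag; field_simp; ring
  have e2 : (1 - mag K n) / 2 = ((K - n : ℕ) : ℝ) / K := by
    unfold mag; rw [Nat.cast_sub hn]; field_simp; ring
  have e3 : K * entropyI (mag K n) = n * Real.log (n / K) +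
      ((K - n : ℕ) : ℝ) * Real.log (((K - n : ℕ) : ℝ) / K) := by
    unfold entropyI
    rw [e1, e2]
    field_simp
  rw [e3, Real.exp_add, key, key, div_pow, div_pow, div_mul_div_comm, ← pow_add,
    Nat.add_sub_cancel' hn]
  push_cast
  rfl

/-- The left side is the probability that a binomial variable with success probability n/K equals n,
that is, one term of the expansion of (n + (K - n))^K divided by K^K. -/
lemma choose_mul_exp_le_one {K n : ℕ} (hK : 0 < K) (hn : n ≤ K) :
    (K.choose n : ℝ) * Real.exp (K * entropyI (mag K n)) ≤ 1 := by
  have hK0 : (0 : ℝ) < K := by exact_mod_cast hK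
  rw [exp_mul_entropyI hK hn, mul_div_assoc', div_le_one (by positivity)]
  have : K.choose n * n ^ n * (K - n) ^ (K - n) ≤ K ^ K := by
    rw [pow_eq_sum_choose hn]
    exact Finset.single_le_sum (f := fun i => K.choose i * n ^ i * (K - n) ^ (K - i))
      (fun _ _ => Nat.zero_le _) (Finset.mem_range.2 (by omega))
  rw [mul_assoc] at this
  exact_mod_cast this

/-- The term i = n is the largest of the K + 1 terms that sum to K^K. -/
lemma one_le_choose_mul_exp {K n : ℕ} (hK : 0 < K) (hn : n ≤ K) :
    1 ≤ ((K : ℝ) + 1) * ((K.choose n : ℝ) * Real.exp (K * entropyI (mag K n))) := by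
  have hK0 : (0 : ℝ) < K := by exact_mod_cast hK
  rw [exp_mul_entropyI hK hn, mul_div_assoc', mul_div_assoc', le_div_iff₀ (by positivity), one_mul]
  have : K ^ K ≤ (K + 1) * (K.choose n * (n ^ n * (K - n) ^ (K - n))) := by
    rw [pow_eq_sum_choose hn]
    refine (Finset.sum_le_card_nsmul _ _ (K.choose n * (n ^ n * (K - n) ^ (K - n)))
      fun i hi => ?_).trans ?_
    · rw [← mul_assoc]
      exact choose_mul_pow_le hn (by rw [Finset.mem_range] at hi; omega)
    · simp
  exact_mod_cast this

/-! ### The interaction between blocks -/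

/-- The interaction kernel between blocks at (signed) distance `d`, for a range of `Q` blocks. -/
noncomputable def blockJ (Q : ℕ) (d : ℤ) : ℝ :=
  if |d| < Q then 1 / (2 * Q) else if |d| = Q then 1 / (4 * Q) else 0

lemma blockJ_nonneg (Q : ℕ) (d : ℤ) : 0 ≤ blockJ Q d := by
  unfold blockJ; split_ifs <;> positivity

lemma blockJ_neg (Q : ℕ) (d : ℤ) : blockJ Q (-d) = blockJ Q d := by
  unfold blockJ; rw [abs_neg]

lemma blockJ_sub_comm (Q : ℕ) (x y : ℤ) : blockJ Q (x - y) = blockJ Q (y - x) := by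
  rw [← blockJ_neg, neg_sub]

lemma blockJ_eq_zero {Q : ℕ} {d : ℤ} (h : (Q : ℤ) < |d|) : blockJ Q d = 0 := by
  unfold blockJ; rw [if_neg (by omega), if_neg (by omega)]

/-- The half weight at distance exactly Q makes the mass exact: 2Q - 1 blocks of weight 1/(2Q) and
two of weight 1/(4Q). Local fields are therefore genuine averages. -/
lemma sum_blockJ {Q : ℕ} (hQ : 0 < Q) (x : ℤ) :
    ∑ y ∈ Finset.Icc (x - Q) (x + Q), blockJ Q (x - y) = 1 := by
  have hQ0 : (0 : ℝ) < Q := by exact_mod_cast hQ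
  have hset : Finset.Icc (x - Q) (x + Q) =
      insert (x - Q : ℤ) (insert (x + Q : ℤ) (Finset.Ioo (x - Q) (x + Q))) := by
    ext y; simp only [Finset.mem_Icc, Finset.mem_insert, Finset.mem_Ioo]; omega
  rw [hset, Finset.sum_insert, Finset.sum_insert]
  · have h1 : ∀ y ∈ Finset.Ioo (x - Q) (x + Q), blockJ Q (x - y) = 1 / (2 * (Q : ℝ)) := by
      intro y hy
      rw [Finset.mem_Ioo] at hy
      unfold blockJ
      rw [if_pos (by rw [abs_lt]; omega)]
    have h2 : blockJ Q (x - (x - Q)) = 1 / (4 * (Q : ℝ)) := by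
      unfold blockJ; simp
    have h3 : blockJ Q (x - (x + Q)) = 1 / (4 * (Q : ℝ)) := by
      unfold blockJ; simp
    rw [Finset.sum_congr rfl h1, h2, h3, Finset.sum_const, Int.card_Ioo, nsmul_eq_mul]
    have h4 : (((x + Q - (x - Q) - 1).toNat : ℕ) : ℝ) = 2 * Q - 1 := by
      have : (x + Q - (x - Q) - 1).toNat = 2 * Q - 1 := by omega
      rw [this, Nat.cast_sub (by omega)]; push_cast; rfl
    rw [h4]
    field_simp
    ring
  · simp
  · simp only [Finset.mem_insert, Finset.mem_Ioo, not_or]; omega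

lemma sum_blockJ_le_one {Q : ℕ} (hQ : 0 < Q) (x : ℤ) (S : Finset ℤ) :
    ∑ y ∈ S, blockJ Q (x - y) ≤ 1 := by
  rw [← sum_blockJ hQ x, ← Finset.sum_filter_add_sum_filter_not S
    (fun y => y ∈ Finset.Icc (x - Q) (x + Q))]
  have h0 : ∑ y ∈ S with y ∉ Finset.Icc (x - Q) (x + Q), blockJ Q (x - y) = 0 := by
    refine Finset.sum_eq_zero fun y hy => blockJ_eq_zero ?_
    simp only [Finset.mem_filter, Finset.mem_Icc] at hy
    rw [lt_abs]; omega
  rw [h0, add_zero]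
  refine Finset.sum_le_sum_of_subset_of_nonneg (fun y hy => (Finset.mem_filter.1 hy).2)
    fun _ _ _ => blockJ_nonneg _ _

/-- A Schur test: 2 D x D y ≥ -(D x)² - (D y)², and every row of the kernel has mass at most 1. It
decouples moves that are made simultaneously in interacting blocks. -/
lemma neg_sum_sq_le_sum_blockJ {Q : ℕ} (hQ : 0 < Q) (X : Finset ℤ) (D : ℤ → ℝ) :
    -∑ x ∈ X, D x ^ 2 ≤ ∑ x ∈ X, ∑ y ∈ X, blockJ Q (x - y) * (D x * D y) := by
  have h1 : ∀ x ∈ X, ∀ y ∈ X, -(blockJ Q (x - y) * D x ^ 2 / 2 + blockJ Q (y - x) * D y ^ 2 / 2) ≤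
      blockJ Q (x - y) * (D x * D y) := fun x _ y _ => by
    rw [blockJ_sub_comm Q y x]
    nlinarith [mul_nonneg (blockJ_nonneg Q (x - y)) (sq_nonneg (D x + D y))]
  refine le_trans ?_ (Finset.sum_le_sum fun x hx => Finset.sum_le_sum fun y hy => h1 x hx y hy)
  simp only [Finset.sum_neg_distrib, Finset.sum_add_distrib]
  rw [Finset.sum_comm (f := fun x y => blockJ Q (y - x) * D y ^ 2 / 2)]
  have h2 : ∑ x ∈ X, ∑ y ∈ X, blockJ Q (x - y) * D x ^ 2 / 2 ≤ ∑ x ∈ X, D x ^ 2 / 2 := by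
    refine Finset.sum_le_sum fun x _ => ?_
    rw [← Finset.sum_div, ← Finset.sum_mul]
    have := sum_blockJ_le_one hQ x X
    have := mul_le_mul_of_nonneg_right this (sq_nonneg (D x))
    linarith
  rw [← Finset.sum_div] at h2
  linarith

/-- The local mean field of a profile. -/
noncomputable def localField (Q : ℕ) (D : ℤ → ℝ) (x : ℤ) : ℝ :=
  ∑ y ∈ Finset.Icc (x - Q) (x + Q), blockJ Q (x - y) * D y

/-- Cauchy–Schwarz for the weights of the kernel, which sum to 1. -/
lemma localField_sq_le {Q : ℕ} (hQ : 0 < Q) (D : ℤ → ℝ) (x : ℤ) :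
    localField Q D x ^ 2 ≤ ∑ y ∈ Finset.Icc (x - Q) (x + Q), blockJ Q (x - y) * D y ^ 2 := by
  have := Finset.sum_sq_le_sum_mul_sum_of_sq_le_mul (Finset.Icc (x - Q) (x + Q))
    (r := fun y => blockJ Q (x - y) * D y) (f := fun y => blockJ Q (x - y))
    (g := fun y => blockJ Q (x - y) * D y ^ 2)
    (fun y _ => blockJ_nonneg _ _) (fun y _ => mul_nonneg (blockJ_nonneg _ _) (sq_nonneg _))
    (fun y _ => by apply le_of_eq; ring)
  rwa [sum_blockJ hQ, one_mul] at this

lemma localField_const {Q : ℕ} (hQ : 0 < Q) (c : ℝ) (x : ℤ) : localField Q (fun _ => c) x = c := by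
  unfold localField; rw [← Finset.sum_mul, sum_blockJ hQ, one_mul]

lemma abs_localField_sub_le {Q : ℕ} (hQ : 0 < Q) (t D : ℤ → ℝ) (c : ℝ) (x : ℤ)
    (h : ∀ y ∈ Finset.Icc (x - Q) (x + Q), |t y - c| ≤ D y) :
    |localField Q t x - c| ≤ localField Q D x := by
  rw [← localField_const hQ c x]
  unfold localField
  rw [← Finset.sum_sub_distrib]
  refine (Finset.abs_sum_le_sum_abs _ _).trans (Finset.sum_le_sum fun y hy => ?_)
  rw [← mul_sub, abs_mul, abs_of_nonneg (blockJ_nonneg _ _)]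
  exact mul_le_mul_of_nonneg_left (h y hy) (blockJ_nonneg _ _)

lemma localField_le_sum {Q : ℕ} (D : ℤ → ℝ) (hD : ∀ y, 0 ≤ D y) (x : ℤ) (S : Finset ℤ)
    (hS : Finset.Icc (x - Q) (x + Q) ⊆ S) : localField Q D x ≤ (∑ y ∈ S, D y) / (2 * Q) := by
  rw [Finset.sum_div]
  refine (Finset.sum_le_sum fun y _ => ?_).trans (Finset.sum_le_sum_of_subset_of_nonneg hS
    fun y _ _ => div_nonneg (hD y) (by positivity))
  rw [div_eq_inv_mul, ← one_div]
  refine mul_le_mul_of_nonneg_right ?_ (hD y)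
  unfold blockJ
  split_ifs
  · rfl
  · rcases Nat.eq_zero_or_pos Q with rfl | hQ
    · simp
    · have : (0 : ℝ) < Q := by exact_mod_cast hQ
      exact one_div_le_one_div_of_le (by positivity) (by linarith)
  · positivity

lemma sum_localField_sq_le {Q : ℕ} (hQ : 0 < Q) (D : ℤ → ℝ) (a b : ℤ) :
    ∑ x ∈ Finset.Ioc a b, localField Q D x ^ 2 ≤ ∑ y ∈ Finset.Ioc (a - Q) (b + Q), D y ^ 2 := by
  have h1 : ∀ x ∈ Finset.Ioc a b, localField Q D x ^ 2 ≤
      ∑ y ∈ Finset.Ioc (a - Q) (b + Q), blockJ Q (y - x) * D y ^ 2 := fun x hx => by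
    refine (localField_sq_le hQ D x).trans ?_
    simp only [blockJ_sub_comm Q x]
    refine Finset.sum_le_sum_of_subset_of_nonneg (fun y hy => ?_)
      fun y _ _ => mul_nonneg (blockJ_nonneg _ _) (sq_nonneg _)
    simp only [Finset.mem_Icc, Finset.mem_Ioc] at *; omega
  refine (Finset.sum_le_sum h1).trans ?_
  rw [Finset.sum_comm]
  refine Finset.sum_le_sum fun y _ => ?_
  rw [← Finset.sum_mul]
  have := mul_le_mul_of_nonneg_right (sum_blockJ_le_one hQ y (Finset.Ioc a b)) (sq_nonneg (D y))
  linarith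

/-- A profile which is contracted by the local averages up to an error is small far away from the
boundary up to the size of the error. -/
lemma sum_sq_le_of_contraction {Q : ℕ} (hQ : 0 < Q) {D e : ℤ → ℝ} (hD : ∀ y, 0 ≤ D y)
    {q η ρ : ℝ} (hη : 0 < η) (hρ : (1 + η) * q ^ 2 = ρ) (hρ1 : ρ < 1) (a b : ℤ)
    (n : ℕ) (X : Finset ℤ) (hX : ∀ j < n, Finset.Ioc (a - j * Q) (b + j * Q) ⊆ X)
    (h : ∀ x ∈ X, D x ≤ q * localField Q D x + e x) :
    ∑ x ∈ Finset.Ioc a b, D x ^ 2 ≤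
      ρ ^ n * ∑ x ∈ Finset.Ioc (a - n * Q) (b + n * Q), D x ^ 2 +
        (1 + 1 / η) / (1 - ρ) * ∑ x ∈ X, e x ^ 2 := by
  have hρ0 : 0 ≤ ρ := by rw [← hρ]; positivity
  set c := (1 + 1 / η) * ∑ x ∈ X, e x ^ 2 with hc
  have hc0 : 0 ≤ c := by
    have : 0 ≤ ∑ x ∈ X, e x ^ 2 := Finset.sum_nonneg fun _ _ => sq_nonneg _
    positivity
  have step : ∀ j < n, ∑ x ∈ Finset.Ioc (a - j * Q) (b + j * Q), D x ^ 2 ≤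
      ρ * ∑ x ∈ Finset.Ioc (a - (j + 1 : ℕ) * Q) (b + (j + 1 : ℕ) * Q), D x ^ 2 + c := by
    intro j hj
    have h1 : ∀ x ∈ Finset.Ioc (a - j * Q) (b + j * Q), D x ^ 2 ≤
        ρ * localField Q D x ^ 2 + (1 + 1 / η) * e x ^ 2 := by
      intro x hx
      have h2 := h x (hX j hj hx)
      have h3 : D x ^ 2 ≤ (q * localField Q D x + e x) ^ 2 :=
        pow_le_pow_left₀ (hD x) h2 2
      refine h3.trans ?_
      rw [← hρ]
      -- Young's inequality (u + e)² ≤ (1 + η) u² + (1 + 1/η) e², written as a square.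
      have h4 : 0 ≤ (η * (q * localField Q D x) - e x) ^ 2 / η := by positivity
      have h5 : (η * (q * localField Q D x) - e x) ^ 2 / η =
          η * (q * localField Q D x) ^ 2 - 2 * (q * localField Q D x) * e x + 1 / η * e x ^ 2 := by
        field_simp; ring
      nlinarith
    refine (Finset.sum_le_sum h1).trans ?_
    rw [Finset.sum_add_distrib, ← Finset.mul_sum, ← Finset.mul_sum]
    have h6 := sum_localField_sq_le hQ D (a - j * Q) (b + j * Q)
    have e1 : a - j * Q - Q = a - (j + 1 : ℕ) * Q := by push_cast; ring
    have e2 : b + j * Q + Q = b + (j + 1 : ℕ) * Q := by push_cast; ring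
    rw [e1, e2] at h6
    have h7 : ∑ x ∈ Finset.Ioc (a - j * Q) (b + j * Q), e x ^ 2 ≤ ∑ x ∈ X, e x ^ 2 :=
      Finset.sum_le_sum_of_subset_of_nonneg (hX j hj) fun _ _ _ => sq_nonneg _
    exact add_le_add (mul_le_mul_of_nonneg_left h6 hρ0)
      (mul_le_mul_of_nonneg_left h7 (by positivity))
  -- Each iteration widens the window by Q blocks on both sides and gains a factor ρ; the errors
  -- form a geometric series.
  have main : ∀ j ≤ n, ∑ x ∈ Finset.Ioc a b, D x ^ 2 ≤
      ρ ^ j * ∑ x ∈ Finset.Ioc (a - j * Q) (b + j * Q), D x ^ 2 + c * (1 - ρ ^ j) / (1 - ρ) := by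
    intro j
    induction j with
    | zero => simp
    | succ j ih =>
      intro hj
      refine (ih (by omega)).trans ?_
      have h1 := mul_le_mul_of_nonneg_left (step j (by omega)) (pow_nonneg hρ0 j)
      have h2 : ρ ^ j * c + c * (1 - ρ ^ j) / (1 - ρ) = c * (1 - ρ ^ (j + 1)) / (1 - ρ) := by
        have : 1 - ρ ≠ 0 := by linarith
        field_simp; ring
      rw [mul_add, ← mul_assoc, ← pow_succ] at h1
      linarith
  refine (main n le_rfl).trans ?_
  gcongr
  rw [div_mul_eq_mul_div, ← hc]
  gcongr
  have := mul_nonneg hc0 (pow_nonneg hρ0 n)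
  linarith

/-! ### Blocks of sites -/

/-- The `x`-th block of `N` consecutive sites. -/
noncomputable def siteBlock (N : ℕ) (x : ℤ) : Finset ℤ := Finset.Ioc ((x - 1) * N) (x * N)

/-- The index of the block of a site. -/
def blockIndex (N : ℕ) (i : ℤ) : ℤ := (i - 1) / N + 1

lemma mem_siteBlock {N : ℕ} (hN : 0 < N) {i x : ℤ} : i ∈ siteBlock N x ↔ blockIndex N i = x := by
  have hN' : (0 : ℤ) < N := by exact_mod_cast hN
  unfold siteBlock blockIndex
  rw [Finset.mem_Ioc]
  have h1 := Int.le_ediv_iff_mul_le (a := x - 1) (b := i - 1) hN'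
  have h2 := Int.ediv_lt_iff_lt_mul (a := i - 1) (b := x) hN'
  constructor
  · rintro ⟨h3, h4⟩
    have := h1.2 (by omega)
    have := h2.2 (by omega)
    omega
  · intro h
    have := h1.1 (by omega)
    have := h2.1 (by omega)
    omega

lemma card_siteBlock (N : ℕ) (x : ℤ) : (siteBlock N x).card = N := by
  unfold siteBlock
  rw [Int.card_Ioc, show x * N - (x - 1) * N = (N : ℤ) by ring, Int.toNat_natCast]

lemma siteBlock_disjoint {N : ℕ} (hN : 0 < N) {x y : ℤ} (h : x ≠ y) :
    Disjoint (siteBlock N x) (siteBlock N y) := by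
  rw [Finset.disjoint_left]
  intro i hi hj
  rw [mem_siteBlock hN] at hi hj
  exact h (hi.symm.trans hj)

/-- The sites of a finite set of blocks. -/
noncomputable def blockSites (N : ℕ) (X : Finset ℤ) : Finset ℤ := X.biUnion (siteBlock N)

lemma mem_blockSites {N : ℕ} (hN : 0 < N) {X : Finset ℤ} {i : ℤ} :
    i ∈ blockSites N X ↔ blockIndex N i ∈ X := by
  unfold blockSites
  rw [Finset.mem_biUnion]
  constructor
  · rintro ⟨x, hx, hi⟩
    rw [mem_siteBlock hN] at hi
    rwa [hi]
  · exact fun h => ⟨_, h, (mem_siteBlock hN).2 rfl⟩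

lemma sum_blockSites {N : ℕ} (hN : 0 < N) (X : Finset ℤ) (f : ℤ → ℝ) :
    ∑ i ∈ blockSites N X, f i = ∑ x ∈ X, ∑ i ∈ siteBlock N x, f i :=
  Finset.sum_biUnion fun _ _ _ _ h => siteBlock_disjoint hN h

lemma card_blockSites {N : ℕ} (hN : 0 < N) (X : Finset ℤ) :
    (blockSites N X).card = X.card * N := by
  unfold blockSites
  rw [Finset.card_biUnion fun _ _ _ _ h => siteBlock_disjoint hN h]
  simp [card_siteBlock]

/-- The mean spin in a block. -/
noncomputable def blockMean (N : ℕ) (τ : ℤ → ℝ) (x : ℤ) : ℝ := (∑ i ∈ siteBlock N x, τ i) / N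

/-! ### Replacing the interaction by the block interaction -/

/-- The interaction range 1/(2γ) is exactly Q N sites. Blocks at distance less than Q interact fully
and blocks at distance more than Q not at all. Only at distance Q are both kinds of pairs possible,
and the half weight makes the error γ/2 for either kind. -/
lemma abs_kac_sub_blockJ_le {N Q : ℕ} (hN : 0 < N) (hQ : 0 < Q) {γ : ℝ}
    (hγ : γ = 1 / (2 * Q * N)) (i j : ℤ) :
    |γ * kacJ (γ * ((i : ℝ) - j)) - blockJ Q (blockIndex N i - blockIndex N j) / N| ≤
      if |blockIndex N i - blockIndex N j| = Q then γ / 2 else 0 := by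
  have hN0 : (0 : ℝ) < N := by exact_mod_cast hN
  have hQ0 : (0 : ℝ) < Q := by exact_mod_cast hQ
  have hγ0 : 0 < γ := by rw [hγ]; positivity
  have hN' : (0 : ℤ) < N := by exact_mod_cast hN
  have hi := (mem_siteBlock hN (i := i)).2 rfl
  have hj := (mem_siteBlock hN (i := j)).2 rfl
  unfold siteBlock at hi hj
  rw [Finset.mem_Ioc] at hi hj
  set a := blockIndex N i
  set b := blockIndex N j
  have hkac : ∀ c : ℤ, c = i - j → (kacJ (γ * ((i : ℝ) - j)) = if |c| ≤ Q * N then 1 else 0) := by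
    intro c hc
    unfold kacJ
    have : |γ * ((i : ℝ) - j)| ≤ 1 / 2 ↔ |c| ≤ Q * N := by
      rw [abs_mul, abs_of_pos hγ0, hγ, div_mul_eq_mul_div, div_le_div_iff₀ (by positivity) two_pos,
        hc]
      constructor
      · intro h
        have : |(i : ℝ) - j| ≤ Q * N := by linarith
        exact_mod_cast this
      · intro h
        have : |(i : ℝ) - j| ≤ Q * N := by exact_mod_cast h
        linarith
    simp only [this]
  rw [hkac _ rfl]
  rcases lt_trichotomy |a - b| (Q : ℤ) with h | h | h
  · have h1 : |i - j| ≤ Q * N := by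
      rw [abs_lt] at h
      rw [abs_le]
      constructor <;> nlinarith
    have h2 : blockJ Q (a - b) = 1 / (2 * Q) := if_pos h
    rw [if_pos h1, h2, if_neg h.ne]
    apply le_of_eq
    rw [abs_eq_zero, hγ]
    field_simp
    ring
  · have h2 : blockJ Q (a - b) = 1 / (4 * Q) := by
      unfold blockJ; rw [if_neg (by omega), if_pos h]
    have h3 : (1 : ℝ) / (4 * Q) / N = γ / 2 := by rw [hγ]; field_simp; norm_num
    rw [h2, h3, if_pos h]
    split_ifs
    · rw [abs_of_nonneg] <;> linarith
    · rw [abs_of_nonpos] <;> linarith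
  · have h1 : ¬|i - j| ≤ Q * N := by
      rw [not_le]
      rw [lt_abs] at h ⊢
      rcases h with h | h
      · left; nlinarith
      · right; nlinarith
    rw [if_neg h1, blockJ_eq_zero h, if_neg h.ne']
    simp

/-- For a given site, only the 2N sites in the two blocks at distance Q contribute, each at most
γ/2. -/
lemma sum_abs_kac_sub_blockJ_le {N Q : ℕ} (hN : 0 < N) (hQ : 0 < Q) {γ : ℝ}
    (hγ : γ = 1 / (2 * Q * N)) (i : ℤ) (Λ : Finset ℤ) :
    ∑ j ∈ Λ, |γ * kacJ (γ * ((i : ℝ) - j)) - blockJ Q (blockIndex N i - blockIndex N j) / N| ≤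
      γ * N := by
  have hN0 : (0 : ℝ) < N := by exact_mod_cast hN
  have hQ0 : (0 : ℝ) < Q := by exact_mod_cast hQ
  have hγ0 : 0 < γ := by rw [hγ]; positivity
  refine (Finset.sum_le_sum fun j _ => abs_kac_sub_blockJ_le hN hQ hγ i j).trans ?_
  rw [← Finset.sum_filter, Finset.sum_const, nsmul_eq_mul]
  have hsub : Λ.filter (fun j => |blockIndex N i - blockIndex N j| = Q) ⊆
      siteBlock N (blockIndex N i - Q) ∪ siteBlock N (blockIndex N i + Q) := by
    intro j hj
    rw [Finset.mem_filter] at hj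
    rw [Finset.mem_union, mem_siteBlock hN, mem_siteBlock hN]
    rcases (abs_eq (by positivity)).1 hj.2 with h | h
    · left; omega
    · right; omega
  have hcard := (Finset.card_le_card hsub).trans (Finset.card_union_le _ _)
  rw [card_siteBlock, card_siteBlock] at hcard
  have : ((Λ.filter (fun j => |blockIndex N i - blockIndex N j| = Q)).card : ℝ) ≤ N + N := by
    exact_mod_cast hcard
  nlinarith

lemma kacJ_neg (r : ℝ) : kacJ (-r) = kacJ r := by unfold kacJ; rw [abs_neg]

lemma kacJ_comm (γ : ℝ) (i j : ℤ) : kacJ (γ * ((i : ℝ) - j)) = kacJ (γ * ((j : ℝ) - i)) := by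
  rw [← kacJ_neg]; ring_nf

/-- Change of a symmetric quadratic form. -/
lemma quadratic_change (Λ : Finset ℤ) (k : ℤ → ℤ → ℝ) (hk : ∀ i j, k i j = k j i)
    (τ τ' : ℤ → ℝ) (I : Finset ℤ) (hI : I ⊆ Λ) (hoff : ∀ i ∉ I, τ' i = τ i) :
    ∑ i ∈ Λ, ∑ j ∈ Λ, k i j * (τ' i * τ' j) - ∑ i ∈ Λ, ∑ j ∈ Λ, k i j * (τ i * τ j) =
      2 * ∑ i ∈ I, (τ' i - τ i) * ∑ j ∈ Λ, k i j * τ j +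
        ∑ i ∈ I, ∑ j ∈ I, k i j * ((τ' i - τ i) * (τ' j - τ j)) := by
  have hz : ∀ i ∉ I, τ' i - τ i = 0 := fun i hi => by rw [hoff i hi, sub_self]
  have h1 : ∑ i ∈ I, (τ' i - τ i) * ∑ j ∈ Λ, k i j * τ j =
      ∑ i ∈ Λ, ∑ j ∈ Λ, k i j * ((τ' i - τ i) * τ j) := by
    rw [Finset.sum_subset hI (fun i _ hi => by rw [hz i hi, zero_mul])]
    refine Finset.sum_congr rfl fun i _ => ?_
    rw [Finset.mul_sum]
    exact Finset.sum_congr rfl fun j _ => by ring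
  have h2 : ∑ i ∈ I, ∑ j ∈ I, k i j * ((τ' i - τ i) * (τ' j - τ j)) =
      ∑ i ∈ Λ, ∑ j ∈ Λ, k i j * ((τ' i - τ i) * (τ' j - τ j)) := by
    rw [Finset.sum_subset hI (fun i _ hi => by simp [hz i hi])]
    refine Finset.sum_congr rfl fun i _ => ?_
    exact Finset.sum_subset hI (fun j _ hj => by simp [hz j hj])
  have h3 : ∑ i ∈ Λ, ∑ j ∈ Λ, k i j * ((τ' i - τ i) * τ j) =
      ∑ i ∈ Λ, ∑ j ∈ Λ, k i j * (τ i * (τ' j - τ j)) := by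
    rw [Finset.sum_comm]
    exact Finset.sum_congr rfl fun i _ => Finset.sum_congr rfl fun j _ => by rw [hk]; ring
  have h4 : ∑ i ∈ Λ, ∑ j ∈ Λ, k i j * (τ' i * τ' j) - ∑ i ∈ Λ, ∑ j ∈ Λ, k i j * (τ i * τ j) =
      ∑ i ∈ Λ, ∑ j ∈ Λ, k i j * ((τ' i - τ i) * τ j) +
      ∑ i ∈ Λ, ∑ j ∈ Λ, k i j * (τ i * (τ' j - τ j)) +
      ∑ i ∈ Λ, ∑ j ∈ Λ, k i j * ((τ' i - τ i) * (τ' j - τ j)) := by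
    simp only [← Finset.sum_add_distrib, ← Finset.sum_sub_distrib]
    exact Finset.sum_congr rfl fun i _ => Finset.sum_congr rfl fun j _ => by ring
  rw [h4, ← h3, ← h1, ← h2]
  ring

/-- The block quadratic form in terms of block means. -/
lemma sum_blockJ_eq_localField {N Q : ℕ} (hN : 0 < N) (Λ : Finset ℤ) (τ : ℤ → ℝ) (i : ℤ)
    (hΛ : ∀ y ∈ Finset.Icc (blockIndex N i - Q) (blockIndex N i + Q), siteBlock N y ⊆ Λ) :
    ∑ j ∈ Λ, blockJ Q (blockIndex N i - blockIndex N j) / N * τ j =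
      localField Q (blockMean N τ) (blockIndex N i) := by
  set x := blockIndex N i
  have hsub : blockSites N (Finset.Icc (x - Q) (x + Q)) ⊆ Λ := fun j hj => by
    rw [mem_blockSites hN] at hj
    exact hΛ _ hj ((mem_siteBlock hN).2 rfl)
  rw [← Finset.sum_subset hsub, sum_blockSites hN]
  · unfold localField blockMean
    refine Finset.sum_congr rfl fun y _ => ?_
    rw [← mul_div_assoc, ← div_mul_eq_mul_div, Finset.mul_sum]
    refine Finset.sum_congr rfl fun j hj => ?_
    rw [(mem_siteBlock hN).1 hj]
  · intro j _ hj
    rw [mem_blockSites hN, Finset.mem_Icc] at hj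
    rw [blockJ_eq_zero (by rw [lt_abs]; omega)]
    simp

/-- Change of the energy when the spins in a set of blocks are changed, in terms of block means. -/
lemma hamiltonian_change_le {N Q : ℕ} (hN : 0 < N) (hQ : 0 < Q) {γ θ : ℝ} (hθ : 0 ≤ θ)
    (hγ : γ = 1 / (2 * Q * N)) (h h' : ℤ → ℝ) (Λ X : Finset ℤ)
    (hΛ : ∀ x ∈ X, ∀ y ∈ Finset.Icc (x - Q) (x + Q), siteBlock N y ⊆ Λ) (σ σ' : Config)
    (hoff : ∀ i ∉ blockSites N X, σ' i = σ i) :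
    hamiltonian θ γ h Λ σ' - hamiltonian θ γ h Λ σ ≤
      -N * (∑ x ∈ X, (blockMean N (fun i => spin (σ' i)) x - blockMean N (fun i => spin (σ i)) x) *
          localField Q (blockMean N (fun i => spin (σ i))) x +
        (∑ x ∈ X, ∑ y ∈ X, blockJ Q (x - y) *
          ((blockMean N (fun i => spin (σ' i)) x - blockMean N (fun i => spin (σ i)) x) *
           (blockMean N (fun i => spin (σ' i)) y - blockMean N (fun i => spin (σ i)) y))) / 2)
      - θ * ∑ x ∈ X, ∑ i ∈ siteBlock N x, h' i * (spin (σ' i) - spin (σ i))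
      + 2 * X.card * N * (γ * N) + 2 * θ * ∑ x ∈ X, ∑ i ∈ siteBlock N x, |h i - h' i| := by
  have hN0 : (0 : ℝ) < N := by exact_mod_cast hN
  set τ : ℤ → ℝ := fun i => spin (σ i) with hτ
  set τ' : ℤ → ℝ := fun i => spin (σ' i) with hτ'
  have hoff' : ∀ i ∉ blockSites N X, τ' i = τ i := fun i hi => by rw [hτ, hτ']; simp [hoff i hi]
  have habs : ∀ b : Bool, |spin b| = 1 := fun b => by cases b <;> simp [spin]
  have hτ1 : ∀ i, |τ i| = 1 := fun i => habs _
  have hτ1' : ∀ i, |τ' i| = 1 := fun i => habs _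
  set I := blockSites N X with hI
  have hIΛ : I ⊆ Λ := fun i hi => by
    rw [hI, mem_blockSites hN] at hi
    exact hΛ _ hi (blockIndex N i) (by simp) ((mem_siteBlock hN).2 rfl)
  set g : ℤ → ℤ → ℝ := fun i j => γ * kacJ (γ * ((i : ℝ) - j)) with hg
  set k : ℤ → ℤ → ℝ := fun i j => blockJ Q (blockIndex N i - blockIndex N j) / N with hk
  have hgs : ∀ i j, g i j = g j i := fun i j => by simp only [hg]; rw [kacJ_comm]
  have hks : ∀ i j, k i j = k j i := fun i j => by simp only [hk]; rw [blockJ_sub_comm]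
  have hH : ∀ ς : Config, hamiltonian θ γ h Λ ς =
      -(1 / 2) * ∑ i ∈ Λ, ∑ j ∈ Λ, g i j * (spin (ς i) * spin (ς j)) -
        θ * ∑ i ∈ Λ, h i * spin (ς i) := fun ς => by
    unfold hamiltonian
    simp only [hg, mul_assoc]
  -- the quadratic part
  have hq := quadratic_change Λ k hks τ τ' I hIΛ hoff'
  have hq1 : ∑ i ∈ I, (τ' i - τ i) * ∑ j ∈ Λ, k i j * τ j =
      N * ∑ x ∈ X, (blockMean N τ' x - blockMean N τ x) * localField Q (blockMean N τ) x := by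
    rw [hI, sum_blockSites hN, Finset.mul_sum]
    refine Finset.sum_congr rfl fun x hx => ?_
    have : ∀ i ∈ siteBlock N x, (τ' i - τ i) * ∑ j ∈ Λ, k i j * τ j =
        (τ' i - τ i) * localField Q (blockMean N τ) x := fun i hi => by
      have hix := (mem_siteBlock hN).1 hi
      have := sum_blockJ_eq_localField (Q := Q) hN Λ τ i (by rw [hix]; exact hΛ x hx)
      rw [hix] at this
      rw [← this, ← hix]
    rw [Finset.sum_congr rfl this, ← Finset.sum_mul, Finset.sum_sub_distrib]
    unfold blockMean
    field_simp
  have hq2 : ∑ i ∈ I, ∑ j ∈ I, k i j * ((τ' i - τ i) * (τ' j - τ j)) =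
      N * ∑ x ∈ X, ∑ y ∈ X, blockJ Q (x - y) *
        ((blockMean N τ' x - blockMean N τ x) * (blockMean N τ' y - blockMean N τ y)) := by
    rw [hI, sum_blockSites hN, Finset.mul_sum]
    refine Finset.sum_congr rfl fun x _ => ?_
    simp only [sum_blockSites hN]
    rw [Finset.sum_comm, Finset.mul_sum]
    refine Finset.sum_congr rfl fun y _ => ?_
    have h1 : ∀ z, blockMean N τ' z - blockMean N τ z =
        (∑ i ∈ siteBlock N z, (τ' i - τ i)) / N := fun z => by
      unfold blockMean; rw [Finset.sum_sub_distrib, sub_div]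
    have h2 : ∀ i ∈ siteBlock N x, ∑ j ∈ siteBlock N y, k i j * ((τ' i - τ i) * (τ' j - τ j)) =
        ∑ j ∈ siteBlock N y, blockJ Q (x - y) / N * ((τ' i - τ i) * (τ' j - τ j)) :=
      fun i hi => Finset.sum_congr rfl fun j hj => by
        simp only [hk]; rw [(mem_siteBlock hN).1 hi, (mem_siteBlock hN).1 hj]
    rw [Finset.sum_congr rfl h2, h1, h1]
    simp only [← Finset.mul_sum]
    rw [← Finset.sum_mul]
    field_simp
  -- the error of the quadratic part
  have hr : |(∑ i ∈ Λ, ∑ j ∈ Λ, g i j * (τ' i * τ' j) - ∑ i ∈ Λ, ∑ j ∈ Λ, g i j * (τ i * τ j)) -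
      (∑ i ∈ Λ, ∑ j ∈ Λ, k i j * (τ' i * τ' j) - ∑ i ∈ Λ, ∑ j ∈ Λ, k i j * (τ i * τ j))| ≤
      4 * (I.card * (γ * N)) := by
    have e1 : (∑ i ∈ Λ, ∑ j ∈ Λ, g i j * (τ' i * τ' j) - ∑ i ∈ Λ, ∑ j ∈ Λ, g i j * (τ i * τ j)) -
        (∑ i ∈ Λ, ∑ j ∈ Λ, k i j * (τ' i * τ' j) - ∑ i ∈ Λ, ∑ j ∈ Λ, k i j * (τ i * τ j)) =
        ∑ i ∈ Λ, ∑ j ∈ Λ, (g i j - k i j) * (τ' i * τ' j - τ i * τ j) := by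
      simp only [← Finset.sum_sub_distrib]
      exact Finset.sum_congr rfl fun i _ => Finset.sum_congr rfl fun j _ => by ring
    -- A pair contributes only if one of its sites is in I; the error is charged to that site, or to
    -- both. By symmetry the two charges have equal sums, which gives the factor 4 in `hr`.
    have e2 : ∀ i ∈ Λ, ∀ j ∈ Λ, |(g i j - k i j) * (τ' i * τ' j - τ i * τ j)| ≤
        (if i ∈ I then 2 * |g i j - k i j| else 0) +
          (if j ∈ I then 2 * |g i j - k i j| else 0) := by
      intro i _ j _
      have h2 : |τ' i * τ' j - τ i * τ j| ≤ 2 := by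
        refine (abs_sub _ _).trans ?_
        rw [abs_mul, abs_mul, hτ1, hτ1, hτ1', hτ1']; norm_num
      have h0 := abs_nonneg (g i j - k i j)
      rw [abs_mul]
      by_cases hi : i ∈ I <;> by_cases hj : j ∈ I <;> simp only [hi, hj, if_true, if_false]
      · nlinarith
      · nlinarith
      · nlinarith
      · rw [hoff' i hi, hoff' j hj]; simp
    have e3 : ∑ i ∈ Λ, ∑ j ∈ Λ, (if i ∈ I then 2 * |g i j - k i j| else 0) ≤
        2 * (I.card * (γ * N)) := by
      rw [← Finset.sum_subset hIΛ (fun i _ hi => by simp [hi])]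
      have : ∀ i ∈ I, ∑ j ∈ Λ, (if i ∈ I then 2 * |g i j - k i j| else 0) ≤ 2 * (γ * N) := by
        intro i hi
        simp only [hi, if_true]
        rw [← Finset.mul_sum]
        exact mul_le_mul_of_nonneg_left (sum_abs_kac_sub_blockJ_le hN hQ hγ i Λ) two_pos.le
      refine (Finset.sum_le_card_nsmul _ _ _ this).trans (le_of_eq ?_)
      rw [nsmul_eq_mul]; ring
    have e4 : ∑ i ∈ Λ, ∑ j ∈ Λ, (if j ∈ I then 2 * |g i j - k i j| else 0) =
        ∑ i ∈ Λ, ∑ j ∈ Λ, (if i ∈ I then 2 * |g i j - k i j| else 0) := by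
      rw [Finset.sum_comm]
      exact Finset.sum_congr rfl fun i _ => Finset.sum_congr rfl fun j _ => by
        rw [hgs j i, hks j i]
    rw [e1]
    refine (Finset.abs_sum_le_sum_abs _ _).trans ((Finset.sum_le_sum fun i hi =>
      (Finset.abs_sum_le_sum_abs _ _).trans (Finset.sum_le_sum fun j hj => e2 i hi j hj)).trans ?_)
    simp only [Finset.sum_add_distrib]
    rw [e4]
    linarith
  -- the field part
  have hf : ∑ i ∈ Λ, h i * τ' i - ∑ i ∈ Λ, h i * τ i =
      ∑ x ∈ X, ∑ i ∈ siteBlock N x, h i * (τ' i - τ i) := by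
    rw [← sum_blockSites hN, ← hI, ← Finset.sum_sub_distrib,
      Finset.sum_subset hIΛ (fun i _ hi => by rw [hoff' i hi]; ring)]
    exact Finset.sum_congr rfl fun i _ => by ring
  have hf2 : ∑ x ∈ X, ∑ i ∈ siteBlock N x, h' i * (τ' i - τ i) -
      2 * ∑ x ∈ X, ∑ i ∈ siteBlock N x, |h i - h' i| ≤
      ∑ x ∈ X, ∑ i ∈ siteBlock N x, h i * (τ' i - τ i) := by
    rw [Finset.mul_sum, ← Finset.sum_sub_distrib]
    refine Finset.sum_le_sum fun x _ => ?_
    rw [Finset.mul_sum, ← Finset.sum_sub_distrib]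
    refine Finset.sum_le_sum fun i _ => ?_
    have h1 : |τ' i - τ i| ≤ 2 := by
      refine (abs_sub _ _).trans ?_
      rw [hτ1, hτ1']; norm_num
    have h2 : |(h i - h' i) * (τ' i - τ i)| ≤ |h i - h' i| * 2 := by
      rw [abs_mul]; exact mul_le_mul_of_nonneg_left h1 (abs_nonneg _)
    have := (abs_le.1 h2).1
    linarith
  have hcard : (I.card : ℝ) = X.card * N := by rw [hI, card_blockSites hN]; push_cast; rfl
  rw [hcard] at hr
  have hr1 := (abs_le.1 hr).1
  rw [hq, hq1, hq2] at hr1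
  rw [hH, hH]
  have hθf := mul_le_mul_of_nonneg_left hf2 hθ
  rw [← hf] at hθf
  simp only [hτ, hτ'] at hr1 hθf ⊢
  linarith

/-! ### Changing a configuration in a finite set of sites -/

/-- The configuration `σ`, replaced by `s` in the finite set `I`. -/
def patch (I : Finset ℤ) (σ : Config) (s : I → Bool) : Config :=
  fun i => if hi : i ∈ I then s ⟨i, hi⟩ else σ i

lemma patch_of_notMem {I : Finset ℤ} (σ : Config) (s : I → Bool) {i : ℤ} (hi : i ∉ I) :
    patch I σ s i = σ i := dif_neg hi

lemma patch_patch (I : Finset ℤ) (σ : Config) (s s' : I → Bool) :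
    patch I (patch I σ s) s' = patch I σ s' := by
  funext i
  unfold patch
  split_ifs <;> rfl

/-- Summation over the spins in `I ⊆ Λ` and over the remaining ones. -/
lemma sum_extend_eq {I Λ : Finset ℤ} (hI : I ⊆ Λ) (f : Config → ℝ) :
    ∑ s : Λ → Bool, f (extend Λ s) =
      ∑ b : {i : Λ // (i : ℤ) ∉ I} → Bool, ∑ a : I → Bool,
        f (patch I (extend Λ fun i => if h : (i : ℤ) ∈ I then true else b ⟨i, h⟩) a) := by
  let e : (Λ → Bool) ≃ ({i : Λ // (i : ℤ) ∉ I} → Bool) × (I → Bool) :=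
    { toFun := fun s => (fun i => s i.1, fun i => s ⟨i, hI i.2⟩)
      invFun := fun p i => if h : (i : ℤ) ∈ I then p.2 ⟨i, h⟩ else p.1 ⟨i, h⟩
      left_inv := fun s => by
        funext i
        by_cases h : (i : ℤ) ∈ I <;> simp [h]
      right_inv := fun p => by
        refine Prod.ext (funext fun i => ?_) (funext fun i => ?_)
        · simp [i.2]
        · simp }
  rw [← Fintype.sum_prod_type' (f := fun (b : {i : Λ // (i : ℤ) ∉ I} → Bool) (a : I → Bool) =>
    f (patch I (extend Λ fun i => if h : (i : ℤ) ∈ I then true else b ⟨i, h⟩) a))]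
  refine Fintype.sum_equiv e _ _ fun s => ?_
  congr 1
  funext i
  by_cases h : i ∈ I
  · simp [patch, extend, h, hI h, e]
  · by_cases h' : i ∈ Λ <;> simp [patch, extend, h, h', e]

/-- It suffices to compare with the spins outside `I` frozen, since they are summed in the same way
on both sides. -/
lemma sum_extend_le_of_patch {I Λ : Finset ℤ} (hI : I ⊆ Λ) (f g : Config → ℝ) (c : ℝ)
    (h : ∀ σ, ∑ a : I → Bool, f (patch I σ a) ≤ c * ∑ a : I → Bool, g (patch I σ a)) :
    ∑ s : Λ → Bool, f (extend Λ s) ≤ c * ∑ s : Λ → Bool, g (extend Λ s) := by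
  rw [sum_extend_eq hI, sum_extend_eq hI, Finset.mul_sum]
  exact Finset.sum_le_sum fun b _ => h _

/-! ### Counting -/

/-- The number of `+1` spins in `S`. -/
def plusCount (σ : Config) (S : Finset ℤ) : ℕ := (S.filter (fun i => σ i = true)).card

lemma plusCount_le (σ : Config) (S : Finset ℤ) : plusCount σ S ≤ S.card :=
  Finset.card_filter_le _ _

lemma sum_spin_eq (σ : Config) (S : Finset ℤ) :
    ∑ i ∈ S, spin (σ i) = 2 * (plusCount σ S : ℝ) - S.card := by
  have h1 : ∀ i, spin (σ i) = 2 * (if σ i = true then (1 : ℝ) else 0) - 1 := fun i => by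
    unfold spin; split_ifs <;> norm_num
  simp only [h1, Finset.sum_sub_distrib, ← Finset.mul_sum, Finset.sum_boole]
  simp [plusCount]

/-- As the cells partition `I`, a configuration on `I` amounts to an independent choice of the set
of plus sites in every cell. -/
lemma card_filter_plusCount {ι : Type*} (P : Finset ι) (C : ι → Finset ℤ)
    (hC : ∀ p ∈ P, ∀ q ∈ P, p ≠ q → Disjoint (C p) (C q)) (I : Finset ℤ)
    (hI : ∀ i, i ∈ I ↔ ∃ p ∈ P, i ∈ C p) (σ : Config) (n : ι → ℕ) :
    (Finset.univ.filter (fun s : I → Bool =>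
      ∀ p ∈ P, plusCount (patch I σ s) (C p) = n p)).card =
      ∏ p ∈ P, (C p).card.choose (n p) := by
  classical
  have hcard : (P.pi fun p => (C p).powersetCard (n p)).card =
      ∏ p ∈ P, (C p).card.choose (n p) := by
    rw [Finset.card_pi]
    exact Finset.prod_congr rfl fun p _ => Finset.card_powersetCard _ _
  rw [← hcard]
  refine Finset.card_bij
    (fun s _ => fun p _ => (C p).filter (fun i => patch I σ s i = true)) ?_ ?_ ?_
  · intro s hs
    rw [Finset.mem_filter] at hs
    rw [Finset.mem_pi]
    intro p hp
    rw [Finset.mem_powersetCard]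
    exact ⟨Finset.filter_subset _ _, hs.2 p hp⟩
  · intro s _ s' _ heq
    funext ⟨i, hi⟩
    obtain ⟨p, hp, hip⟩ := (hI i).1 hi
    have h1 : (C p).filter (fun i => patch I σ s i = true) =
        (C p).filter (fun i => patch I σ s' i = true) := congrFun (congrFun heq p) hp
    have h2 : patch I σ s i = true ↔ patch I σ s' i = true := by
      have h3 := Finset.ext_iff.1 h1 i
      rwa [Finset.mem_filter, Finset.mem_filter, and_iff_right hip, and_iff_right hip] at h3
    simp only [patch, hi, dif_pos] at h2
    exact Bool.eq_iff_iff.2 h2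
  · intro T hT
    rw [Finset.mem_pi] at hT
    have hT' : ∀ p (hp : p ∈ P), T p hp ⊆ C p ∧ (T p hp).card = n p := fun p hp =>
      Finset.mem_powersetCard.1 (hT p hp)
    have key : ∀ p (hp : p ∈ P), (C p).filter (fun i => patch I σ
        (fun i : I => decide (∃ p, ∃ hp : p ∈ P, (i : ℤ) ∈ T p hp)) i = true) = T p hp := by
      intro p hp
      ext i
      rw [Finset.mem_filter]
      constructor
      · rintro ⟨hip, hi⟩
        have hiI : i ∈ I := (hI i).2 ⟨p, hp, hip⟩
        simp only [patch, hiI, dif_pos, decide_eq_true_eq] at hi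
        obtain ⟨q, hq, hiq⟩ := hi
        by_cases hpq : p = q
        · subst hpq; exact hiq
        · exact absurd ((hT' q hq).1 hiq) (Finset.disjoint_left.1 (hC p hp q hq hpq) hip)
      · intro hi
        have hip := (hT' p hp).1 hi
        have hiI : i ∈ I := (hI i).2 ⟨p, hp, hip⟩
        refine ⟨hip, ?_⟩
        simp only [patch, hiI, dif_pos, decide_eq_true_eq]
        exact ⟨p, hp, hi⟩
    refine ⟨fun i : I => decide (∃ p, ∃ hp : p ∈ P, (i : ℤ) ∈ T p hp), ?_, ?_⟩
    · rw [Finset.mem_filter]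
      refine ⟨Finset.mem_univ _, fun p hp => ?_⟩
      unfold plusCount
      rw [key p hp]
      exact (hT' p hp).2
    · funext p hp
      exact key p hp

/-- Comparison of weights through the fibers of a map with few values. -/
lemma sum_le_of_fibers {S π : Type*} [Fintype S] [DecidableEq π] (w : S → ℝ) (hw : ∀ s, 0 ≤ w s)
    (prof : S → π) (Pf : Finset π) (hPf : ∀ s, prof s ∈ Pf) (bad good : S → Prop)
    [DecidablePred bad] [DecidablePred good] (M : ℝ) (hM : 0 ≤ M)
    (h : ∀ s, bad s → ∃ p', (∀ s', prof s' = p' → good s') ∧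
      0 < (Finset.univ.filter (fun s' => prof s' = p')).card ∧
      ∀ s₁ s', prof s₁ = prof s → prof s' = p' →
        w s₁ * (Finset.univ.filter (fun s' => prof s' = prof s)).card ≤
          M * (w s' * (Finset.univ.filter (fun s' => prof s' = p')).card)) :
    ∑ s, (if bad s then w s else 0) ≤ Pf.card * M * ∑ s, (if good s then w s else 0) := by
  have hgood0 : 0 ≤ ∑ s, (if good s then w s else 0) :=
    Finset.sum_nonneg fun s _ => by split_ifs <;> simp [hw]
  rw [← Finset.sum_fiberwise_of_maps_to (s := Finset.univ) (t := Pf) (g := prof)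
    (fun s _ => hPf s)]
  have key : ∀ p ∈ Pf, ∑ s ∈ Finset.univ.filter (fun s => prof s = p),
      (if bad s then w s else 0) ≤ M * ∑ s, (if good s then w s else 0) := by
    intro p _
    by_cases hex : ∃ s, prof s = p ∧ bad s
    · obtain ⟨s, rfl, hs⟩ := hex
      obtain ⟨p', hg, hcard, hle⟩ := h s hs
      set A := Finset.univ.filter (fun s' => prof s' = prof s) with hA
      set B := Finset.univ.filter (fun s' => prof s' = p') with hB
      have hB0 : (0 : ℝ) < B.card := by exact_mod_cast hcard
      have hA0 : (0 : ℝ) < A.card := by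
        have : 0 < A.card := Finset.card_pos.2 ⟨s, by simp [hA]⟩
        exact_mod_cast this
      have h1 : ∑ s₁ ∈ A, (if bad s₁ then w s₁ else 0) ≤ ∑ s₁ ∈ A, w s₁ :=
        Finset.sum_le_sum fun s _ => by split_ifs <;> simp [hw]
      have h2 : ∑ s' ∈ B, w s' ≤ ∑ s, (if good s then w s else 0) := by
        calc ∑ s' ∈ B, w s' = ∑ s' ∈ B, (if good s' then w s' else 0) :=
              Finset.sum_congr rfl fun s' hs' => by
                rw [if_pos (hg s' (by simpa [hB] using hs'))]
          _ ≤ _ := Finset.sum_le_sum_of_subset_of_nonneg (Finset.subset_univ _)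
              fun s _ _ => by split_ifs <;> simp [hw]
      -- Summing the pairwise bound over A × B produces the common factor |A||B|, so no matching
      -- between the two fibers is needed.
      have h3 : ∑ s₁ ∈ A, ∑ s' ∈ B, w s₁ * A.card ≤
          ∑ s₁ ∈ A, ∑ s' ∈ B, M * (w s' * B.card) :=
        Finset.sum_le_sum fun s₁ hs₁ => Finset.sum_le_sum fun s' hs' =>
          hle s₁ s' (by simpa [hA] using hs₁) (by simpa [hB] using hs')
      simp only [Finset.sum_const, nsmul_eq_mul, ← Finset.mul_sum, ← Finset.sum_mul] at h3
      have h4 : ∑ s₁ ∈ A, w s₁ ≤ M * ∑ s' ∈ B, w s' := by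
        refine le_of_mul_le_mul_left ?_ (mul_pos hA0 hB0)
        linarith
      exact (h1.trans h4).trans (mul_le_mul_of_nonneg_left h2 hM)
    · push Not at hex
      rw [Finset.sum_eq_zero fun s hs => if_neg (hex s (by simpa using hs))]
      positivity
  refine (Finset.sum_le_card_nsmul _ _ _ key).trans (le_of_eq ?_)
  rw [nsmul_eq_mul, mul_assoc]

/-! ### Improving a profile -/

/-- A decomposition of the blocks of `2 * K` sites into two halves. -/
structure HalfBlocks (K : ℕ) (B : Bool → ℤ → Finset ℤ) : Prop where
  card : ∀ b x, (B b x).card = K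
  disj : ∀ x, Disjoint (B true x) (B false x)
  union : ∀ x, B true x ∪ B false x = siteBlock (2 * K) x

/-- The components of the phase with mean magnetization `v`. -/
noncomputable def phaseComp (β θ v : ℝ) (b : Bool) : ℝ := Real.tanh (β * (v + spin b * θ))

/-- The distance of a block profile from the phase with mean magnetization `v`. -/
noncomputable def phaseDist (β θ v : ℝ) (m : Bool → ℝ) : ℝ :=
  ∑ b, |m b - phaseComp β θ v b|

lemma phaseDist_nonneg (β θ v : ℝ) (m : Bool → ℝ) : 0 ≤ phaseDist β θ v m :=
  Finset.sum_nonneg fun _ _ => abs_nonneg _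

lemma sum_phaseComp (β θ v : ℝ) : ∑ b, phaseComp β θ v b = 2 * gMap β θ v := by
  rw [Fintype.sum_bool]
  simp only [phaseComp, gMap, spin, if_true, Bool.false_eq_true, if_false]
  rw [show v + -1 * θ = v - θ by ring, one_mul]
  ring

/-- Both components increase with the mean magnetization, so their differences have the same sign
and the ℓ¹ distance is the difference of the sums. This reduces a two-component contraction to a
statement on `gMap` alone. -/
lemma sum_abs_phaseComp_sub {β : ℝ} (hβ : 0 ≤ β) (θ v w : ℝ) :
    ∑ b, |phaseComp β θ v b - phaseComp β θ w b| = 2 * |gMap β θ v - gMap β θ w| := by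
  have key : ∀ v w : ℝ, w ≤ v →
      ∑ b, |phaseComp β θ v b - phaseComp β θ w b| = 2 * |gMap β θ v - gMap β θ w| := by
    intro v w h
    have h1 : ∀ b, 0 ≤ phaseComp β θ v b - phaseComp β θ w b := fun b =>
      sub_nonneg.2 (tanh_strictMono.monotone (mul_le_mul_of_nonneg_left (by linarith) hβ))
    have h2 : 2 * (gMap β θ v - gMap β θ w) = ∑ b, (phaseComp β θ v b - phaseComp β θ w b) := by
      rw [Finset.sum_sub_distrib, sum_phaseComp, sum_phaseComp]; ring
    have h3 : 0 ≤ gMap β θ v - gMap β θ w := by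
      have := Finset.sum_nonneg fun b (_ : b ∈ Finset.univ) => h1 b
      linarith
    rw [abs_of_nonneg h3, h2]
    exact Finset.sum_congr rfl fun b _ => abs_of_nonneg (h1 b)
  rcases le_total w v with h | h
  · exact key v w h
  · rw [abs_sub_comm, ← key w v h]
    exact Finset.sum_congr rfl fun b _ => abs_sub_comm _ _

/-- Every profile can be moved closer to the phase, such that the gain in free energy controls
the deviation from the mean field equation. -/
lemma exists_improved_counts {K Q : ℕ} (hK : 0 < K) (hQ : 0 < Q) {β θ v₀ q : ℝ} (hβ : 1 ≤ β)
    (hfix : gMap β θ v₀ = v₀) (hq0 : 0 ≤ q) (n : Bool → ℤ → ℕ) (hn : ∀ b x, n b x ≤ K)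
    (t : ℤ → ℝ) (ht : ∀ x, t x = (∑ b, mag K (n b x)) / 2) (X : Finset ℤ)
    (hv : ∀ x ∈ X, |gMap β θ (localField Q t x) - v₀| ≤ q * |localField Q t x - v₀|) :
    ∃ (n' : Bool → ℤ → ℕ) (e : ℤ → ℝ), (∀ b x, n' b x ≤ K) ∧
      (∀ b x, |mag K (n' b x) - phaseComp β θ v₀ b| ≤ |mag K (n b x) - phaseComp β θ v₀ b|) ∧
      (∀ x ∈ X, phaseDist β θ v₀ (fun b => mag K (n b x)) ≤
        q * localField Q (fun y => phaseDist β θ v₀ (fun b => mag K (n b y))) x + e x) ∧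
      ∀ x, e x ^ 2 / (16 * β) - 4 / K ≤ ∑ b,
        ((entropyI (mag K (n b x)) - β * (localField Q t x + spin b * θ) * mag K (n b x)) -
          (entropyI (mag K (n' b x)) - β * (localField Q t x + spin b * θ) * mag K (n' b x)) -
          β / 2 * (mag K (n' b x) - mag K (n b x)) ^ 2) := by
  -- Every half block is moved in the local field of the old profile, with the phase component as
  -- target `a`; the error `e x` is the total distance of the block from the projections.
  choose n' hn' p hp hd hdrop using fun b x => exists_move hK (hn b x) hβ (phaseComp β θ v₀ b)
    (β * (localField Q t x + spin b * θ))
  refine ⟨n', fun x => ∑ b, |mag K (n b x) - p b x|, hn', hd, ?_, ?_⟩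
  · intro x hx
    set D : ℤ → ℝ := fun y => phaseDist β θ v₀ (fun b => mag K (n b y)) with hD
    have h1 : phaseDist β θ v₀ (fun b => mag K (n b x)) ≤
        ∑ b, (|phaseComp β θ (localField Q t x) b - phaseComp β θ v₀ b| +
          |mag K (n b x) - p b x|) := by
      unfold phaseDist
      refine Finset.sum_le_sum fun b _ => ?_
      have h2 := hp b x
      have h3 := abs_add_le (mag K (n b x) - p b x) (p b x - phaseComp β θ v₀ b)
      rw [sub_add_sub_cancel] at h3
      unfold phaseComp at *
      linarith
    refine h1.trans ?_
    rw [Finset.sum_add_distrib]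
    refine add_le_add_left ?_ _
    rw [sum_abs_phaseComp_sub (by linarith), hfix]
    -- The mean of the two components deviates by at most half of the ℓ¹ distance; this compensates
    -- for the factor 2 in `sum_abs_phaseComp_sub`.
    have h4 : |localField Q t x - v₀| ≤ localField Q (fun y => D y / 2) x := by
      refine abs_localField_sub_le hQ t _ v₀ x fun y _ => ?_
      rw [ht, hD]
      unfold phaseDist
      have h5 : (∑ b, mag K (n b y)) / 2 - v₀ =
          (∑ b, (mag K (n b y) - phaseComp β θ v₀ b)) / 2 := by
        rw [Finset.sum_sub_distrib, sum_phaseComp, hfix]; ring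
      rw [h5, abs_div, abs_two]
      gcongr
      exact Finset.abs_sum_le_sum_abs _ _
    have h6 : localField Q (fun y => D y / 2) x = localField Q D x / 2 := by
      unfold localField
      rw [Finset.sum_div]
      exact Finset.sum_congr rfl fun y _ => by ring
    rw [h6] at h4
    have h7 := (hv x hx).trans (mul_le_mul_of_nonneg_left h4 hq0)
    linarith
  · intro x
    have h1 : (∑ b, |mag K (n b x) - p b x|) ^ 2 / (16 * β) - 4 / K ≤
        ∑ b, ((mag K (n b x) - p b x) ^ 2 / (8 * β) - 2 / K) := by
      rw [Finset.sum_sub_distrib, ← Finset.sum_div, Fintype.sum_bool, Fintype.sum_bool]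
      have h2 : (|mag K (n true x) - p true x| + |mag K (n false x) - p false x|) ^ 2 / (16 * β) ≤
          ((mag K (n true x) - p true x) ^ 2 + (mag K (n false x) - p false x) ^ 2) / (8 * β) := by
        rw [div_le_div_iff₀ (by positivity) (by positivity)]
        have h3 := sq_nonneg (|mag K (n true x) - p true x| - |mag K (n false x) - p false x|)
        rw [← sq_abs (mag K (n true x) - p true x), ← sq_abs (mag K (n false x) - p false x)]
        nlinarith
      have h4 : ∑ _b : Bool, (2 : ℝ) / K = 4 / K := by rw [Fintype.sum_bool]; ring
      rw [h4]
      linarith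
    exact h1.trans (Finset.sum_le_sum fun b _ => hdrop b x)

/-! ### Comparison of the weights -/

section
variable {K : ℕ} {B : Bool → ℤ → Finset ℤ}

lemma HalfBlocks.sum_siteBlock (hB : HalfBlocks K B) (f : ℤ → ℝ) (x : ℤ) :
    ∑ i ∈ siteBlock (2 * K) x, f i = ∑ b, ∑ i ∈ B b x, f i := by
  rw [← hB.union, Finset.sum_union (hB.disj x), Fintype.sum_bool]

lemma HalfBlocks.sum_spin (hB : HalfBlocks K B) (hK : 0 < K) (σ : Config) (b : Bool) (x : ℤ) :
    ∑ i ∈ B b x, spin (σ i) = K * mag K (plusCount σ (B b x)) := by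
  have hK0 : (0 : ℝ) < K := by exact_mod_cast hK
  rw [sum_spin_eq, hB.card]
  unfold mag
  field_simp

lemma HalfBlocks.blockMean_eq (hB : HalfBlocks K B) (hK : 0 < K) (σ : Config) (x : ℤ) :
    blockMean (2 * K) (fun i => spin (σ i)) x = (∑ b, mag K (plusCount σ (B b x))) / 2 := by
  have hK0 : (0 : ℝ) < K := by exact_mod_cast hK
  unfold blockMean
  rw [hB.sum_siteBlock]
  simp only [hB.sum_spin hK, ← Finset.mul_sum]
  push_cast
  field_simp

lemma HalfBlocks.sum_idealField (hB : HalfBlocks K B) (hK : 0 < K) (h' : ℤ → ℝ)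
    (hh' : ∀ b x, ∀ i ∈ B b x, h' i = spin b) (σ σ' : Config) (x : ℤ) :
    ∑ i ∈ siteBlock (2 * K) x, h' i * (spin (σ' i) - spin (σ i)) =
      K * ∑ b, spin b * (mag K (plusCount σ' (B b x)) - mag K (plusCount σ (B b x))) := by
  rw [hB.sum_siteBlock, Finset.mul_sum]
  refine Finset.sum_congr rfl fun b _ => ?_
  rw [Finset.sum_congr rfl fun i hi => by rw [hh' b x i hi], ← Finset.mul_sum,
    Finset.sum_sub_distrib, hB.sum_spin hK, hB.sum_spin hK]
  ring

lemma sq_half_sum_le (d : Bool → ℝ) : ((∑ b, d b) / 2) ^ 2 ≤ (∑ b, d b ^ 2) / 2 := by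
  rw [Fintype.sum_bool, Fintype.sum_bool]
  nlinarith [sq_nonneg (d true - d false)]

/-- Comparison of the weights of two configurations in terms of the change of their profiles. -/
lemma HalfBlocks.hamiltonian_sub_le (hB : HalfBlocks K B) (hK : 0 < K) {Q : ℕ} (hQ : 0 < Q)
    {β θ γ : ℝ} (hβ : 0 ≤ β) (hθ : 0 ≤ θ) (hγ : γ = 1 / (2 * Q * (2 * K : ℕ)))
    (h h' : ℤ → ℝ) (hh' : ∀ b x, ∀ i ∈ B b x, h' i = spin b) (Λ X : Finset ℤ)
    (hΛ : ∀ x ∈ X, ∀ y ∈ Finset.Icc (x - Q) (x + Q), siteBlock (2 * K) y ⊆ Λ)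
    (σ σ' : Config) (hoff : ∀ i ∉ blockSites (2 * K) X, σ' i = σ i)
    (n n' : Bool → ℤ → ℕ) (hn : ∀ b, ∀ x ∈ X, plusCount σ (B b x) = n b x)
    (hn' : ∀ b, ∀ x ∈ X, plusCount σ' (B b x) = n' b x) (t : ℤ → ℝ)
    (ht : ∀ x, t x = blockMean (2 * K) (fun i => spin (σ i)) x) :
    β * (hamiltonian θ γ h Λ σ' - hamiltonian θ γ h Λ σ) ≤
      K * ∑ x ∈ X, ∑ b, (-(β * (localField Q t x + spin b * θ)) *
          (mag K (n' b x) - mag K (n b x)) + β / 2 * (mag K (n' b x) - mag K (n b x)) ^ 2) +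
        β * (2 * X.card * (2 * K : ℕ) * (γ * (2 * K : ℕ)) +
          2 * θ * ∑ x ∈ X, ∑ i ∈ siteBlock (2 * K) x, |h i - h' i|) := by
  have hK0 : (0 : ℝ) < K := by exact_mod_cast hK
  have h1 := hamiltonian_change_le (N := 2 * K) (by omega) hQ hθ hγ h h' Λ X hΛ σ σ' hoff
  have htt : t = blockMean (2 * K) (fun i => spin (σ i)) := funext ht
  rw [← htt] at h1
  set δ : Bool → ℤ → ℝ := fun b x => mag K (plusCount σ' (B b x)) - mag K (plusCount σ (B b x))
    with hδ
  have hΔ : ∀ x, blockMean (2 * K) (fun i => spin (σ' i)) x - t x = (∑ b, δ b x) / 2 := fun x => by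
    rw [ht, hB.blockMean_eq hK, hB.blockMean_eq hK, hδ, Finset.sum_sub_distrib]
    ring
  have hδn : ∀ b, ∀ x ∈ X, mag K (n' b x) - mag K (n b x) = δ b x := fun b x hx => by
    rw [hδ, ← hn b x hx, ← hn' b x hx]
  simp only [hΔ, hB.sum_idealField hK h' hh'] at h1
  -- The interaction among the moved blocks is bounded by the squares of the block moves, and these
  -- by the squares of the half-block moves. This is the origin of the term β/2 times the squared
  -- displacement that every move has to pay.
  have h2 := neg_sum_sq_le_sum_blockJ hQ X (fun x => (∑ b, δ b x) / 2)
  have h3 : ∑ x ∈ X, ((∑ b, δ b x) / 2) ^ 2 ≤ ∑ x ∈ X, (∑ b, δ b x ^ 2) / 2 :=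
    Finset.sum_le_sum fun x _ => sq_half_sum_le fun b => δ b x
  have h4 : ∑ x ∈ X, ∑ b, (-(β * (localField Q t x + spin b * θ)) *
      (mag K (n' b x) - mag K (n b x)) + β / 2 * (mag K (n' b x) - mag K (n b x)) ^ 2) =
      β * (-(2 * ∑ x ∈ X, (∑ b, δ b x) / 2 * localField Q t x) -
        θ * ∑ x ∈ X, ∑ b, spin b * δ b x + ∑ x ∈ X, (∑ b, δ b x ^ 2) / 2) := by
    rw [Finset.mul_sum, Finset.mul_sum, ← Finset.sum_neg_distrib, ← Finset.sum_sub_distrib,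
      ← Finset.sum_add_distrib, Finset.mul_sum]
    refine Finset.sum_congr rfl fun x hx => ?_
    simp only [hδn _ x hx, Fintype.sum_bool]
    ring
  rw [h4]
  set S1 := ∑ x ∈ X, (∑ b, δ b x) / 2 * localField Q t x
  set S2 := ∑ x ∈ X, ∑ b, spin b * δ b x
  set S3 := ∑ x ∈ X, (∑ b, δ b x ^ 2) / 2
  set S4 := ∑ x ∈ X, ∑ y ∈ X, blockJ Q (x - y) * ((∑ b, δ b x) / 2 * ((∑ b, δ b y) / 2))
  rw [← Finset.mul_sum] at h1
  have h5 := mul_le_mul_of_nonneg_left h1 hβ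
  refine h5.trans ?_
  have h6 : 0 ≤ β * K * (S4 + S3) := mul_nonneg (mul_nonneg hβ hK0.le) (by linarith)
  push_cast
  nlinarith

/-- Weights are multiplied by the number of configurations with the same profile, so energy and
entropy combine into the gain `he`. The upper bound for the old binomials is free; the lower bound
for the new ones costs log(K + 1) per half block. The constant 4 per block is K times the rounding
loss 4/K. -/
lemma HalfBlocks.weight_le (hB : HalfBlocks K B) (hK : 0 < K) {Q : ℕ} (hQ : 0 < Q)
    {β θ γ : ℝ} (hβ : 1 ≤ β) (hθ : 0 ≤ θ) (hγ : γ = 1 / (2 * Q * (2 * K : ℕ)))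
    (h h' : ℤ → ℝ) (hh' : ∀ b x, ∀ i ∈ B b x, h' i = spin b) (Λ X : Finset ℤ)
    (hΛ : ∀ x ∈ X, ∀ y ∈ Finset.Icc (x - Q) (x + Q), siteBlock (2 * K) y ⊆ Λ)
    (σ σ' : Config) (hoff : ∀ i ∉ blockSites (2 * K) X, σ' i = σ i)
    (n n' : Bool → ℤ → ℕ) (hnK : ∀ b x, n b x ≤ K) (hnK' : ∀ b x, n' b x ≤ K)
    (hn : ∀ b, ∀ x ∈ X, plusCount σ (B b x) = n b x)
    (hn' : ∀ b, ∀ x ∈ X, plusCount σ' (B b x) = n' b x) (t : ℤ → ℝ)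
    (ht : ∀ x, t x = blockMean (2 * K) (fun i => spin (σ i)) x) (e : ℤ → ℝ)
    (he : ∀ x, e x ^ 2 / (16 * β) - 4 / K ≤ ∑ b,
        ((entropyI (mag K (n b x)) - β * (localField Q t x + spin b * θ) * mag K (n b x)) -
          (entropyI (mag K (n' b x)) - β * (localField Q t x + spin b * θ) * mag K (n' b x)) -
          β / 2 * (mag K (n' b x) - mag K (n b x)) ^ 2)) :
    Real.exp (-β * hamiltonian θ γ h Λ σ) * ∏ x ∈ X, ∏ b, ((K.choose (n b x) : ℕ) : ℝ) ≤
      Real.exp (-(K / (16 * β) * ∑ x ∈ X, e x ^ 2) + X.card * (4 + 2 * Real.log (K + 1)) +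
        β * (2 * X.card * (2 * K : ℕ) * (γ * (2 * K : ℕ)) +
          2 * θ * ∑ x ∈ X, ∑ i ∈ siteBlock (2 * K) x, |h i - h' i|)) *
      (Real.exp (-β * hamiltonian θ γ h Λ σ') * ∏ x ∈ X, ∏ b, ((K.choose (n' b x) : ℕ) : ℝ)) := by
  have hK0 : (0 : ℝ) < K := by exact_mod_cast hK
  have hlow : ∏ x ∈ X, ∏ b, ((K.choose (n b x) : ℕ) : ℝ) ≤
      Real.exp (∑ x ∈ X, ∑ b, -(K * entropyI (mag K (n b x)))) := by
    rw [Real.exp_sum]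
    refine Finset.prod_le_prod (fun x _ => by positivity) fun x _ => ?_
    rw [Real.exp_sum]
    refine Finset.prod_le_prod (fun b _ => by positivity) fun b _ => ?_
    rw [Real.exp_neg, ← one_div, le_div_iff₀ (Real.exp_pos _)]
    exact choose_mul_exp_le_one hK (hnK b x)
  have hup : Real.exp (∑ x ∈ X, ∑ b, -(K * entropyI (mag K (n' b x)) + Real.log (K + 1))) ≤
      ∏ x ∈ X, ∏ b, ((K.choose (n' b x) : ℕ) : ℝ) := by
    rw [Real.exp_sum]
    refine Finset.prod_le_prod (fun x _ => (Real.exp_pos _).le) fun x _ => ?_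
    rw [Real.exp_sum]
    refine Finset.prod_le_prod (fun b _ => (Real.exp_pos _).le) fun b _ => ?_
    rw [Real.exp_neg, Real.exp_add, Real.exp_log (by positivity), ← one_div,
      div_le_iff₀ (by positivity)]
    have := one_le_choose_mul_exp hK (hnK' b x)
    linarith
  refine (mul_le_mul_of_nonneg_left hlow (Real.exp_pos _).le).trans ?_
  refine le_trans ?_ (mul_le_mul_of_nonneg_left (mul_le_mul_of_nonneg_left hup
    (Real.exp_pos _).le) (Real.exp_pos _).le)
  rw [← Real.exp_add, ← Real.exp_add, ← Real.exp_add, Real.exp_le_exp]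
  have h1 := hB.hamiltonian_sub_le hK hQ (by linarith : 0 ≤ β) hθ hγ h h' hh' Λ X hΛ σ σ' hoff
    n n' hn hn' t ht
  have h2 := mul_le_mul_of_nonneg_left (Finset.sum_le_sum fun x (_ : x ∈ X) => he x) hK0.le
  have e1 : K * ∑ x ∈ X, (e x ^ 2 / (16 * β) - 4 / K) =
      K / (16 * β) * ∑ x ∈ X, e x ^ 2 - 4 * X.card := by
    rw [Finset.sum_sub_distrib, ← Finset.sum_div, Finset.sum_const, nsmul_eq_mul]
    field_simp
  rw [e1] at h2
  have e2 : ∑ x ∈ X, ∑ b, ((entropyI (mag K (n b x)) -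
      β * (localField Q t x + spin b * θ) * mag K (n b x)) -
        (entropyI (mag K (n' b x)) - β * (localField Q t x + spin b * θ) * mag K (n' b x)) -
        β / 2 * (mag K (n' b x) - mag K (n b x)) ^ 2) =
      ∑ x ∈ X, ∑ b, entropyI (mag K (n b x)) - ∑ x ∈ X, ∑ b, entropyI (mag K (n' b x)) -
      ∑ x ∈ X, ∑ b, (-(β * (localField Q t x + spin b * θ)) *
          (mag K (n' b x) - mag K (n b x)) + β / 2 * (mag K (n' b x) - mag K (n b x)) ^ 2) := by
    simp only [← Finset.sum_sub_distrib]
    exact Finset.sum_congr rfl fun x _ => Finset.sum_congr rfl fun b _ => by ring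
  rw [e2] at h2
  have e3 : ∑ x ∈ X, ∑ b, -(K * entropyI (mag K (n b x))) =
      -(K * ∑ x ∈ X, ∑ b, entropyI (mag K (n b x))) := by
    simp only [Finset.sum_neg_distrib, ← Finset.mul_sum]
  have e4 : ∑ x ∈ X, ∑ b, -(K * entropyI (mag K (n' b x)) + Real.log (K + 1)) =
      -(K * ∑ x ∈ X, ∑ b, entropyI (mag K (n' b x))) - X.card * (2 * Real.log (K + 1)) := by
    simp only [Fintype.sum_bool, Finset.sum_neg_distrib, Finset.sum_add_distrib, Finset.sum_const,
      nsmul_eq_mul, ← Finset.mul_sum, Finset.card_univ, Fintype.card_bool]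
    push_cast
    ring
  rw [e3, e4]
  linarith

end

/-! ### Comparison of partition functions -/

/-- The distance of the profile of `σ` in the block `x` from the phase with mean `v`. -/
noncomputable def profileDist (K : ℕ) (B : Bool → ℤ → Finset ℤ) (β θ v : ℝ) (σ : Config)
    (x : ℤ) : ℝ :=
  phaseDist β θ v fun b => mag K (plusCount σ (B b x))

lemma plusCount_congr {σ σ' : Config} {S : Finset ℤ} (h : ∀ i ∈ S, σ' i = σ i) :
    plusCount σ' S = plusCount σ S := by
  unfold plusCount
  congr 1
  exact Finset.filter_congr fun i hi => by rw [h i hi]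

section
variable {K : ℕ} {B : Bool → ℤ → Finset ℤ}

lemma HalfBlocks.subset (hB : HalfBlocks K B) (b : Bool) (x : ℤ) :
    B b x ⊆ siteBlock (2 * K) x := by
  rw [← hB.union]
  cases b
  · exact Finset.subset_union_right
  · exact Finset.subset_union_left

lemma HalfBlocks.disjoint (hB : HalfBlocks K B) (hK : 0 < K) {b b' : Bool} {x x' : ℤ}
    (h : (b, x) ≠ (b', x')) : Disjoint (B b x) (B b' x') := by
  by_cases hx : x = x'
  · subst hx
    have hb : b ≠ b' := fun hb => h (by rw [hb])
    cases b <;> cases b'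
    · exact absurd rfl hb
    · exact (hB.disj x).symm
    · exact hB.disj x
    · exact absurd rfl hb
  · exact Finset.disjoint_of_subset_left (hB.subset b x) (Finset.disjoint_of_subset_right
      (hB.subset b' x') (siteBlock_disjoint (by omega) hx))

lemma HalfBlocks.card_filter_plusCount (hB : HalfBlocks K B) (hK : 0 < K) (X : Finset ℤ)
    (σ : Config) (n : Bool → ℤ → ℕ) :
    (Finset.univ.filter (fun s : blockSites (2 * K) X → Bool =>
      ∀ p ∈ X ×ˢ (Finset.univ : Finset Bool),
      plusCount (patch (blockSites (2 * K) X) σ s) (B p.2 p.1) = n p.2 p.1)).card =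
      ∏ x ∈ X, ∏ b, K.choose (n b x) := by
  rw [RFKac.card_filter_plusCount (X ×ˢ (Finset.univ : Finset Bool)) (fun p => B p.2 p.1) _ _ _ σ
    (fun p => n p.2 p.1), Finset.prod_product]
  · exact Finset.prod_congr rfl fun x _ => Finset.prod_congr rfl fun b _ => by
      simp only [hB.card]
  · intro p _ p' _ hpp
    refine hB.disjoint hK fun h => hpp ?_
    rw [Prod.mk.injEq] at h
    exact Prod.ext h.2 h.1
  · intro i
    rw [mem_blockSites (by omega)]
    constructor
    · intro hi
      have h1 := (mem_siteBlock (N := 2 * K) (by omega) (i := i)).2 rfl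
      rw [← hB.union, Finset.mem_union] at h1
      rcases h1 with h1 | h1
      · exact ⟨(_, true), Finset.mem_product.2 ⟨hi, Finset.mem_univ _⟩, h1⟩
      · exact ⟨(_, false), Finset.mem_product.2 ⟨hi, Finset.mem_univ _⟩, h1⟩
    · rintro ⟨p, hp, hi⟩
      rw [(mem_siteBlock (by omega)).1 (hB.subset _ _ hi)]
      exact (Finset.mem_product.1 hp).1

/-- If every configuration in `Bad` can be improved, then the partition function in `Bad` is much
smaller than the one in `Good`. -/
lemma HalfBlocks.partitionFn_le (hB : HalfBlocks K B) (hK : 0 < K) {Q : ℕ} (hQ : 0 < Q)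
    {β θ γ v₀ q r : ℝ} (hβ : 1 ≤ β) (hθ : 0 ≤ θ) (hγ : γ = 1 / (2 * Q * (2 * K : ℕ)))
    (hfix : gMap β θ v₀ = v₀) (hq0 : 0 ≤ q)
    (hg : ∀ v, |v - v₀| ≤ r → |gMap β θ v - v₀| ≤ q * |v - v₀|)
    (h h' : ℤ → ℝ) (hh' : ∀ b x, ∀ i ∈ B b x, h' i = spin b) (Λ X : Finset ℤ)
    (hΛ : ∀ x ∈ X, ∀ y ∈ Finset.Icc (x - Q) (x + Q), siteBlock (2 * K) y ⊆ Λ)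
    (Bad Good : Set Config) (E : ℝ)
    (hfield : ∀ σ ∈ Bad, ∀ x ∈ X, localField Q (profileDist K B β θ v₀ σ) x ≤ 2 * r)
    (hbad : ∀ σ ∈ Bad, ∀ e : ℤ → ℝ, (∀ x ∈ X, profileDist K B β θ v₀ σ x ≤
      q * localField Q (profileDist K B β θ v₀ σ) x + e x) → E ≤ ∑ x ∈ X, e x ^ 2)
    (hgood : ∀ σ ∈ Bad, ∀ σ' : Config,
      (∀ x, profileDist K B β θ v₀ σ' x ≤ profileDist K B β θ v₀ σ x) → σ' ∈ Good) :
    partitionFn β θ γ h Λ Bad ≤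
      ((K : ℝ) + 1) ^ (2 * X.card) * Real.exp (-(K / (16 * β) * E) +
        X.card * (4 + 2 * Real.log (K + 1)) + β * (2 * X.card * (2 * K : ℕ) * (γ * (2 * K : ℕ)) +
          2 * θ * ∑ x ∈ X, ∑ i ∈ siteBlock (2 * K) x, |h i - h' i|)) *
      partitionFn β θ γ h Λ Good := by
  classical
  have hN : 0 < 2 * K := by omega
  set I := blockSites (2 * K) X with hI
  have hIΛ : I ⊆ Λ := fun i hi => by
    rw [hI, mem_blockSites hN] at hi
    exact hΛ _ hi (blockIndex (2 * K) i) (by simp) ((mem_siteBlock hN).2 rfl)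
  have hunfold : ∀ F : Set Config, partitionFn β θ γ h Λ F = ∑ s : Λ → Bool,
      (fun σ : Config => if σ ∈ F then Real.exp (-β * hamiltonian θ γ h Λ σ) else 0)
        (extend Λ s) := fun F => by
    unfold partitionFn
    exact Finset.sum_congr rfl fun s _ => by congr
  rw [hunfold, hunfold]
  refine sum_extend_le_of_patch hIΛ
    (fun σ => if σ ∈ Bad then Real.exp (-β * hamiltonian θ γ h Λ σ) else 0)
    (fun σ => if σ ∈ Good then Real.exp (-β * hamiltonian θ γ h Λ σ) else 0) _ fun σ => ?_
  set M : ℝ := Real.exp (-(K / (16 * β) * E) +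
        X.card * (4 + 2 * Real.log (K + 1)) + β * (2 * X.card * (2 * K : ℕ) * (γ * (2 * K : ℕ)) +
          2 * θ * ∑ x ∈ X, ∑ i ∈ siteBlock (2 * K) x, |h i - h' i|)) with hM
  set P : Finset (ℤ × Bool) := X ×ˢ Finset.univ with hP
  let prof : (I → Bool) → (P → ℕ) := fun s p => plusCount (patch I σ s) (B p.1.2 p.1.1)
  have hprof : ∀ s s', prof s = prof s' ↔
      ∀ b, ∀ x ∈ X, plusCount (patch I σ s) (B b x) = plusCount (patch I σ s') (B b x) := by
    intro s s'
    constructor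
    · intro hs b x hx
      exact congrFun hs ⟨(x, b), by simp [hP, hx]⟩
    · intro hs
      funext p
      exact hs _ _ (Finset.mem_product.1 p.2).1
  have hout : ∀ s s', ∀ b, ∀ x ∉ X,
      plusCount (patch I σ s) (B b x) = plusCount (patch I σ s') (B b x) := by
    intro s s' b x hx
    refine plusCount_congr fun i hi => ?_
    have : i ∉ I := by
      rw [hI, mem_blockSites hN, (mem_siteBlock hN).1 (hB.subset b x hi)]
      exact hx
    rw [patch_of_notMem _ _ this, patch_of_notMem _ _ this]
  have hfib : ∀ n : Bool → ℤ → ℕ, (Finset.univ.filter (fun s' : I → Bool =>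
      prof s' = fun p => n p.1.2 p.1.1)).card = ∏ x ∈ X, ∏ b, K.choose (n b x) := by
    intro n
    rw [← hB.card_filter_plusCount hK X σ n]
    congr 1
    ext s
    simp only [Finset.mem_filter, Finset.mem_univ, true_and]
    constructor
    · intro hs p hp
      exact congrFun hs ⟨p, hp⟩
    · intro hs
      funext p
      exact hs p.1 p.2
  have hmain := sum_le_of_fibers (fun s : I → Bool =>
      Real.exp (-β * hamiltonian θ γ h Λ (patch I σ s))) (fun s => (Real.exp_pos _).le) prof
      (Fintype.piFinset fun _ : P => Finset.range (K + 1))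
      (fun s => by
        rw [Fintype.mem_piFinset]
        intro p
        rw [Finset.mem_range, Nat.lt_succ_iff]
        exact (plusCount_le _ _).trans (hB.card _ _).le)
      (fun s => patch I σ s ∈ Bad) (fun s => patch I σ s ∈ Good) M (Real.exp_pos _).le ?_
  -- The prefactor counts profiles: K + 1 values for each of the 2|X| half blocks.
  · refine hmain.trans (le_of_eq ?_)
    rw [Fintype.card_piFinset]
    simp [hP, Finset.card_product, mul_comm]
  intro s hs
  set n : Bool → ℤ → ℕ := fun b x => plusCount (patch I σ s) (B b x) with hn
  have hnK : ∀ b x, n b x ≤ K := fun b x => (plusCount_le _ _).trans (hB.card _ _).le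
  set t : ℤ → ℝ := fun x => (∑ b, mag K (n b x)) / 2 with ht
  have hDn : profileDist K B β θ v₀ (patch I σ s) =
      fun y => phaseDist β θ v₀ (fun b => mag K (n b y)) := rfl
  obtain ⟨n', e, hn'K, hn'd, he1, he2⟩ := exists_improved_counts hK hQ hβ hfix hq0 n hnK t
    (fun _ => rfl) X (fun x hx => hg _ (by
      have h1 : |localField Q t x - v₀| ≤
          localField Q (fun y => profileDist K B β θ v₀ (patch I σ s) y / 2) x := by
        refine abs_localField_sub_le hQ t _ v₀ x fun y _ => ?_
        have h5 : t y - v₀ = (∑ b, (mag K (n b y) - phaseComp β θ v₀ b)) / 2 := by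
          rw [Finset.sum_sub_distrib, sum_phaseComp, hfix, ht]; ring
        rw [h5, abs_div, abs_two]
        gcongr
        exact Finset.abs_sum_le_sum_abs _ _
      have h6 : localField Q (fun y => profileDist K B β θ v₀ (patch I σ s) y / 2) x =
          localField Q (profileDist K B β θ v₀ (patch I σ s)) x / 2 := by
        unfold localField
        rw [Finset.sum_div]
        exact Finset.sum_congr rfl fun y _ => by ring
      rw [h6] at h1
      linarith [hfield _ hs x hx]))
  have hE := hbad _ hs e he1
  refine ⟨fun p => n' p.1.2 p.1.1, ?_, ?_, ?_⟩
  · intro s' hs'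
    refine hgood _ hs _ fun x => ?_
    unfold profileDist phaseDist
    refine Finset.sum_le_sum fun b _ => ?_
    beta_reduce
    by_cases hx : x ∈ X
    · have : plusCount (patch I σ s') (B b x) = n' b x :=
        congrFun hs' ⟨(x, b), by simp [hP, hx]⟩
      rw [this]
      exact hn'd b x
    · rw [hout s' s b x hx]
  · rw [hfib]
    exact Finset.prod_pos fun x _ => Finset.prod_pos fun b _ => Nat.choose_pos (hn'K b x)
  · intro s₁ s' hs₁ hs'
    have hc1 : ∀ b, ∀ x ∈ X, plusCount (patch I σ s₁) (B b x) = n b x := (hprof _ _).1 hs₁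
    have hc2 : ∀ b, ∀ x ∈ X, plusCount (patch I σ s') (B b x) = n' b x := fun b x hx =>
      congrFun hs' ⟨(x, b), by simp [hP, hx]⟩
    have hall : ∀ b x, plusCount (patch I σ s₁) (B b x) = n b x := fun b x => by
      by_cases hx : x ∈ X
      · exact hc1 b x hx
      · exact hout s₁ s b x hx
    have htx : ∀ x, t x = blockMean (2 * K) (fun i => spin (patch I σ s₁ i)) x := fun x => by
      rw [hB.blockMean_eq hK]
      simp only [hall]
      rfl
    have hoff : ∀ i ∉ I, patch I σ s' i = patch I σ s₁ i := fun i hi => by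
      rw [patch_of_notMem _ _ hi, patch_of_notMem _ _ hi]
    have hw := hB.weight_le hK hQ hβ hθ hγ h h' hh' Λ X hΛ (patch I σ s₁) (patch I σ s')
      hoff n n' hnK hn'K hc1 hc2 t htx e he2
    have hcs := hfib n
    have hcs' := hfib n'
    have hps : prof s = fun p => n p.1.2 p.1.1 := rfl
    rw [hps, hcs, hcs']
    push_cast
    push_cast at hw
    refine hw.trans (mul_le_mul_of_nonneg_right ?_ (by positivity))
    rw [hM, Real.exp_le_exp]
    push_cast
    have : K / (16 * β) * E ≤ K / (16 * β) * ∑ x ∈ X, e x ^ 2 := by gcongr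
    linarith

end

/-! ### Closeness to a phase in a unit block -/

/-- In every cell of `k` blocks of the `l`-th group of `q` cells the average of `D` is at most
`ζ`. -/
def CloseTo (k q : ℕ) (ζ : ℝ) (D : ℤ → ℝ) (l : ℤ) : Prop :=
  ∀ u ∈ siteBlock q l, ∑ x ∈ siteBlock k u, D x ≤ ζ * k

lemma CloseTo.mono {k q : ℕ} {ζ ζ' : ℝ} {D D' : ℤ → ℝ} {l : ℤ} (h : CloseTo k q ζ D l)
    (hζ : ζ ≤ ζ') (hD : ∀ x, D' x ≤ D x) : CloseTo k q ζ' D' l := fun u hu =>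
  (Finset.sum_le_sum fun x _ => hD x).trans ((h u hu).trans (by gcongr))

lemma siteBlock_mul {k q : ℕ} (hk : 0 < k) (l : ℤ) :
    siteBlock (k * q) l = blockSites k (siteBlock q l) := by
  have hk' : (0 : ℤ) < k := by exact_mod_cast hk
  ext x
  rw [mem_blockSites hk]
  have hx := (mem_siteBlock hk (i := x)).2 rfl
  simp only [siteBlock, Finset.mem_Ioc] at *
  push_cast
  set i := blockIndex k x
  constructor
  · rintro ⟨h1, h2⟩
    constructor
    · by_contra h
      have : i ≤ (l - 1) * q := not_lt.1 h
      nlinarith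
    · by_contra h
      have : l * q ≤ i - 1 := by omega
      nlinarith
  · rintro ⟨h1, h2⟩
    constructor
    · have : (l - 1) * q ≤ i - 1 := by omega
      nlinarith
    · nlinarith

lemma CloseTo.sum_le {k q : ℕ} (hk : 0 < k) {ζ : ℝ} {D : ℤ → ℝ} {l : ℤ}
    (h : CloseTo k q ζ D l) : ∑ x ∈ siteBlock (k * q) l, D x ≤ ζ * (k * q : ℕ) := by
  rw [siteBlock_mul hk, sum_blockSites hk]
  refine (Finset.sum_le_card_nsmul _ _ _ h).trans (le_of_eq ?_)
  rw [card_siteBlock, nsmul_eq_mul]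
  push_cast
  ring

/-- Cauchy–Schwarz in the one cell where the average of `D` exceeds ζ. -/
lemma sum_sq_ge_of_not_closeTo {k q : ℕ} (hk : 0 < k) {ζ : ℝ} (hζ : 0 ≤ ζ) {D : ℤ → ℝ} {l : ℤ}
    (h : ¬CloseTo k q ζ D l) : k * ζ ^ 2 ≤ ∑ x ∈ siteBlock (k * q) l, D x ^ 2 := by
  have hk0 : (0 : ℝ) < k := by exact_mod_cast hk
  unfold CloseTo at h
  push Not at h
  obtain ⟨u, hu, hlt⟩ := h
  rw [siteBlock_mul hk, sum_blockSites hk]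
  refine le_trans ?_ (Finset.single_le_sum (f := fun u => ∑ x ∈ siteBlock k u, D x ^ 2)
    (fun _ _ => Finset.sum_nonneg fun _ _ => sq_nonneg _) hu)
  have h1 := sq_sum_le_card_mul_sum_sq (s := siteBlock k u) (f := D)
  rw [card_siteBlock] at h1
  have h2 : (ζ * k) ^ 2 ≤ (∑ x ∈ siteBlock k u, D x) ^ 2 :=
    pow_le_pow_left₀ (by positivity) hlt.le 2
  refine le_of_mul_le_mul_left ?_ hk0
  nlinarith

lemma phaseDist_mag_le {K : ℕ} (hK : 0 < K) (β θ v : ℝ) (n : Bool → ℕ) (hn : ∀ b, n b ≤ K) :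
    phaseDist β θ v (fun b => mag K (n b)) ≤ 4 := by
  have : ∀ b, |mag K (n b) - phaseComp β θ v b| ≤ 2 := fun b => by
    have h1 := mag_mem_Icc hK (hn b)
    have h2 := tanh_mem_Ioo (β * (v + spin b * θ))
    unfold phaseComp
    rw [abs_le]
    constructor <;> linarith [h1.1, h1.2, h2.1, h2.2]
  unfold phaseDist
  rw [Fintype.sum_bool]
  linarith [this true, this false]

section
variable {k q Q : ℕ} {D : ℤ → ℝ} {ζ : ℝ}

/-- A unit block consists of 2Q blocks, so the range of Q blocks reaches at most the two
neighbouring units, and the kernel is bounded by 1/(2Q). -/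
lemma localField_le_of_closeTo (hk : 0 < k) (hkq : k * q = 2 * Q) (hQ : 0 < Q)
    (hD : ∀ x, 0 ≤ D x) {l x : ℤ} (hx : x ∈ siteBlock (2 * Q) l)
    (hc : ∀ l' ∈ Finset.Icc (l - 1) (l + 1), CloseTo k q ζ D l') :
    localField Q D x ≤ 3 * ζ := by
  have hQ0 : (0 : ℝ) < Q := by exact_mod_cast hQ
  have h1 := localField_le_sum (Q := Q) D hD x (blockSites (2 * Q) (Finset.Icc (l - 1) (l + 1)))
    (fun y hy => by
      have hy' := (mem_siteBlock (N := 2 * Q) (by omega) (i := y)).2 rfl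
      rw [mem_blockSites (by omega)]
      unfold siteBlock at *
      rw [Finset.mem_Icc, Finset.mem_Ioc] at *
      push_cast at hx hy'
      have hQ' : (0 : ℤ) < Q := by exact_mod_cast hQ
      set j := blockIndex (2 * Q) y
      constructor
      · by_contra h
        have : j ≤ l - 2 := by omega
        nlinarith
      · by_contra h
        have : l + 2 ≤ j := by omega
        nlinarith)
  refine h1.trans ?_
  rw [div_le_iff₀ (by positivity), sum_blockSites (by omega)]
  have h2 : ∀ l' ∈ Finset.Icc (l - 1) (l + 1), ∑ y ∈ siteBlock (2 * Q) l', D y ≤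
      ζ * (2 * Q : ℕ) := fun l' hl' => by
    have := (hc l' hl').sum_le hk
    rwa [hkq] at this
  refine (Finset.sum_le_card_nsmul _ _ _ h2).trans (le_of_eq ?_)
  rw [Int.card_Icc, show l + 1 + 1 - (l - 1) = 3 by ring, nsmul_eq_mul]
  push_cast
  ring

/-- Deviations from a phase far away from the boundary require deviations from the mean field
equation. -/
lemma le_sum_sq_of_not_closeTo (hk : 0 < k) (hkq : k * q = 2 * Q) (hQ : 0 < Q)
    (hD : ∀ x, 0 ≤ D x) (hD4 : ∀ x, D x ≤ 4) {c η ρ ζ' : ℝ} (hη : 0 < η)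
    (hρ : (1 + η) * c ^ 2 = ρ) (hρ1 : ρ < 1) (hζ' : 0 ≤ ζ') {l : ℤ} {l₀ : ℕ} (hl₀ : 0 < l₀)
    (hc : ∀ l' ∈ Finset.Icc (l - l₀) (l + l₀), CloseTo k q ζ D l')
    (hnc : ¬CloseTo k q ζ' D l) (e : ℤ → ℝ)
    (he : ∀ x ∈ blockSites (2 * Q) (Finset.Ioo (l - l₀) (l + l₀)),
      D x ≤ c * localField Q D x + e x) :
    k * ζ' ^ 2 ≤ ρ ^ (2 * l₀ - 1) * (4 * (2 * l₀ + 1) * (2 * Q) * ζ) +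
      (1 + 1 / η) / (1 - ρ) *
        ∑ x ∈ blockSites (2 * Q) (Finset.Ioo (l - l₀) (l + l₀)), e x ^ 2 := by
  have hQ' : (0 : ℤ) < Q := by exact_mod_cast hQ
  have hρ0 : 0 ≤ ρ := by rw [← hρ]; positivity
  have h1 := sum_sq_ge_of_not_closeTo hk hζ' hnc
  rw [hkq] at h1
  -- One contraction step consumes Q blocks, half a unit. With 2 l₀ - 1 steps the contraction is
  -- needed only inside the open interval of units, and the last window stays within l₀ units of l.
  have h2 := sum_sq_le_of_contraction hQ hD hη hρ hρ1 ((l - 1) * (2 * Q : ℕ)) (l * (2 * Q : ℕ))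
    (2 * l₀ - 1) (blockSites (2 * Q) (Finset.Ioo (l - l₀) (l + l₀))) (fun j hj x hx => by
      have hx' := (mem_siteBlock (N := 2 * Q) (by omega) (i := x)).2 rfl
      rw [mem_blockSites (by omega)]
      unfold siteBlock at hx'
      rw [Finset.mem_Ioc] at *
      rw [Finset.mem_Ioo]
      push_cast at hx hx'
      have hj' : (j : ℤ) ≤ 2 * l₀ - 2 := by omega
      set i := blockIndex (2 * Q) x
      constructor
      · by_contra h
        have : i ≤ l - l₀ := by omega
        nlinarith
      · by_contra h
        have : l + l₀ ≤ i := by omega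
        nlinarith) he
  refine (h1.trans h2).trans ?_
  gcongr
  calc ∑ x ∈ Finset.Ioc ((l - 1) * ((2 * Q : ℕ) : ℤ) - (2 * l₀ - 1 : ℕ) * Q)
        (l * ((2 * Q : ℕ) : ℤ) + (2 * l₀ - 1 : ℕ) * Q), D x ^ 2
      ≤ ∑ x ∈ blockSites (2 * Q) (Finset.Icc (l - l₀) (l + l₀)), D x ^ 2 := by
        refine Finset.sum_le_sum_of_subset_of_nonneg (fun x hx => ?_) fun _ _ _ => sq_nonneg _
        have hx' := (mem_siteBlock (N := 2 * Q) (by omega) (i := x)).2 rfl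
        rw [mem_blockSites (by omega)]
        unfold siteBlock at hx'
        rw [Finset.mem_Ioc] at *
        rw [Finset.mem_Icc]
        push_cast [show 1 ≤ 2 * l₀ by omega] at hx hx'
        set i := blockIndex (2 * Q) x
        constructor
        · by_contra h
          have : i ≤ l - l₀ - 1 := by omega
          nlinarith
        · by_contra h
          have : l + l₀ + 1 ≤ i := by omega
          nlinarith
    -- Closeness controls sums of D, not of D²; the bound D ≤ 4 passes from one to the other.
    _ ≤ ∑ x ∈ blockSites (2 * Q) (Finset.Icc (l - l₀) (l + l₀)), 4 * D x :=
        Finset.sum_le_sum fun x _ => by nlinarith [hD x, hD4 x]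
    _ ≤ 4 * (2 * l₀ + 1) * (2 * Q) * ζ := by
        rw [← Finset.mul_sum, sum_blockSites (by omega)]
        have h3 : ∀ l' ∈ Finset.Icc (l - l₀) (l + l₀), ∑ y ∈ siteBlock (2 * Q) l', D y ≤
            ζ * (2 * Q : ℕ) := fun l' hl' => by
          have := (hc l' hl').sum_le hk
          rwa [hkq] at this
        have h4 := Finset.sum_le_card_nsmul _ _ _ h3
        have h5 : (Finset.Icc (l - (l₀ : ℤ)) (l + l₀)).card = 2 * l₀ + 1 := by
          rw [Int.card_Icc]; omega
        rw [h5, nsmul_eq_mul] at h4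
        push_cast at h4
        linarith

end

/-! ### The energy estimate -/

/-- The n + 1 terms of the geometric sum are at least λ^n each, and their sum is at most 1/(1 - λ).
A slightly better rate thus absorbs the number of unit blocks, which is linear in l₀. -/
lemma succ_mul_pow_le {lam : ℝ} (h0 : 0 ≤ lam) (h1 : lam < 1) (n : ℕ) :
    (n + 1) * lam ^ n * (1 - lam) ≤ 1 := by
  have h2 := geom_sum_mul_neg lam (n + 1)
  have h3 : (n + 1) * lam ^ n ≤ ∑ i ∈ Finset.range (n + 1), lam ^ i := by
    have := Finset.card_nsmul_le_sum (Finset.range (n + 1)) (fun i => lam ^ i) (lam ^ n)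
      fun i hi => pow_le_pow_of_le_one h0 h1.le (by rw [Finset.mem_range] at hi; omega)
    rw [Finset.card_range, nsmul_eq_mul] at this
    exact_mod_cast this
  have h4 : 0 ≤ lam ^ (n + 1) := pow_nonneg h0 _
  have h5 := mul_le_mul_of_nonneg_right h3 (by linarith : 0 ≤ 1 - lam)
  linarith

lemma exp_neg_alphaRate {β : ℝ} (hβ : 0 < β) (θ ζ : ℝ) (l₀ : ℕ) :
    Real.exp (-(alphaRate β θ ζ * (2 * (l₀ : ℝ)))) =
      deriv (gMap β θ) (mTilde β θ - ζ / 2) ^ (2 * l₀) := by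
  have h := deriv_gMap_pos hβ θ (mTilde β θ - ζ / 2)
  unfold alphaRate
  rw [show -(-Real.log (deriv (gMap β θ) (mTilde β θ - ζ / 2)) * (2 * (l₀ : ℝ))) =
    ((2 * l₀ : ℕ) : ℝ) * Real.log (deriv (gMap β θ) (mTilde β θ - ζ / 2)) by push_cast; ring,
    Real.exp_nat_mul, Real.exp_log h]

/-- Constants for which deviations from a phase are exponentially damped. -/
structure ContractionConstants (β θ v₀ ζ₀ c η ρ lam r : ℝ) : Prop where
  fix : gMap β θ v₀ = v₀
  c_nonneg : 0 ≤ c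
  eta_pos : 0 < η
  rho_eq : (1 + η) * c ^ 2 = ρ
  rho_pos : 0 < ρ
  rho_lt : ρ < 1
  lam_nonneg : 0 ≤ lam
  lam_lt : lam < 1
  rho_le : ρ ≤ lam * deriv (gMap β θ) (mTilde β θ - ζ₀ / 2)
  contraction : ∀ v, |v - v₀| ≤ r → |gMap β θ v - v₀| ≤ c * |v - v₀|
  zeta_pos : 0 < ζ₀
  zeta_lt : ζ₀ < 1
  zeta_le : 3 * ζ₀ ≤ 2 * r

/-- The profiles which are close to a phase in the unit blocks of `[l₁, l₂]`. -/
def closeR14 (K k q : ℕ) (B : Bool → ℤ → Finset ℤ) (β θ v ζ₁ ζ₄ : ℝ) (l₁ l₂ : ℤ) : Set Config :=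
  {σ | CloseTo k q ζ₁ (profileDist K B β θ v σ) l₁ ∧ CloseTo k q ζ₁ (profileDist K B β θ v σ) l₂ ∧
    ∀ l ∈ Set.Icc (l₁ + 1) (l₂ - 1), CloseTo k q ζ₄ (profileDist K B β θ v σ) l}

lemma closeR14_closeTo {K k q : ℕ} {B : Bool → ℤ → Finset ℤ} {β θ v ζ₁ ζ₄ : ℝ} {l₁ l₂ : ℤ}
    (hζ : ζ₁ ≤ ζ₄) {σ : Config} (hσ : σ ∈ closeR14 K k q B β θ v ζ₁ ζ₄ l₁ l₂) {l : ℤ}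
    (hl : l ∈ Finset.Icc l₁ l₂) : CloseTo k q ζ₄ (profileDist K B β θ v σ) l := by
  rw [Finset.mem_Icc] at hl
  rcases hl.1.eq_or_lt with rfl | h1
  · exact hσ.1.mono hζ fun _ => le_rfl
  rcases hl.2.eq_or_lt with rfl | h2
  · exact hσ.2.1.mono hζ fun _ => le_rfl
  · exact hσ.2.2 l ⟨by omega, by omega⟩

/-- With w = s^(-1/2) the hypothesis says w ≥ 17, as 17⁴ = 83521. Then log(K + 1) ≤ log(2K) = 4 log
w ≤ 4(w - 1), and 16 w - 12 ≤ w² = 1/s. -/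
lemma log_bound {K : ℕ} (hK : 0 < K) {s : ℝ} (hs : 0 < s) (hs2 : s ^ 2 * (2 * K) = 1)
    (hs3 : s ^ 2 ≤ 1 / 83521) : 4 + 4 * Real.log (K + 1) ≤ 1 / s := by
  have hK1 : (1 : ℝ) ≤ K := by exact_mod_cast hK
  set z := 1 / s with hz
  have hz0 : 0 < z := by positivity
  have hz2 : z ^ 2 = 2 * K := by rw [hz]; field_simp; linarith
  have hz3 : 289 ≤ z := by
    have : 83521 ≤ z ^ 2 := by
      rw [hz, div_pow, one_pow, le_div_iff₀ (by positivity)]; linarith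
    nlinarith
  have hw := Real.sq_sqrt hz0.le
  set w := Real.sqrt z
  have hw17 : 17 ≤ w := Real.le_sqrt_of_sq_le (by linarith)
  have h1 : Real.log (K + 1) ≤ Real.log (z ^ 2) :=
    Real.log_le_log (by linarith) (by rw [hz2]; linarith)
  have h2 : Real.log (z ^ 2) = 4 * Real.log w := by
    rw [← hw, ← pow_mul, Real.log_pow]; norm_num
  have h3 := Real.log_le_sub_one_of_pos (by linarith : 0 < w)
  nlinarith

lemma rateExponent_nonneg_imp {β θ κ ζ₀ γ δs δ ζ₄ ζ₅ : ℝ} {l₀ : ℕ} (hβ : 0 < β) (hθ : 0 < θ)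
    (hE : 0 ≤ rateExponent β θ κ ζ₀ γ δs δ ζ₄ ζ₅ l₀) :
    2 * ζ₄ * deriv (gMap β θ) (mTilde β θ - ζ₀ / 2) ^ (2 * l₀) ≤ κ / 2 * δ * ζ₅ ^ 3 := by
  unfold rateExponent at hE
  rw [exp_neg_alphaRate hβ] at hE
  have h1 : 0 ≤ max δs (Real.sqrt (γ / δs)) := (Real.sqrt_nonneg _).trans (le_max_right _ _)
  have h2 : 0 ≤ 12 * (1 + θ) * (4 * (l₀ : ℝ) + 10) * max δs (Real.sqrt (γ / δs)) := by positivity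
  linarith

/-- Here the boundary term of the rate is used. Nonnegativity bounds A^(2 l₀), with A = e^(-α), by a
multiple of κ δ ζ₅³ / ζ₄, and ρ ≤ λ A transfers this to ρ^(2 l₀). The surplus λ^(2 l₀) absorbs the
factor 2 l₀ + 1, and the smallness of κ ζ₀ pays for 1 - λ and for the one missing factor ρ. -/
lemma damping {β θ v₀ ζ₀ c η ρ lam r κ ζ₄ ζ₅ δ : ℝ} {l₀ : ℕ} (hβ : 0 < β)
    (hC : ContractionConstants β θ v₀ ζ₀ c η ρ lam r) (hκ : 0 < κ)
    (hκ1 : κ * ζ₀ * 2 ≤ ρ * (1 - lam)) (hδ : 0 < δ) (hδ1 : δ < 1) (h5 : 0 < ζ₅) (h54 : ζ₅ < ζ₄)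
    (h40 : ζ₄ ≤ ζ₀)
    (hE : 2 * ζ₄ * deriv (gMap β θ) (mTilde β θ - ζ₀ / 2) ^ (2 * l₀) ≤ κ / 2 * δ * ζ₅ ^ 3) :
    0 < l₀ ∧ ρ ^ (2 * l₀ - 1) * (4 * (2 * l₀ + 1) * ζ₄) ≤ δ * ζ₅ ^ 2 / 2 := by
  have hlam : 0 < 1 - lam := by linarith [hC.lam_lt]
  have hρl : ρ * (1 - lam) ≤ 1 := by nlinarith [hC.rho_lt, hC.rho_pos, hC.lam_nonneg]
  have hκ5 : κ * ζ₅ * 2 ≤ ρ * (1 - lam) := by nlinarith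
  have hE' : κ / 2 * δ * ζ₅ ^ 3 = κ * ζ₅ * 2 * (δ * ζ₅ ^ 2 / 4) := by ring
  have h6 : κ / 2 * δ * ζ₅ ^ 3 ≤ ρ * (1 - lam) * (δ * ζ₅ ^ 2 / 4) := by
    rw [hE']; gcongr
  have hl : 0 < l₀ := by
    rcases Nat.eq_zero_or_pos l₀ with rfl | h
    -- Without damping the left side is 2 ζ₄, whereas the right side is at most δ ζ₅²/4 < ζ₄.
    · exfalso
      simp only [mul_zero, pow_zero, mul_one] at hE
      have h7 : ρ * (1 - lam) * (δ * ζ₅ ^ 2 / 4) ≤ 1 * (δ * ζ₅ ^ 2 / 4) := by gcongr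
      have h8 : δ * ζ₅ ^ 2 ≤ 1 * ζ₅ := by
        have : ζ₅ ^ 2 ≤ ζ₅ := by nlinarith [hC.zeta_lt]
        nlinarith
      linarith
    · exact h
  refine ⟨hl, ?_⟩
  set A := deriv (gMap β θ) (mTilde β θ - ζ₀ / 2) with hA
  have hA0 : 0 < A := deriv_gMap_pos hβ _ _
  have h1 : ρ * ρ ^ (2 * l₀ - 1) ≤ lam ^ (2 * l₀) * A ^ (2 * l₀) := by
    rw [← pow_succ', show 2 * l₀ - 1 + 1 = 2 * l₀ by omega, ← mul_pow]
    exact pow_le_pow_left₀ hC.rho_pos.le hC.rho_le _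
  have h2 := succ_mul_pow_le hC.lam_nonneg hC.lam_lt (2 * l₀)
  push_cast at h2
  have h3 : (1 - lam) * (2 * l₀ + 1) * (ρ * ρ ^ (2 * l₀ - 1)) ≤ A ^ (2 * l₀) := by
    calc (1 - lam) * (2 * l₀ + 1) * (ρ * ρ ^ (2 * l₀ - 1))
        ≤ (1 - lam) * (2 * l₀ + 1) * (lam ^ (2 * l₀) * A ^ (2 * l₀)) := by gcongr
      _ = ((2 * l₀ + 1) * lam ^ (2 * l₀) * (1 - lam)) * A ^ (2 * l₀) := by ring
      _ ≤ 1 * A ^ (2 * l₀) := by gcongr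
      _ = A ^ (2 * l₀) := one_mul _
  have h40' : 0 < ζ₄ := h5.trans h54
  have h4 := mul_le_mul_of_nonneg_left h3 (by positivity : 0 ≤ 2 * ζ₄)
  refine le_of_mul_le_mul_left ?_ (mul_pos hC.rho_pos hlam)
  linarith

/-- With s = √(γ/δ*) and L = 2 l₀ - 1, all costs are measured in units of 1/γ: entropy L s, block
interaction 2 L δ*, field imbalance 4 θ L s, and s for the factor γ^(p + 2). Together they are at
most the last term of the rate. -/
lemma exponent_bound {K Q k : ℕ} (hK : 0 < K) (hQ : 0 < Q)
    {β θ γ δs δ ζ₀ κ ζ₄ ζ₅ C n S : ℝ} (hβ : 1 ≤ β) (hθ : 0 < θ) (hγ0 : 0 < γ)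
    (hγQ : γ * (2 * Q) * (2 * K) = 1) (hδs : δs = γ * (2 * K)) (hkδ : (k : ℝ) = 2 * Q * δ)
    (hδ0 : 0 < δ) (hC0 : 0 < C) (hκ : 0 < κ) (hκ2 : κ * ζ₀ * (32 * β ^ 2 * C) ≤ 1)
    (hd : γ / δs ≤ 1 / 83521) {p : ℕ} (hp : ((p : ℝ) + 2) * δs * Real.log (1 / γ) ≤ 1 / 64)
    (h5 : 0 < ζ₅) (h54 : ζ₅ < ζ₄) (h40 : ζ₄ ≤ ζ₀) {l₀ : ℕ} (hl₀ : 0 < l₀)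
    (hcard : n = (2 * l₀ - 1) * (2 * Q))
    (hsum : S ≤ (2 * l₀ - 1) * (2 / γ * Real.sqrt (γ / δs))) :
    2 * n * Real.log (K + 1) + (-(K / (16 * β) * (k * ζ₅ ^ 2 / (2 * C))) +
      n * (4 + 2 * Real.log (K + 1)) + β * (2 * n * (2 * K) * (γ * (2 * K)) + 2 * θ * S)) ≤
      -(((p : ℝ) + 2) * Real.log (1 / γ)) +
        -(β / γ) * rateExponent β θ κ ζ₀ γ δs δ ζ₄ ζ₅ l₀ := by
  have hK0 : (0 : ℝ) < K := by exact_mod_cast hK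
  have hQ0 : (0 : ℝ) < Q := by exact_mod_cast hQ
  have hβ0 : 0 < β := by linarith
  have hδs0 : 0 < δs := by rw [hδs]; positivity
  have hδsQ : δs * (2 * Q) = 1 := by rw [hδs]; linarith
  set s := Real.sqrt (γ / δs) with hs
  have hs0 : 0 < s := Real.sqrt_pos.2 (by positivity)
  have hs2 : s ^ 2 = γ / δs := Real.sq_sqrt (by positivity)
  have hs2K : s ^ 2 * (2 * K) = 1 := by rw [hs2, hδs]; field_simp
  have hlog := log_bound hK hs0 hs2K (by rw [hs2]; exact hd)
  have hs1 : s ≤ 1 := by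
    refine (pow_le_one_iff_of_nonneg hs0.le two_ne_zero).1 ?_
    rw [hs2]
    linarith
  have hmx1 : δs ≤ max δs s := le_max_left _ _
  have hmx2 : s ≤ max δs s := le_max_right _ _
  have hmx0 : 0 < max δs s := hδs0.trans_le hmx1
  set L : ℝ := 2 * l₀ - 1 with hL
  have hl₀1 : (1 : ℝ) ≤ l₀ := by exact_mod_cast hl₀
  have hL1 : 1 ≤ L := by linarith
  have hQγ : 2 * (Q : ℝ) = s ^ 2 / γ := by
    rw [hs2]; field_simp; linarith
  have hn0 : 0 ≤ n := by rw [hcard]; positivity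
  have hQK : 2 * (Q : ℝ) * (2 * K) = 1 / γ := by rw [eq_div_iff hγ0.ne']; linarith
  have e1 : n * (4 + 4 * Real.log (K + 1)) ≤ β / γ * (L * s) := by
    calc n * (4 + 4 * Real.log (K + 1)) ≤ n * (1 / s) := by gcongr
      _ = 1 / γ * (L * s) := by rw [hcard, hQγ]; field_simp
      _ ≤ β / γ * (L * s) := by gcongr
  clear_value s L
  -- The gain is of order ζ₅²; one factor ζ₅ ≤ ζ₀ is given away so that the smallness of κ ζ₀
  -- absorbs the constants.
  have e2 : β / γ * (κ / 2 * δ * ζ₅ ^ 3) ≤ K / (16 * β) * (k * ζ₅ ^ 2 / (2 * C)) := by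
    have h1 : κ * ζ₅ * (32 * β ^ 2 * C) ≤ 1 := by
      refine le_trans ?_ hκ2
      have : ζ₅ ≤ ζ₀ := by linarith only [h54, h40]
      gcongr
    have h2 : K / (16 * β) * (k * ζ₅ ^ 2 / (2 * C)) =
        δ * ζ₅ ^ 2 / (64 * γ * β * C) := by
      rw [hkδ]
      have : (K : ℝ) = 1 / (γ * (2 * Q) * 2) := by field_simp; linarith
      rw [this]
      field_simp
      norm_num
    rw [h2, le_div_iff₀ (by positivity)]
    calc β / γ * (κ / 2 * δ * ζ₅ ^ 3) * (64 * γ * β * C)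
        = δ * ζ₅ ^ 2 * (κ * ζ₅ * (32 * β ^ 2 * C)) := by field_simp; ring
      _ ≤ δ * ζ₅ ^ 2 * 1 := by gcongr
      _ = δ * ζ₅ ^ 2 := mul_one _
  have e3 : 2 * n * (2 * K) * (γ * (2 * K)) = 1 / γ * (L * (2 * δs)) := by
    rw [hcard, ← hδs, ← hQK]
    ring
  have e4 : 2 * θ * S ≤
      1 / γ * (4 * θ * L * s) := by
    have := mul_le_mul_of_nonneg_left hsum (by positivity : 0 ≤ 2 * θ)
    refine this.trans (le_of_eq ?_)
    ring
  have e5 : ((p : ℝ) + 2) * Real.log (1 / γ) ≤ β / γ * s := by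
    have h1 : ((p : ℝ) + 2) * Real.log (1 / γ) ≤ 1 / δs := by
      rw [le_div_iff₀ hδs0]; linarith
    have h2 : 1 / δs = 1 / γ * s ^ 2 := by rw [hs2]; field_simp
    rw [h2] at h1
    refine h1.trans ?_
    have h3 : s ^ 2 ≤ s := by rw [pow_two]; exact mul_le_of_le_one_left hs0.le hs1
    gcongr
  have e6 : rateExponent β θ κ ζ₀ γ δs δ ζ₄ ζ₅ l₀ ≤
      κ / 2 * δ * ζ₅ ^ 3 - 12 * (1 + θ) * (4 * (l₀ : ℝ) + 10) * max δs s := by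
    unfold rateExponent
    have : 0 ≤ 2 * ζ₄ * Real.exp (-(alphaRate β θ ζ₀ * (2 * (l₀ : ℝ)))) := by
      have : 0 < ζ₄ := h5.trans h54
      positivity
    rw [← hs]
    linarith only [this]
  have e7 : L * s + L * (2 * δs) + 4 * θ * L * s + s ≤
      12 * (1 + θ) * (4 * (l₀ : ℝ) + 10) * max δs s := by
    have : L * s + L * (2 * δs) + 4 * θ * L * s + s ≤ (L * 3 + 4 * θ * L + 1) * max δs s := by
      have a1 : L * s ≤ L * max δs s := by gcongr
      have a2 : L * (2 * δs) ≤ L * (2 * max δs s) := by gcongr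
      have a3 : 4 * θ * L * s ≤ 4 * θ * L * max δs s := by gcongr
      linarith
    refine this.trans (mul_le_mul_of_nonneg_right ?_ hmx0.le)
    rw [hL]
    have : 0 ≤ θ * l₀ := by positivity
    linarith only [this, hθ, hl₀1]
  have hβγ : 0 < β / γ := by positivity
  have e8 : β * (2 * n * (2 * K) * (γ * (2 * K)) +
      2 * θ * S) ≤
      β / γ * (L * (2 * δs) + 4 * θ * L * s) := by
    rw [e3]
    have := mul_le_mul_of_nonneg_left e4 hβ0.le
    have h1 : β / γ * (L * (2 * δs) + 4 * θ * L * s) =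
      β * (1 / γ * (L * (2 * δs))) + β * (1 / γ * (4 * θ * L * s)) := by ring
    rw [h1]
    linarith only [this]
  have hlogn : 0 ≤ n * Real.log (K + 1) := mul_nonneg hn0 (Real.log_nonneg (by linarith))
  have e9 := mul_le_mul_of_nonneg_left e7 hβγ.le
  have e10 := mul_le_mul_of_nonneg_left e6 hβγ.le
  linarith only [e1, e2, e5, e8, e9, e10, hlogn]

section
variable {K : ℕ} {B : Bool → ℤ → Finset ℤ}

/-- The comparison is with all of `closeR14`: a move preserves closeness but need not create
ζ₅-closeness. The factor γ^(p + 2) is kept in reserve for the union over the unit blocks. -/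
lemma HalfBlocks.partitionFn_deviation_le (hB : HalfBlocks K B) (hK : 0 < K) {Q k q : ℕ}
    (hQ : 0 < Q) (hk : 0 < k) (hkq : k * q = 2 * Q)
    {β θ γ δs δ v₀ ζ₀ c η ρ lam r κ ζ₁ ζ₄ ζ₅ : ℝ} (hβ : 1 ≤ β) (hθ : 0 < θ)
    (hγ : γ = 1 / (2 * Q * (2 * K : ℕ))) (hδs : δs = γ * (2 * K)) (hδ : δ = k * δs)
    (hδ1 : δ < 1) (hC : ContractionConstants β θ v₀ ζ₀ c η ρ lam r) (hκ : 0 < κ)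
    (hκ1 : κ * ζ₀ * 2 ≤ ρ * (1 - lam))
    (hκ2 : κ * ζ₀ * (32 * β ^ 2 * ((1 + 1 / η) / (1 - ρ))) ≤ 1)
    (hd : γ / δs ≤ 1 / 83521) {p : ℕ} (hp : ((p : ℝ) + 2) * δs * Real.log (1 / γ) ≤ 1 / 64)
    (h5 : 0 < ζ₅) (h51 : ζ₅ < ζ₁) (h14 : ζ₁ < ζ₄) (h40 : ζ₄ ≤ ζ₀) {l₀ : ℕ}
    (hE : 0 ≤ rateExponent β θ κ ζ₀ γ δs δ ζ₄ ζ₅ l₀) (l₁ l₂ : ℤ)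
    (h h' : ℤ → ℝ) (hh' : ∀ b x, ∀ i ∈ B b x, h' i = spin b) (Λ : Finset ℤ)
    (hΛ : ∀ l ∈ Finset.Icc l₁ l₂, ∀ y ∈ siteBlock (2 * Q) l, siteBlock (2 * K) y ⊆ Λ)
    (hh : ∀ l ∈ Finset.Icc l₁ l₂, ∑ x ∈ siteBlock (2 * Q) l, ∑ i ∈ siteBlock (2 * K) x,
      |h i - h' i| ≤ 2 / γ * Real.sqrt (γ / δs))
    (l : ℤ) (hl : l ∈ Finset.Icc (l₁ + l₀) (l₂ - l₀)) :
    partitionFn β θ γ h Λ (closeR14 K k q B β θ v₀ ζ₁ ζ₄ l₁ l₂ ∩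
        {σ | ¬CloseTo k q ζ₅ (profileDist K B β θ v₀ σ) l}) ≤
      γ ^ (p + 2) * Real.exp (-(β / γ) * rateExponent β θ κ ζ₀ γ δs δ ζ₄ ζ₅ l₀) *
        partitionFn β θ γ h Λ (closeR14 K k q B β θ v₀ ζ₁ ζ₄ l₁ l₂) := by
  have hK0 : (0 : ℝ) < K := by exact_mod_cast hK
  have hQ0 : (0 : ℝ) < Q := by exact_mod_cast hQ
  have hk0 : (0 : ℝ) < k := by exact_mod_cast hk
  have hQ' : (0 : ℤ) < Q := by exact_mod_cast hQ
  have hβ0 : 0 < β := by linarith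
  have hγ0 : 0 < γ := by rw [hγ]; positivity
  have hδs0 : 0 < δs := by rw [hδs]; positivity
  have hδ0 : 0 < δ := by rw [hδ]; positivity
  have hγQ : γ * (2 * Q) * (2 * K) = 1 := by rw [hγ]; push_cast; field_simp
  have hδsQ : δs * (2 * Q) = 1 := by rw [hδs]; linarith
  have hkδ : (k : ℝ) = 2 * Q * δ := by
    rw [hδ]; linear_combination (-(k : ℝ)) * hδsQ
  have hE1 := rateExponent_nonneg_imp hβ0 hθ hE
  obtain ⟨hl₀, hdamp⟩ := damping hβ0 hC hκ hκ1 hδ0 hδ1 h5 (h51.trans h14) h40 hE1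
  rw [Finset.mem_Icc] at hl
  set X := blockSites (2 * Q) (Finset.Ioo (l - l₀) (l + l₀)) with hX
  set C := (1 + 1 / η) / (1 - ρ) with hCdef
  have hC0 : 0 < C := by
    have := hC.eta_pos; have := hC.rho_lt
    have : 0 < 1 - ρ := by linarith
    positivity
  have hXl : ∀ x ∈ X, blockIndex (2 * Q) x ∈ Finset.Ioo (l - l₀) (l + l₀) := fun x hx => by
    rwa [hX, mem_blockSites (by omega)] at hx
  have hmain := hB.partitionFn_le hK hQ (r := r) (q := c) hβ hθ.le hγ hC.fix hC.c_nonneg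
    hC.contraction h h' hh' Λ X (fun x hx y hy => by
      have h1 := hXl x hx
      have hx' := (mem_siteBlock (N := 2 * Q) (by omega) (i := x)).2 rfl
      have hy' := (mem_siteBlock (N := 2 * Q) (by omega) (i := y)).2 rfl
      refine hΛ (blockIndex (2 * Q) y) ?_ y hy'
      simp only [siteBlock, Finset.mem_Ioc, Finset.mem_Ioo, Finset.mem_Icc] at *
      push_cast at hx' hy'
      set i := blockIndex (2 * Q) x
      set j := blockIndex (2 * Q) y
      have h2 : i - 1 ≤ j := by
        by_contra hcon
        have : j ≤ i - 2 := by omega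
        nlinarith
      have h3 : j ≤ i + 1 := by
        by_contra hcon
        have : i + 2 ≤ j := by omega
        nlinarith
      omega)
    (closeR14 K k q B β θ v₀ ζ₁ ζ₄ l₁ l₂ ∩
        {σ | ¬CloseTo k q ζ₅ (profileDist K B β θ v₀ σ) l})
    (closeR14 K k q B β θ v₀ ζ₁ ζ₄ l₁ l₂) (k * ζ₅ ^ 2 / (2 * C))
    (fun σ hσ x hx => by
      have h1 := hXl x hx
      refine (localField_le_of_closeTo hk hkq hQ (fun _ => phaseDist_nonneg _ _ _ _)
        ((mem_siteBlock (by omega)).2 rfl) fun l' hl' => closeR14_closeTo h14.le hσ.1 ?_).trans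
        (by linarith [hC.zeta_le] : 3 * ζ₄ ≤ 2 * r)
      rw [Finset.mem_Icc] at *
      rw [Finset.mem_Ioo] at h1
      omega)
    (fun σ hσ e he => by
      have h1 := le_sum_sq_of_not_closeTo hk hkq hQ (fun _ => phaseDist_nonneg _ _ _ _)
        (fun x => phaseDist_mag_le hK β θ v₀ _ fun b => (plusCount_le _ _).trans (hB.card _ _).le)
        hC.eta_pos hC.rho_eq hC.rho_lt h5.le hl₀
        (fun l' hl' => closeR14_closeTo h14.le hσ.1 (by rw [Finset.mem_Icc] at *; omega))
        hσ.2 e he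
      -- The boundary contribution is at most half of the deviation, so the other half must come
      -- from `e`; hence the bound k ζ₅²/(2C).
      have h2 : ρ ^ (2 * l₀ - 1) * (4 * (2 * l₀ + 1) * (2 * Q) * ζ₄) ≤ k * ζ₅ ^ 2 / 2 := by
        have := mul_le_mul_of_nonneg_left hdamp (by positivity : 0 ≤ 2 * (Q : ℝ))
        rw [hkδ]
        exact (le_of_eq (by ring)).trans (this.trans (le_of_eq (by ring)))
      rw [div_le_iff₀ (by positivity)]
      rw [← hCdef, ← hX] at h1
      linarith only [h1, h2])
    (fun σ hσ σ' hσ' => ⟨hσ.1.1.mono le_rfl hσ', hσ.1.2.1.mono le_rfl hσ',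
      fun l' hl' => (hσ.1.2.2 l' hl').mono le_rfl hσ'⟩)
  have hG0 : 0 ≤ partitionFn β θ γ h Λ (closeR14 K k q B β θ v₀ ζ₁ ζ₄ l₁ l₂) := by
    unfold partitionFn
    exact Finset.sum_nonneg fun s _ => by split_ifs <;> first | exact (Real.exp_pos _).le | rfl
  refine hmain.trans (mul_le_mul_of_nonneg_right ?_ hG0)
  have hpow : ((K : ℝ) + 1) ^ (2 * X.card) = Real.exp ((2 * X.card : ℕ) * Real.log (K + 1)) := by
    rw [Real.exp_nat_mul, Real.exp_log (by positivity)]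
  have hγp : Real.exp (-(((p : ℝ) + 2) * Real.log (1 / γ))) = γ ^ (p + 2) := by
    rw [one_div, Real.log_inv, show -(((p : ℝ) + 2) * -Real.log γ) =
      ((p + 2 : ℕ) : ℝ) * Real.log γ by push_cast; ring, Real.exp_nat_mul, Real.exp_log hγ0]
  rw [hpow, ← hγp, ← Real.exp_add, ← Real.exp_add, Real.exp_le_exp]
  have hIoo : ((Finset.Ioo (l - (l₀ : ℤ)) (l + l₀)).card : ℝ) = 2 * l₀ - 1 := by
    rw [Int.card_Ioo, show (l + l₀ - (l - l₀) - 1 : ℤ).toNat = 2 * l₀ - 1 by omega,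
      Nat.cast_sub (by omega)]
    push_cast; ring
  have hcard : (X.card : ℝ) = (2 * l₀ - 1) * (2 * Q) := by
    rw [hX, card_blockSites (by omega)]; push_cast; rw [hIoo]
  have hsum : ∑ x ∈ X, ∑ i ∈ siteBlock (2 * K) x, |h i - h' i| ≤
      (2 * l₀ - 1) * (2 / γ * Real.sqrt (γ / δs)) := by
    rw [hX, sum_blockSites (by omega), ← hIoo, ← nsmul_eq_mul]
    refine Finset.sum_le_card_nsmul _ _ _ fun l' hl' => hh l' ?_
    rw [Finset.mem_Icc]; rw [Finset.mem_Ioo] at hl'; omega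
  push_cast
  exact exponent_bound hK hQ hβ hθ hγ0 hγQ hδs hkδ hδ0 hC0 hκ hκ2 hd hp h5 (h51.trans h14) h40
    hl₀ hcard hsum

end

/-! ### Restricted partition functions -/

section
variable (β θ γ : ℝ) (h : ℤ → ℝ) (Λ : Finset ℤ)

lemma partitionFn_nonneg (F : Set Config) : 0 ≤ partitionFn β θ γ h Λ F := by
  unfold partitionFn
  exact Finset.sum_nonneg fun s _ => by split_ifs <;> first | exact (Real.exp_pos _).le | rfl

lemma partitionFn_mono {F G : Set Config} (hFG : F ⊆ G) :
    partitionFn β θ γ h Λ F ≤ partitionFn β θ γ h Λ G := by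
  unfold partitionFn
  refine Finset.sum_le_sum fun s _ => ?_
  by_cases hF : extend Λ s ∈ F
  · rw [if_pos hF, if_pos (hFG hF)]
  · rw [if_neg hF]
    split_ifs <;> first | exact (Real.exp_pos _).le | rfl

lemma partitionFn_inter_add (F G : Set Config) :
    partitionFn β θ γ h Λ (F ∩ G) + partitionFn β θ γ h Λ (F ∩ Gᶜ) = partitionFn β θ γ h Λ F := by
  unfold partitionFn
  rw [← Finset.sum_add_distrib]
  refine Finset.sum_congr rfl fun s _ => ?_
  by_cases hF : extend Λ s ∈ F <;> by_cases hG : extend Λ s ∈ G <;> simp [hF, hG]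

open Classical in
lemma partitionFn_le_sum {ι : Type*} (S : Finset ι) {F : Set Config} (G : ι → Set Config)
    (hFG : ∀ σ ∈ F, ∃ i ∈ S, σ ∈ G i) :
    partitionFn β θ γ h Λ F ≤ ∑ i ∈ S, partitionFn β θ γ h Λ (G i) := by
  unfold partitionFn
  rw [Finset.sum_comm]
  have hnn : ∀ s : Λ → Bool, ∀ i, 0 ≤ (if extend Λ s ∈ G i then
      Real.exp (-β * hamiltonian θ γ h Λ (extend Λ s)) else 0) := fun s i => by
    split_ifs <;> first | exact (Real.exp_pos _).le | rfl
  refine Finset.sum_le_sum fun s _ => ?_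
  by_cases hF : extend Λ s ∈ F
  · rw [if_pos hF]
    obtain ⟨i, hi, hG⟩ := hFG _ hF
    refine le_trans ?_ (Finset.single_le_sum (fun i _ => hnn s i) hi)
    rw [if_pos hG]
  · rw [if_neg hF]
    exact Finset.sum_nonneg fun i _ => hnn s i

lemma partitionFn_pos {F : Set Config} (s : Λ → Bool) (hs : extend Λ s ∈ F) :
    0 < partitionFn β θ γ h Λ F := by
  unfold partitionFn
  refine Finset.sum_pos' (fun s _ => by split_ifs <;> first | exact (Real.exp_pos _).le | rfl)
    ⟨s, Finset.mem_univ _, ?_⟩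
  rw [if_pos hs]
  exact Real.exp_pos _

end

/-! ### The probability of a deviation -/

/-- The profiles which are `ζ₅`-close to a phase in the unit blocks of `[l₁, l₂]`. -/
def closeR5 (K k q : ℕ) (B : Bool → ℤ → Finset ℤ) (β θ v ζ₅ : ℝ) (l₁ l₂ : ℤ) : Set Config :=
  {σ | ∀ l ∈ Set.Icc l₁ l₂, CloseTo k q ζ₅ (profileDist K B β θ v σ) l}

lemma exists_mag_near {K : ℕ} (hK : 0 < K) {a : ℝ} (ha : a ∈ Set.Ioo (-1 : ℝ) 1) :
    ∃ n ≤ K, |mag K n - a| ≤ 2 / K := by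
  have hK0 : (0 : ℝ) < K := by exact_mod_cast hK
  have h0 : 0 ≤ K * (1 + a) / 2 := by
    have : 0 < 1 + a := by linarith [ha.1]
    positivity
  have h1 := Nat.floor_le h0
  have h2 := Nat.lt_floor_add_one (K * (1 + a) / 2)
  refine ⟨⌊K * (1 + a) / 2⌋₊, ?_, ?_⟩
  · refine Nat.floor_le_of_le ?_
    nlinarith [ha.2]
  · set n := ⌊K * (1 + a) / 2⌋₊
    have h3 : mag K n - a = (2 * n - K * (1 + a)) / K := by
      unfold mag; field_simp; ring
    rw [h3, abs_div, abs_of_pos hK0]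
    gcongr
    rw [abs_le]
    constructor <;> linarith

section
variable {K : ℕ} {B : Bool → ℤ → Finset ℤ}

lemma HalfBlocks.exists_config (hB : HalfBlocks K B) (hK : 0 < K) (n : Bool → ℕ)
    (hn : ∀ b, n b ≤ K) : ∃ σ : Config, ∀ b x, plusCount σ (B b x) = n b := by
  classical
  have hS : ∀ b x, ∃ S ⊆ B b x, S.card = n b := fun b x =>
    Finset.exists_subset_card_eq ((hn b).trans (hB.card b x).ge)
  choose S hSB hSc using hS
  refine ⟨fun i => decide (∃ b x, i ∈ S b x), fun b x => ?_⟩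
  rw [← hSc b x]
  unfold plusCount
  congr 1
  ext i
  simp only [Finset.mem_filter, decide_eq_true_eq]
  constructor
  · rintro ⟨hi, b', x', hi'⟩
    by_contra hne
    have hbx : (b, x) ≠ (b', x') := by
      rintro hbx
      rw [Prod.mk.injEq] at hbx
      obtain ⟨rfl, rfl⟩ := hbx
      exact hne hi'
    exact Finset.disjoint_left.1 (hB.disjoint hK hbx) hi (hSB _ _ hi')
  · exact fun hi => ⟨hSB _ _ hi, b, x, hi⟩

/-- Each half-block average can be put within 2/K of its phase component, in all blocks at once. The
resulting distance 4/K equals 8γ/δ*, the lower bound imposed on ζ₅. -/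
lemma HalfBlocks.partitionFn_close_pos (hB : HalfBlocks K B) (hK : 0 < K) {k q Q : ℕ} (hk : 0 < k)
    (hkq : k * q = 2 * Q) {β θ v ζ₁ ζ₄ ζ₅ : ℝ} (hζ : 4 / K ≤ ζ₅) (h51 : ζ₅ ≤ ζ₁)
    (h14 : ζ₁ ≤ ζ₄) (γ : ℝ) (h : ℤ → ℝ) {l₁ l₂ : ℤ} (hl : l₁ ≤ l₂) (l₀ : ℕ) (Λ : Finset ℤ)
    (hΛ : ∀ l ∈ Finset.Icc l₁ l₂, ∀ y ∈ siteBlock (2 * Q) l, siteBlock (2 * K) y ⊆ Λ) :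
    0 < partitionFn β θ γ h Λ (closeR14 K k q B β θ v ζ₁ ζ₄ l₁ l₂ ∩
      closeR5 K k q B β θ v ζ₅ (l₁ + l₀) (l₂ - l₀)) := by
  have hn : ∀ b, ∃ n ≤ K, |mag K n - phaseComp β θ v b| ≤ 2 / K := fun b =>
    exists_mag_near hK (tanh_mem_Ioo _)
  choose n hn hmag using hn
  obtain ⟨σ, hσ⟩ := hB.exists_config hK n hn
  have hclose : ∀ l ∈ Finset.Icc l₁ l₂,
      CloseTo k q ζ₅ (profileDist K B β θ v (extend Λ fun i => σ i)) l := by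
    intro l hl u hu
    nth_rw 2 [← card_siteBlock k u]
    rw [← nsmul_eq_mul']
    refine Finset.sum_le_card_nsmul (siteBlock k u) _ ζ₅ fun x hx => ?_
    have hxl : x ∈ siteBlock (2 * Q) l := by
      rw [← hkq, siteBlock_mul hk, blockSites, Finset.mem_biUnion]
      exact ⟨u, hu, hx⟩
    have hcount : ∀ b, plusCount (extend Λ fun i => σ i) (B b x) = n b := fun b => by
      rw [← hσ b x]
      refine plusCount_congr fun i hi => ?_
      have := hΛ l hl x hxl (hB.subset b x hi)
      simp [extend, this]
    unfold profileDist phaseDist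
    rw [Fintype.sum_bool]
    simp only [hcount]
    have h1 := hmag true
    have h2 := hmag false
    have : (2 : ℝ) / K + 2 / K = 4 / K := by ring
    linarith
  refine partitionFn_pos β θ γ h Λ (fun i => σ i) ⟨⟨?_, ?_, ?_⟩, ?_⟩
  · exact (hclose _ (Finset.mem_Icc.2 ⟨le_rfl, hl⟩)).mono h51 fun _ => le_rfl
  · exact (hclose _ (Finset.mem_Icc.2 ⟨hl, le_rfl⟩)).mono h51 fun _ => le_rfl
  · rintro l ⟨h1, h2⟩
    exact (hclose _ (Finset.mem_Icc.2 ⟨by omega, by omega⟩)).mono (h51.trans h14) fun _ => le_rfl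
  · rintro l ⟨h1, h2⟩
    exact hclose _ (Finset.mem_Icc.2 ⟨by omega, by omega⟩)

/-- The interval contains at most 3 γ^(-p) unit blocks, so γ^(p + 2) leaves 3 γ². -/
lemma HalfBlocks.partitionFn_union_le (hB : HalfBlocks K B) (hK : 0 < K) {Q k q : ℕ}
    (hQ : 0 < Q) (hk : 0 < k) (hkq : k * q = 2 * Q)
    {β θ γ δs δ v₀ ζ₀ c η ρ lam r κ ζ₁ ζ₄ ζ₅ : ℝ} (hβ : 1 ≤ β) (hθ : 0 < θ)
    (hγ : γ = 1 / (2 * Q * (2 * K : ℕ))) (hδs : δs = γ * (2 * K)) (hδ : δ = k * δs)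
    (hδ1 : δ < 1) (hC : ContractionConstants β θ v₀ ζ₀ c η ρ lam r) (hκ : 0 < κ)
    (hκ1 : κ * ζ₀ * 2 ≤ ρ * (1 - lam))
    (hκ2 : κ * ζ₀ * (32 * β ^ 2 * ((1 + 1 / η) / (1 - ρ))) ≤ 1)
    (hd : γ / δs ≤ 1 / 83521) {p : ℕ} (hp : ((p : ℝ) + 2) * δs * Real.log (1 / γ) ≤ 1 / 64)
    (h5 : 0 < ζ₅) (h51 : ζ₅ < ζ₁) (h14 : ζ₁ < ζ₄) (h40 : ζ₄ ≤ ζ₀) {l₀ : ℕ}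
    (hE : 0 ≤ rateExponent β θ κ ζ₀ γ δs δ ζ₄ ζ₅ l₀) (l₁ l₂ : ℤ)
    (hl₁ : -(1 / γ ^ p) ≤ (l₁ : ℝ)) (hl₂ : (l₂ : ℝ) ≤ 1 / γ ^ p)
    (h h' : ℤ → ℝ) (hh' : ∀ b x, ∀ i ∈ B b x, h' i = spin b) (Λ : Finset ℤ)
    (hΛ : ∀ l ∈ Finset.Icc l₁ l₂, ∀ y ∈ siteBlock (2 * Q) l, siteBlock (2 * K) y ⊆ Λ)
    (hh : ∀ l ∈ Finset.Icc l₁ l₂, ∑ x ∈ siteBlock (2 * Q) l, ∑ i ∈ siteBlock (2 * K) x,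
      |h i - h' i| ≤ 2 / γ * Real.sqrt (γ / δs)) :
    partitionFn β θ γ h Λ (closeR14 K k q B β θ v₀ ζ₁ ζ₄ l₁ l₂ ∩
        (closeR5 K k q B β θ v₀ ζ₅ (l₁ + l₀) (l₂ - l₀))ᶜ) ≤
      3 * γ ^ 2 * Real.exp (-(β / γ) * rateExponent β θ κ ζ₀ γ δs δ ζ₄ ζ₅ l₀) *
        partitionFn β θ γ h Λ (closeR14 K k q B β θ v₀ ζ₁ ζ₄ l₁ l₂) := by
  have hγ0 : 0 < γ := by
    have hK0 : (0 : ℝ) < K := by exact_mod_cast hK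
    have hQ0 : (0 : ℝ) < Q := by exact_mod_cast hQ
    rw [hγ]; push_cast; positivity
  have hγ1 : γ ≤ 1 := by
    rw [hγ]
    refine div_le_one_of_le₀ ?_ (by positivity)
    have : 1 ≤ 2 * Q * (2 * K) := by nlinarith
    exact_mod_cast this
  set Z := partitionFn β θ γ h Λ (closeR14 K k q B β θ v₀ ζ₁ ζ₄ l₁ l₂)
  set e := Real.exp (-(β / γ) * rateExponent β θ κ ζ₀ γ δs δ ζ₄ ζ₅ l₀)
  have hZ : 0 ≤ Z := partitionFn_nonneg _ _ _ _ _ _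
  have he : 0 < e := Real.exp_pos _
  refine (partitionFn_le_sum β θ γ h Λ (Finset.Icc (l₁ + l₀) (l₂ - l₀))
    (fun l => closeR14 K k q B β θ v₀ ζ₁ ζ₄ l₁ l₂ ∩
      {σ | ¬CloseTo k q ζ₅ (profileDist K B β θ v₀ σ) l}) ?_).trans ?_
  · rintro σ ⟨hσ, hσ5⟩
    simp only [closeR5, Set.mem_compl_iff, Set.mem_ofPred_eq, not_forall] at hσ5
    obtain ⟨l, hl, hnot⟩ := hσ5
    exact ⟨l, Finset.mem_Icc.2 hl, hσ, hnot⟩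
  refine (Finset.sum_le_card_nsmul _ _ _ fun l hl => hB.partitionFn_deviation_le hK hQ hk hkq hβ hθ
    hγ hδs hδ hδ1 hC hκ hκ1 hκ2 hd hp h5 h51 h14 h40 hE l₁ l₂ h h' hh' Λ hΛ hh l hl).trans ?_
  rw [nsmul_eq_mul, ← mul_assoc, ← mul_assoc]
  refine mul_le_mul_of_nonneg_right (mul_le_mul_of_nonneg_right ?_ he.le) hZ
  have hpow : 0 < γ ^ p := by positivity
  have hpow1 : 1 ≤ 1 / γ ^ p := by
    rw [le_div_iff₀ hpow, one_mul]
    exact pow_le_one₀ hγ0.le hγ1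
  have hcard : ((Finset.Icc (l₁ + l₀) (l₂ - l₀)).card : ℝ) ≤ 3 * (1 / γ ^ p) := by
    rw [Int.card_Icc]
    rcases le_total 0 (l₂ - l₀ + 1 - (l₁ + l₀)) with h0 | h0
    · have h1 : (((l₂ - l₀ + 1 - (l₁ + l₀)).toNat : ℤ) : ℝ) =
          ((l₂ - l₀ + 1 - (l₁ + l₀) : ℤ) : ℝ) := by
        rw [Int.toNat_of_nonneg h0]
      rw [Int.cast_natCast] at h1
      rw [h1]
      push_cast
      have : (0 : ℝ) ≤ l₀ := Nat.cast_nonneg _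
      linarith
    · rw [Int.toNat_of_nonpos h0]
      push_cast
      positivity
  calc _ ≤ 3 * (1 / γ ^ p) * γ ^ (p + 2) := by gcongr
    _ = 3 * γ ^ 2 := by rw [pow_add]; field_simp

end

/-! ### The choice of the constants -/

/-- The growth inequality is evaluated at (1, 1), which has positive distance from both phases
because their components lie in the open interval (-1, 1). -/
lemma IsGrowthConstant.exists_bound (β θ : ℝ) :
    ∃ κ₀ : ℝ, 0 < κ₀ ∧ ∀ κ, IsGrowthConstant β θ κ → κ ≤ κ₀ := by
  have h1 := tanh_mem_Ioo (β * (mTilde β θ + θ))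
  have h2 := tanh_mem_Ioo (β * (mTilde β θ - θ))
  have hp : 0 < distPlus β θ 1 1 := by
    have := abs_pos.2 (show (1 : ℝ) - mPhase1 β θ ≠ 0 by unfold mPhase1; linarith [h1.2])
    unfold distPlus
    positivity
  have hm : 0 < distMinus β θ 1 1 := by
    have := abs_pos.2 (show (1 : ℝ) + mPhase2 β θ ≠ 0 by unfold mPhase2; linarith [h2.1])
    unfold distMinus
    positivity
  have hmin : 0 < min (distPlus β θ 1 1 ^ 2) (distMinus β θ 1 1 ^ 2) := by positivity
  refine ⟨max 1 ((freeEnergy β θ 1 1 - freeEnergy β θ (mPhase1 β θ) (mPhase2 β θ)) /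
    min (distPlus β θ 1 1 ^ 2) (distMinus β θ 1 1 ^ 2)), by positivity, fun κ hκ => ?_⟩
  refine le_trans ?_ (le_max_right _ _)
  rw [le_div_iff₀ hmin]
  exact hκ.2 1 (by simp) 1 (by simp)

lemma exists_contraction {β θ c : ℝ} (hd : 0 ≤ deriv (gMap β θ) (mTilde β θ))
    (hc : deriv (gMap β θ) (mTilde β θ) < c) :
    ∃ r > 0, ∀ v, |v - mTilde β θ| ≤ r →
      |gMap β θ v - mTilde β θ| ≤ c * |v - mTilde β θ| := by
  set m := mTilde β θ with hm
  have h1 : HasDerivAt (gMap β θ) (deriv (gMap β θ) m) m :=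
    (hasDerivAt_gMap β θ m).differentiableAt.hasDerivAt
  have h2 := h1.isLittleO.def (sub_pos.2 hc)
  rw [Metric.eventually_nhds_iff] at h2
  obtain ⟨ε, hε, h3⟩ := h2
  refine ⟨ε / 2, by positivity, fun v hv => ?_⟩
  have h4 := h3 (show dist v m < ε by rw [Real.dist_eq]; linarith)
  rw [hm, gMap_mTilde, ← hm, smul_eq_mul, Real.norm_eq_abs, Real.norm_eq_abs] at h4
  have h5 := abs_add_le (gMap β θ v - m - (v - m) * deriv (gMap β θ) m)
    ((v - m) * deriv (gMap β θ) m)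
  rw [sub_add_cancel, abs_mul, abs_of_nonneg hd] at h5
  linarith

lemma exists_constants {β θ : ℝ} (h : TwoPhaseRegion β θ) :
    ∃ ζ₀ c η ρ lam r : ℝ, 0 < alphaRate β θ ζ₀ ∧ ζ₀ < mTilde β θ ∧
      ContractionConstants β θ (mTilde β θ) ζ₀ c η ρ lam r ∧
      ContractionConstants β θ (-mTilde β θ) ζ₀ c η ρ lam r ∧
      ∀ κ, IsGrowthConstant β θ κ → κ * ζ₀ * 2 ≤ ρ * (1 - lam) ∧
        κ * ζ₀ * (32 * β ^ 2 * ((1 + 1 / η) / (1 - ρ))) ≤ 1 := by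
  have hβ : 0 < β := by linarith [h.one_lt]
  have hm := mTilde_pos h
  set q₀ := deriv (gMap β θ) (mTilde β θ) with hq
  have hq0 : 0 < q₀ := deriv_gMap_pos hβ _ _
  have hq1 : q₀ < 1 := deriv_gMap_mTilde_lt_one h
  -- ρ lies strictly between q₀² and q₀. The room below it is shared by the contraction factor c >
  -- q₀ and the Young parameter η; the room above it gives ρ < λ q₀ with λ < 1.
  set ρ := q₀ * (1 + q₀) / 2 with hρ
  have hρ0 : 0 < ρ := by positivity
  have hρ1 : ρ < 1 := by rw [hρ]; nlinarith
  have hqρ : q₀ ^ 2 < ρ := by rw [hρ]; nlinarith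
  set c := Real.sqrt ((q₀ ^ 2 + ρ) / 2) with hc
  have hc2 : c ^ 2 = (q₀ ^ 2 + ρ) / 2 := Real.sq_sqrt (by positivity)
  have hqc : q₀ < c := Real.lt_sqrt_of_sq_lt (by linarith)
  have hc0 : 0 < c := hq0.trans hqc
  set η := ρ / c ^ 2 - 1 with hη
  have hη0 : 0 < η := by
    rw [hη, sub_pos, lt_div_iff₀ (by positivity)]; linarith
  have hηρ : (1 + η) * c ^ 2 = ρ := by rw [hη]; field_simp; ring
  set lam := (3 + q₀) / 4 with hlam
  have hlam0 : 0 < lam := by positivity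
  have hlam1 : lam < 1 := by linarith
  have hρlam : ρ < lam * q₀ := by rw [hρ, hlam]; nlinarith
  obtain ⟨r, hr, hcon⟩ := exists_contraction hq0.le hqc
  obtain ⟨κ₀, hκ₀, hκ⟩ := IsGrowthConstant.exists_bound β θ
  set C := 32 * β ^ 2 * ((1 + 1 / η) / (1 - ρ)) with hC
  have hC0 : 0 < C := by
    have : 0 < 1 - ρ := by linarith
    positivity
  have hder : Tendsto (fun ζ : ℝ => deriv (gMap β θ) (mTilde β θ - ζ / 2)) (𝓝[>] 0) (𝓝 q₀) := by
    have h1 : Continuous fun ζ : ℝ => deriv (gMap β θ) (mTilde β θ - ζ / 2) :=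
      (continuous_deriv_gMap β θ).comp (by fun_prop)
    have h2 := h1.tendsto 0
    simp only [zero_div, sub_zero] at h2
    exact h2.mono_left nhdsWithin_le_nhds
  have hlin : ∀ a b : ℝ, 0 < b → ∀ᶠ ζ : ℝ in 𝓝[>] 0, a * ζ < b := fun a b hb => by
    have h1 : Tendsto (fun ζ : ℝ => a * ζ) (𝓝[>] 0) (𝓝 (a * 0)) :=
      ((continuous_const.mul continuous_id).tendsto 0).mono_left nhdsWithin_le_nhds
    rw [mul_zero] at h1
    exact h1.eventually_lt_const hb
  -- ζ₀ is chosen last, so small that the slope at m̃ - ζ₀/2 is still close to q₀ and that the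
  -- bounds on κ ζ₀ hold for every admissible κ.
  have hall := (((((((hlin 1 1 one_pos).and (hlin 3 (2 * r) (by positivity))).and
    (hlin 1 (mTilde β θ) hm)).and ((hder.const_mul lam).eventually_const_lt hρlam)).and
    (hder.eventually_lt_const hq1)).and (hlin (κ₀ * 2) (ρ * (1 - lam))
    (mul_pos hρ0 (by linarith)))).and (hlin (κ₀ * C) 1 one_pos)).and self_mem_nhdsWithin
  obtain ⟨ζ, ⟨⟨⟨⟨⟨⟨⟨h1, h2⟩, h3⟩, h4⟩, h5⟩, h6⟩, h7⟩, h8⟩⟩ := hall.exists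
  have hζ : 0 < ζ := h8
  refine ⟨ζ, c, η, ρ, lam, r, ?_, by linarith, ?_, ?_, fun κ hk => ⟨?_, ?_⟩⟩
  · unfold alphaRate
    rw [neg_pos]
    exact Real.log_neg (deriv_gMap_pos hβ _ _) h5
  · exact ⟨gMap_mTilde β θ, hc0.le, hη0, hηρ, hρ0, hρ1, hlam0.le, hlam1, h4.le, hcon, hζ,
      by linarith, h2.le⟩
  -- The minus phase follows from the oddness of g; the same rate constants serve both phases.
  · refine ⟨by rw [gMap_neg, gMap_mTilde], hc0.le, hη0, hηρ, hρ0, hρ1, hlam0.le, hlam1, h4.le,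
      fun v hv => ?_, hζ, by linarith, h2.le⟩
    have h9 := hcon (-v) (by rw [← abs_neg]; convert hv using 2; ring)
    rw [gMap_neg, ← abs_neg, ← abs_neg (-v - _)] at h9
    convert h9 using 2
    · ring
    · congr 1; ring
  · have : κ * ζ ≤ κ₀ * ζ := mul_le_mul_of_nonneg_right (hκ κ hk) hζ.le
    linarith
  · have : κ * ζ * C ≤ κ₀ * ζ * C := by
      have := hκ κ hk
      gcongr
    linarith

/-! ### The geometry of the blocks -/

/-- From 1/δ = q and δ = k δ* one gets k q · 2M = 2^n, so k divides a power of two; being at least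
2, it is even. Hence half a unit is a whole number Q of blocks, which makes the block kernel exact
away from distance Q. -/
lemma exists_scales {γ δs δ : ℝ} {n M k q : ℕ} (hγ : γ = ((2 : ℝ) ^ n)⁻¹) (hδs : 0 < δs)
    (hM : δs / γ = 2 * (M : ℝ)) (hk : 2 ≤ k) (hδ : δ = k * δs) (hq : 1 / δ = q) :
    ∃ Q : ℕ, 0 < Q ∧ k * q = 2 * Q ∧ γ = 1 / (2 * Q * (2 * M : ℕ)) := by
  have hγ0 : 0 < γ := by rw [hγ]; positivity
  have hk0 : (0 : ℝ) < k := by exact_mod_cast (by omega : 0 < k)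
  have hδ0 : 0 < δ := by rw [hδ]; positivity
  have hq0 : (0 : ℝ) < q := by rw [← hq]; positivity
  have h1 : (q : ℝ) * δ = 1 := by rw [← hq]; field_simp
  have h2 : δs = 2 * M * γ := by rw [← hM]; field_simp
  have hγ2 : γ * 2 ^ n = 1 := by rw [hγ]; field_simp
  have h3 : (k : ℝ) * q * (2 * M) = 2 ^ n := by
    have h4 : (k : ℝ) * q * (2 * M) * γ = 1 := by rw [← h1, hδ, h2]; ring
    have : (k : ℝ) * q * (2 * M) * (γ * 2 ^ n) = 2 ^ n := by rw [← mul_assoc, h4, one_mul]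
    rwa [hγ2, mul_one] at this
  have h3' : k * q * (2 * M) = 2 ^ n := by exact_mod_cast h3
  have hkn : k ∣ 2 ^ n := ⟨q * (2 * M), by rw [← h3']; ring⟩
  obtain ⟨j, _, rfl⟩ := (Nat.dvd_prime_pow Nat.prime_two).1 hkn
  have hj : j ≠ 0 := by rintro rfl; simp at hk
  obtain ⟨i, rfl⟩ := Nat.exists_eq_succ_of_ne_zero hj
  refine ⟨2 ^ i * q, ?_, by rw [pow_succ]; ring, ?_⟩
  · have : 0 < q := by exact_mod_cast hq0
    positivity
  · rw [hγ, ← h3]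
    push_cast
    rw [pow_succ, one_div]
    congr 1
    ring

lemma sites_eq {γ a b : ℝ} (m n : ℤ) (ha : a / γ = m) (hb : b / γ = n) :
    sites γ a b = Finset.Ioc m n := by
  rw [sites, ha, hb, Int.floor_intCast, Int.floor_intCast]

lemma cells_eq {δ a b : ℝ} (m n : ℤ) (ha : a / δ = m) (hb : b / δ = n) :
    cells δ a b = Finset.Ioc m n := by
  rw [cells, ha, hb, Int.ceil_intCast, Int.floor_intCast]
  ext x
  simp only [Finset.mem_Icc, Finset.mem_Ioc]
  omega

lemma block_eq {γ δs : ℝ} {K : ℕ} (hγ : 0 < γ) (hδs : δs = γ * (2 * K)) (x : ℤ) :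
    block γ δs x = siteBlock (2 * K) x := by
  refine sites_eq _ _ ?_ ?_ <;> rw [hδs] <;> push_cast <;> field_simp

lemma cells_unit_eq {δ : ℝ} {q : ℕ} (hq : 1 / δ = q) (l : ℤ) :
    cells δ ((l : ℝ) - 1) l = siteBlock q l := by
  refine cells_eq _ _ ?_ ?_ <;> push_cast <;> rw [← hq] <;> ring

lemma cells_block_eq {δ δs : ℝ} {k : ℕ} (hδs : 0 < δs) (hδ : δ = k * δs) (u : ℤ) :
    cells δs (((u : ℝ) - 1) * δ) (u * δ) = siteBlock k u := by
  refine cells_eq _ _ ?_ ?_ <;> rw [hδ] <;> push_cast <;> field_simp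

lemma sites_unit_eq {γ : ℝ} {N : ℕ} (hγ : γ * N = 1) (l₁ l₂ : ℤ) :
    sites γ ((l₁ : ℝ) - 1) l₂ = Finset.Ioc ((l₁ - 1) * (N : ℤ)) (l₂ * N) := by
  have hγ0 : γ ≠ 0 := by rintro rfl; simp at hγ
  refine sites_eq _ _ ?_ ?_ <;> rw [div_eq_iff hγ0] <;> push_cast <;>
    rw [mul_assoc, mul_comm _ γ, hγ, mul_one]

lemma siteBlock_subset_Ioc {M Q N : ℕ} (hM : 0 < M) (hN : M * Q = N) {l₁ l₂ l y : ℤ}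
    (hl : l ∈ Finset.Icc l₁ l₂) (hy : y ∈ siteBlock Q l) :
    siteBlock M y ⊆ Finset.Ioc ((l₁ - 1) * (N : ℤ)) (l₂ * N) := by
  intro i hi
  have h1 : i ∈ siteBlock (M * Q) l := by
    rw [siteBlock_mul hM, blockSites, Finset.mem_biUnion]
    exact ⟨y, hy, hi⟩
  rw [hN] at h1
  rw [siteBlock, Finset.mem_Ioc] at h1
  rw [Finset.mem_Icc] at hl
  rw [Finset.mem_Ioc]
  have h2 : (l₁ - 1) * (N : ℤ) ≤ (l - 1) * N :=
    mul_le_mul_of_nonneg_right (by omega) (Nat.cast_nonneg _)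
  have h3 : l * (N : ℤ) ≤ l₂ * N := mul_le_mul_of_nonneg_right hl.2 (Nat.cast_nonneg _)
  omega

/-! ### The two halves of a block -/

lemma firstElements_subset (k : ℕ) (S : Finset ℤ) : firstElements k S ⊆ S :=
  Finset.filter_subset _ _

/-- The rank of an element within `S` maps `S` bijectively onto {1, …, |S|}, and the selected
elements are those of rank at most k. -/
lemma card_firstElements {k : ℕ} {S : Finset ℤ} (hk : k ≤ S.card) :
    (firstElements k S).card = k := by
  set rank : ℤ → ℕ := fun i => (S.filter (fun j => j ≤ i)).card with hrank
  have hlt : ∀ i, ∀ j ∈ S, i < j → rank i < rank j := fun i j hj hij => by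
    refine Finset.card_lt_card ⟨fun a ha => ?_, fun hsub => ?_⟩
    · rw [Finset.mem_filter] at ha ⊢
      exact ⟨ha.1, by omega⟩
    · have := hsub (Finset.mem_filter.2 ⟨hj, le_rfl⟩)
      rw [Finset.mem_filter] at this
      omega
  have hinj : Set.InjOn rank S := fun i hi j hj hij => by
    rcases lt_trichotomy i j with h | h | h
    · exact absurd hij (hlt i j hj h).ne
    · exact h
    · exact absurd hij (hlt j i hi h).ne'
  have himg : S.image rank = Finset.Icc 1 S.card := by
    refine Finset.eq_of_subset_of_card_le ?_ ?_
    · intro a ha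
      obtain ⟨i, hi, rfl⟩ := Finset.mem_image.1 ha
      rw [Finset.mem_Icc]
      exact ⟨Finset.card_pos.2 ⟨i, Finset.mem_filter.2 ⟨hi, le_rfl⟩⟩,
        Finset.card_le_card (Finset.filter_subset _ _)⟩
    · rw [Finset.card_image_of_injOn hinj, Nat.card_Icc]
      omega
  have h1 : (firstElements k S).image rank = Finset.Icc 1 k := by
    ext a
    simp only [firstElements, Finset.mem_image, Finset.mem_filter, Finset.mem_Icc]
    constructor
    · rintro ⟨i, ⟨hi, hik⟩, rfl⟩
      exact ⟨Finset.card_pos.2 ⟨i, Finset.mem_filter.2 ⟨hi, le_rfl⟩⟩, hik⟩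
    · rintro ⟨h1, h2⟩
      have : a ∈ S.image rank := by rw [himg, Finset.mem_Icc]; omega
      obtain ⟨i, hi, rfl⟩ := Finset.mem_image.1 this
      exact ⟨i, ⟨hi, h2⟩, rfl⟩
  rw [← Finset.card_image_of_injOn (hinj.mono (Finset.coe_subset.2 (firstElements_subset k S))), h1,
    Nat.card_Icc]
  omega

/-- The two halves of the blocks. -/
noncomputable def halfBlock (γ δs : ℝ) (h : ℤ → ℝ) (b : Bool) (x : ℤ) : Finset ℤ :=
  if b then blockPlus γ δs h x else blockMinus γ δs h x

section
variable {γ δs : ℝ} {K : ℕ} {h : ℤ → ℝ}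

/-- Whichever sign has at least half of the block fills its own half entirely. This purity of one
half is what keeps the imbalance error of a constant sign. -/
lemma halfBlock_cases (hγ : 0 < γ) (hδs : δs = γ * (2 * K)) (hh : ∀ i, h i = 1 ∨ h i = -1)
    (x : ℤ) : ((blockPlus γ δs h x).card = K ∧ (blockMinus γ δs h x).card = K ∧
      blockPlus γ δs h x ⊆ block γ δs x) ∧
      ((∀ i ∈ blockPlus γ δs h x, h i = 1) ∨ ∀ i ∈ blockMinus γ δs h x, h i = -1) := by
  have hfloor : ⌊δs / γ / 2⌋₊ = K := by
    rw [hδs, show γ * (2 * (K : ℝ)) / γ / 2 = K by field_simp, Nat.floor_natCast]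
  have hcard : (block γ δs x).card = 2 * K := by rw [block_eq hγ hδs, card_siteBlock]
  have hsub : ∀ τ, blockField γ δs h τ x ⊆ block γ δs x := fun τ => Finset.filter_subset _ _
  by_cases hK : K ≤ (blockField γ δs h 1 x).card
  · have hp : blockPlus γ δs h x = firstElements K (blockField γ δs h 1 x) := by
      rw [blockPlus, hfloor, if_pos hK]
    have hps : blockPlus γ δs h x ⊆ blockField γ δs h 1 x := by
      rw [hp]; exact firstElements_subset _ _
    have hpc : (blockPlus γ δs h x).card = K := by rw [hp, card_firstElements hK]
    refine ⟨⟨hpc, ?_, hps.trans (hsub 1)⟩, Or.inl fun i hi => (Finset.mem_filter.1 (hps hi)).2⟩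
    rw [blockMinus, Finset.card_sdiff_of_subset (hps.trans (hsub 1)), hpc, hcard]
    omega
  · have hK' : K ≤ (blockField γ δs h (-1) x).card := by
      have h1 : block γ δs x ⊆ blockField γ δs h 1 x ∪ blockField γ δs h (-1) x := fun i hi => by
        rw [Finset.mem_union, blockField, blockField, Finset.mem_filter, Finset.mem_filter]
        exact (hh i).imp (fun h => ⟨hi, h⟩) fun h => ⟨hi, h⟩
      have h2 := (Finset.card_le_card h1).trans (Finset.card_union_le _ _)
      omega
    have hp : blockPlus γ δs h x =
        block γ δs x \ firstElements K (blockField γ δs h (-1) x) := by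
      rw [blockPlus, hfloor, if_neg hK]
    have hfs := (firstElements_subset K (blockField γ δs h (-1) x))
    have hm : blockMinus γ δs h x = firstElements K (blockField γ δs h (-1) x) := by
      rw [blockMinus, hp, Finset.sdiff_sdiff_eq_self (hfs.trans (hsub _))]
    refine ⟨⟨?_, by rw [hm, card_firstElements hK'], by rw [hp]; exact Finset.sdiff_subset⟩,
      Or.inr fun i hi => ?_⟩
    · rw [hp, Finset.card_sdiff_of_subset (hfs.trans (hsub _)), hcard, card_firstElements hK']
      omega
    · rw [hm] at hi
      exact (Finset.mem_filter.1 (hfs hi)).2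

lemma halfBlocks_halfBlock (hγ : 0 < γ) (hδs : δs = γ * (2 * K)) (hh : ∀ i, h i = 1 ∨ h i = -1) :
    HalfBlocks K (halfBlock γ δs h) where
  card b x := by
    obtain ⟨⟨h1, h2, -⟩, -⟩ := halfBlock_cases hγ hδs hh x
    cases b
    · simpa [halfBlock] using h2
    · simpa [halfBlock] using h1
  disj x := by
    simp only [halfBlock, if_true, Bool.false_eq_true, if_false, blockMinus]
    exact Finset.disjoint_sdiff
  union x := by
    obtain ⟨⟨-, -, h3⟩, -⟩ := halfBlock_cases hγ hδs hh x
    simp only [halfBlock, if_true, Bool.false_eq_true, if_false, blockMinus]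
    rw [Finset.union_sdiff_of_subset h3, block_eq hγ hδs]

-- The ideal field is ±1 on the two halves and sums to 0 over the block. As one half is pure, h - h'
-- has a constant sign, so its ℓ¹ norm is the absolute value of the sum of h.
open Classical in
lemma exists_idealField (hγ : 0 < γ) (hK : 0 < K) (hδs : δs = γ * (2 * K))
    (hh : ∀ i, h i = 1 ∨ h i = -1) :
    ∃ h' : ℤ → ℝ, (∀ b x, ∀ i ∈ halfBlock γ δs h b x, h' i = spin b) ∧
      ∀ x, ∑ i ∈ siteBlock (2 * K) x, |h i - h' i| ≤ |∑ i ∈ siteBlock (2 * K) x, h i| := by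
  have hB := halfBlocks_halfBlock hγ hδs hh
  set h' : ℤ → ℝ := fun i =>
    if i ∈ halfBlock γ δs h true (blockIndex (2 * K) i) then 1 else -1 with hdef
  have h1 : ∀ b x, ∀ i ∈ halfBlock γ δs h b x, h' i = spin b := fun b x i hi => by
    have hx : blockIndex (2 * K) i = x := (mem_siteBlock (by omega)).1 (hB.subset b x hi)
    simp only [hdef, hx]
    cases b
    · rw [if_neg (fun hi' => Finset.disjoint_left.1 (hB.disj x) hi' hi)]
      simp [spin]
    · rw [if_pos hi]
      simp [spin]
  refine ⟨h', h1, fun x => ?_⟩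
  have h2 : ∑ i ∈ siteBlock (2 * K) x, h' i = 0 := by
    rw [hB.sum_siteBlock, Fintype.sum_bool, Finset.sum_congr rfl (h1 true x),
      Finset.sum_congr rfl (h1 false x)]
    simp [hB.card, spin]
  obtain ⟨-, h3 | h3⟩ := halfBlock_cases hγ hδs hh x
  · have h4 : ∀ i ∈ siteBlock (2 * K) x, 0 ≤ h i - h' i := fun i hi => by
      rw [← hB.union, Finset.mem_union] at hi
      rcases hi with hi | hi
      · rw [h1 true x i hi, h3 i (by simpa [halfBlock] using hi)]
        simp [spin]
      · rw [h1 false x i hi]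
        rcases hh i with h | h <;> rw [h] <;> simp [spin]
    rw [Finset.sum_congr rfl fun i hi => abs_of_nonneg (h4 i hi), Finset.sum_sub_distrib, h2,
      sub_zero]
    exact le_abs_self _
  · have h4 : ∀ i ∈ siteBlock (2 * K) x, h i - h' i ≤ 0 := fun i hi => by
      rw [← hB.union, Finset.mem_union] at hi
      rcases hi with hi | hi
      · rw [h1 true x i hi]
        rcases hh i with h | h <;> rw [h] <;> simp [spin]
      · rw [h1 false x i hi, h3 i (by simpa [halfBlock] using hi)]
        simp [spin]
    rw [Finset.sum_congr rfl fun i hi => abs_of_nonpos (h4 i hi), Finset.sum_neg_distrib,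
      Finset.sum_sub_distrib, h2, sub_zero]
    exact neg_le_abs _

/-! ### The phase indicator -/

lemma mPlus_eq (hγ : 0 < γ) (hK : 0 < K) (hδs : δs = γ * (2 * K)) (hh : ∀ i, h i = 1 ∨ h i = -1)
    (σ : Config) (x : ℤ) :
    mPlus γ δs h σ x = mag K (plusCount σ (halfBlock γ δs h true x)) := by
  have h1 := (halfBlocks_halfBlock hγ hδs hh).sum_spin hK σ true x
  have hK0 : (0 : ℝ) < K := by exact_mod_cast hK
  rw [show halfBlock γ δs h true x = blockPlus γ δs h x by simp [halfBlock]] at *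
  rw [mPlus, h1, hδs]
  field_simp

lemma mMinus_eq (hγ : 0 < γ) (hK : 0 < K) (hδs : δs = γ * (2 * K)) (hh : ∀ i, h i = 1 ∨ h i = -1)
    (σ : Config) (x : ℤ) :
    mMinus γ δs h σ x = mag K (plusCount σ (halfBlock γ δs h false x)) := by
  have h1 := (halfBlocks_halfBlock hγ hδs hh).sum_spin hK σ false x
  have hK0 : (0 : ℝ) < K := by exact_mod_cast hK
  rw [show halfBlock γ δs h false x = blockMinus γ δs h x by simp [halfBlock]] at *
  rw [mMinus, h1, hδs]
  field_simp

lemma distPlus_eq (hγ : 0 < γ) (hK : 0 < K) (hδs : δs = γ * (2 * K))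
    (hh : ∀ i, h i = 1 ∨ h i = -1) (β θ : ℝ) (σ : Config) (x : ℤ) :
    distPlus β θ (mPlus γ δs h σ x) (mMinus γ δs h σ x) =
      profileDist K (halfBlock γ δs h) β θ (mTilde β θ) σ x := by
  rw [mPlus_eq hγ hK hδs hh, mMinus_eq hγ hK hδs hh]
  unfold distPlus profileDist phaseDist
  rw [Fintype.sum_bool]
  simp [phaseComp, spin, mPhase1, mPhase2, sub_eq_add_neg]

lemma distMinus_eq (hγ : 0 < γ) (hK : 0 < K) (hδs : δs = γ * (2 * K))
    (hh : ∀ i, h i = 1 ∨ h i = -1) (β θ : ℝ) (σ : Config) (x : ℤ) :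
    distMinus β θ (mPlus γ δs h σ x) (mMinus γ δs h σ x) =
      profileDist K (halfBlock γ δs h) β θ (-mTilde β θ) σ x := by
  rw [mPlus_eq hγ hK hδs hh, mMinus_eq hγ hK hδs hh]
  unfold distMinus profileDist phaseDist
  rw [Fintype.sum_bool]
  simp only [phaseComp, spin, mPhase1, mPhase2, if_true, Bool.false_eq_true, if_false]
  rw [show β * (-mTilde β θ + 1 * θ) = -(β * (mTilde β θ - θ)) by ring,
    show β * (-mTilde β θ + -1 * θ) = -(β * (mTilde β θ + θ)) by ring, Real.tanh_neg,
    Real.tanh_neg, sub_neg_eq_add, sub_neg_eq_add]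

/-- The two phases differ by m_{β,1} + m_{β,2} = 2 m̃ in each component, so this is the triangle
inequality. -/
lemma four_mul_mTilde_le (β θ m₁ m₂ : ℝ) :
    4 * mTilde β θ ≤ distPlus β θ m₁ m₂ + distMinus β θ m₁ m₂ := by
  have h1 : mPhase1 β θ + mPhase2 β θ = 2 * mTilde β θ := by
    have := gMap_mTilde β θ
    unfold gMap at this
    unfold mPhase1 mPhase2
    linarith
  unfold distPlus distMinus
  have h2 := neg_abs_le (m₁ - mPhase1 β θ)
  have h3 := neg_abs_le (m₂ - mPhase2 β θ)
  have h4 := le_abs_self (m₁ + mPhase2 β θ)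
  have h5 := le_abs_self (m₂ + mPhase1 β θ)
  linarith

/-- The definition of `eta` tests the plus phase first. For ζ < m̃ the two tests exclude each other,
so the order does not matter and both phases are described by `CloseTo`. -/
lemma eta_eq_iff {k q : ℕ} {δ β θ ζ : ℝ} (hγ : 0 < γ) (hK : 0 < K) (hδs : δs = γ * (2 * K))
    (hh : ∀ i, h i = 1 ∨ h i = -1) (hk : 0 < k) (hq0 : 0 < q) (hδ : δ = k * δs)
    (hq : 1 / δ = q) (hζ : ζ < mTilde β θ) (hm : 0 < mTilde β θ) {ηbar : ℤ}
    (hη : ηbar = 1 ∨ ηbar = -1) (σ : Config) (l : ℤ) :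
    eta β θ γ δs δ ζ h σ l = ηbar ↔
      CloseTo k q ζ (profileDist K (halfBlock γ δs h) β θ (ηbar * mTilde β θ) σ) l := by
  have hk0 : (0 : ℝ) < k := by exact_mod_cast hk
  have hK0 : (0 : ℝ) < K := by exact_mod_cast hK
  have hδs0 : 0 < δs := by rw [hδs]; positivity
  have hcond : ∀ S : ℝ, δs / δ * S ≤ ζ ↔ S ≤ ζ * k := fun S => by
    rw [hδ, show δs / (k * δs) * S = S / k by field_simp, div_le_iff₀ hk0]
  have hplus : (∀ u ∈ cells δ ((l : ℝ) - 1) l,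
      δs / δ * ∑ x ∈ cells δs (((u : ℝ) - 1) * δ) (u * δ),
        distPlus β θ (mPlus γ δs h σ x) (mMinus γ δs h σ x) ≤ ζ) ↔
      CloseTo k q ζ (profileDist K (halfBlock γ δs h) β θ (mTilde β θ) σ) l := by
    simp only [hcond, cells_unit_eq hq, cells_block_eq hδs0 hδ, distPlus_eq hγ hK hδs hh, CloseTo]
  have hminus : (∀ u ∈ cells δ ((l : ℝ) - 1) l,
      δs / δ * ∑ x ∈ cells δs (((u : ℝ) - 1) * δ) (u * δ),
        distMinus β θ (mPlus γ δs h σ x) (mMinus γ δs h σ x) ≤ ζ) ↔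
      CloseTo k q ζ (profileDist K (halfBlock γ δs h) β θ (-mTilde β θ) σ) l := by
    simp only [hcond, cells_unit_eq hq, cells_block_eq hδs0 hδ, distMinus_eq hγ hK hδs hh, CloseTo]
  have hdisj : CloseTo k q ζ (profileDist K (halfBlock γ δs h) β θ (mTilde β θ) σ) l →
      ¬CloseTo k q ζ (profileDist K (halfBlock γ δs h) β θ (-mTilde β θ) σ) l := by
    intro h1 h2
    have hne : (siteBlock q l).Nonempty := by
      rw [← Finset.card_pos, card_siteBlock]; exact hq0
    obtain ⟨u, hu⟩ := hne
    have h3 := h1 u hu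
    have h4 := h2 u hu
    have h5 : (siteBlock k u).card • (4 * mTilde β θ) ≤ ∑ x ∈ siteBlock k u,
        (profileDist K (halfBlock γ δs h) β θ (mTilde β θ) σ x +
          profileDist K (halfBlock γ δs h) β θ (-mTilde β θ) σ x) := by
      refine Finset.card_nsmul_le_sum _ _ _ fun x _ => ?_
      rw [← distPlus_eq hγ hK hδs hh, ← distMinus_eq hγ hK hδs hh]
      exact four_mul_mTilde_le _ _ _ _
    rw [Finset.sum_add_distrib, card_siteBlock, nsmul_eq_mul] at h5
    have h6 : (k : ℝ) * ζ < k * mTilde β θ := mul_lt_mul_of_pos_left hζ hk0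
    have h7 : 0 < (k : ℝ) * mTilde β θ := by positivity
    linarith
  unfold eta
  rw [hplus, hminus]
  rcases hη with rfl | rfl
  · rw [Int.cast_one, one_mul]
    constructor
    · intro h1
      by_contra h2
      rw [if_neg h2] at h1
      split_ifs at h1; omega
    · intro h1
      rw [if_pos h1]
  · rw [Int.cast_neg, Int.cast_one, neg_one_mul]
    constructor
    · intro h1
      by_contra h2
      rw [if_neg h2] at h1
      split_ifs at h1
    · intro h1
      rw [if_neg fun h2 => hdisj h2 h1, if_pos h1]

lemma R14_eq_closeR14 {k q : ℕ} {δ β θ ζ₁ ζ₄ : ℝ} (hγ : 0 < γ) (hK : 0 < K)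
    (hδs : δs = γ * (2 * K)) (hh : ∀ i, h i = 1 ∨ h i = -1) (hk : 0 < k) (hq0 : 0 < q)
    (hδ : δ = k * δs) (hq : 1 / δ = q) (hζ₁ : ζ₁ < mTilde β θ) (hζ₄ : ζ₄ < mTilde β θ)
    (hm : 0 < mTilde β θ) {ηbar : ℤ} (hη : ηbar = 1 ∨ ηbar = -1) (l₁ l₂ : ℤ) :
    R14 β θ γ δs δ ζ₁ ζ₄ h ηbar l₁ l₂ =
      closeR14 K k q (halfBlock γ δs h) β θ (ηbar * mTilde β θ) ζ₁ ζ₄ l₁ l₂ := by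
  unfold R14 closeR14
  simp only [eta_eq_iff hγ hK hδs hh hk hq0 hδ hq hζ₁ hm hη,
    eta_eq_iff hγ hK hδs hh hk hq0 hδ hq hζ₄ hm hη]

lemma R5_eq_closeR5 {k q : ℕ} {δ β θ ζ₅ : ℝ} (hγ : 0 < γ) (hK : 0 < K)
    (hδs : δs = γ * (2 * K)) (hh : ∀ i, h i = 1 ∨ h i = -1) (hk : 0 < k) (hq0 : 0 < q)
    (hδ : δ = k * δs) (hq : 1 / δ = q) (hζ : ζ₅ < mTilde β θ)
    (hm : 0 < mTilde β θ) {ηbar : ℤ} (hη : ηbar = 1 ∨ ηbar = -1) (l₁ l₂ : ℤ) :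
    R5 β θ γ δs δ ζ₅ h ηbar l₁ l₂ =
      closeR5 K k q (halfBlock γ δs h) β θ (ηbar * mTilde β θ) ζ₅ l₁ l₂ := by
  unfold R5 closeR5
  simp only [eta_eq_iff hγ hK hδs hh hk hq0 hδ hq hζ hm hη]

end

/-! ### Conditional probabilities of finite volume Gibbs measures -/

lemma sum_patch_congr {I J : Finset ℤ} (hI : I ⊆ J) (f g : Config → ℝ)
    (h : ∀ τ, ∑ a : I → Bool, f (patch I τ a) = ∑ a : I → Bool, g (patch I τ a)) (σ : Config) :
    ∑ s : J → Bool, f (patch J σ s) = ∑ s : J → Bool, g (patch J σ s) := by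
  set mix : Config → Config := fun τ i => if i ∈ J then τ i else σ i with hmix
  have h1 : ∀ s : J → Bool, patch J σ s = mix (extend J s) := fun s => by
    funext i
    by_cases hi : i ∈ J <;> simp [patch, hmix, extend, hi]
  have h2 : ∀ τ (a : I → Bool), mix (patch I τ a) = patch I (mix τ) a := fun τ a => by
    funext i
    by_cases hi : i ∈ I
    · simp [patch, hmix, hi, hI hi]
    · by_cases hj : i ∈ J <;> simp [patch, hmix, hi, hj]
  simp only [h1]
  rw [sum_extend_eq hI (fun τ => f (mix τ)), sum_extend_eq hI (fun τ => g (mix τ))]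
  refine Finset.sum_congr rfl fun b _ => ?_
  simp only [h2]
  exact h _

/-- Doeblin's argument: the normalized weights p dominate ε times the normalized reference weights
p₀. The p-average is therefore ε times a fixed number plus a remainder of mass 1 - ε, so its
oscillation shrinks by the factor 1 - ε. -/
lemma average_bounds {S : Type*} [Fintype S] {p p₀ q : S → ℝ} {M ε R a d : ℝ}
    (hp₀ : ∀ s, 0 < p₀ s) [Nonempty S] (hM : 0 < M) (hε : 0 < ε) (hR : 0 < R)
    (hMε : ε * M ^ 2 ≤ 1)
    (h1 : ∀ s, R * p₀ s ≤ M * p s) (h2 : ∀ s, p s ≤ M * (R * p₀ s))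
    (hq : ∀ s, a ≤ q s ∧ q s ≤ a + d) :
    (1 - ε) * a + ε * ((∑ s, p₀ s * q s) / ∑ s, p₀ s) ≤ (∑ s, p s * q s) / ∑ s, p s ∧
      (∑ s, p s * q s) / ∑ s, p s ≤
        (1 - ε) * a + ε * ((∑ s, p₀ s * q s) / ∑ s, p₀ s) + (1 - ε) * d := by
  have hp : ∀ s, 0 < p s := fun s => by
    have := h1 s
    have := hp₀ s
    by_contra hcon
    rw [not_lt] at hcon
    have : M * p s ≤ 0 := mul_nonpos_of_nonneg_of_nonpos hM.le hcon
    have : 0 < R * p₀ s := by positivity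
    linarith
  have hP : 0 < ∑ s, p s := Finset.sum_pos (fun s _ => hp s) Finset.univ_nonempty
  have hP₀ : 0 < ∑ s, p₀ s := Finset.sum_pos (fun s _ => hp₀ s) Finset.univ_nonempty
  set P := ∑ s, p s with hPdef
  set P₀ := ∑ s, p₀ s with hP₀def
  have hPP : P ≤ M * (R * P₀) := by
    rw [hPdef, hP₀def, Finset.mul_sum, Finset.mul_sum]
    exact Finset.sum_le_sum fun s _ => h2 s
  set r : S → ℝ := fun s => p s / P - ε * (p₀ s / P₀) with hr
  have hr0 : ∀ s, 0 ≤ r s := fun s => by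
    simp only [hr]
    rw [sub_nonneg, ← mul_div_assoc, div_le_div_iff₀ hP₀ hP]
    have h3 : R * p₀ s ≤ M * p s := h1 s
    have h4 : 0 < p₀ s := hp₀ s
    have h5 : 0 < p s := hp s
    calc ε * p₀ s * P ≤ ε * p₀ s * (M * (R * P₀)) := by gcongr
      _ = ε * M * P₀ * (R * p₀ s) := by ring
      _ ≤ ε * M * P₀ * (M * p s) := by gcongr
      _ = ε * M ^ 2 * (p s * P₀) := by ring
      _ ≤ 1 * (p s * P₀) := by gcongr
      _ = p s * P₀ := one_mul _
  have hrsum : ∑ s, r s = 1 - ε := by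
    simp only [hr]
    rw [Finset.sum_sub_distrib, ← Finset.sum_div, ← Finset.mul_sum, ← Finset.sum_div,
      ← hPdef, ← hP₀def, div_self hP.ne', div_self hP₀.ne', mul_one]
  have hkey : (∑ s, p s * q s) / P =
      ∑ s, r s * q s + ε * ((∑ s, p₀ s * q s) / P₀) := by
    simp only [hr]
    rw [Finset.sum_div, Finset.sum_div, Finset.mul_sum, ← Finset.sum_add_distrib]
    refine Finset.sum_congr rfl fun s _ => ?_
    ring
  have hlow : (1 - ε) * a ≤ ∑ s, r s * q s := by
    rw [← hrsum, Finset.sum_mul]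
    exact Finset.sum_le_sum fun s _ => mul_le_mul_of_nonneg_left (hq s).1 (hr0 s)
  have hupp : ∑ s, r s * q s ≤ (1 - ε) * (a + d) := by
    rw [← hrsum, Finset.sum_mul]
    exact Finset.sum_le_sum fun s _ => mul_le_mul_of_nonneg_left (hq s).2 (hr0 s)
  rw [hkey]
  constructor <;> linarith

section
variable (β θ γ : ℝ) (h : ℤ → ℝ)

/-- The interaction energy between the spins in `I` and in `J`. -/
noncomputable def crossEnergy (I J : Finset ℤ) (σ : Config) : ℝ :=
  ∑ i ∈ I, ∑ j ∈ J, γ * kacJ (γ * ((i : ℝ) - (j : ℝ))) * spin (σ i) * spin (σ j)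

lemma hamiltonian_split {I V : Finset ℤ} (hI : I ⊆ V) (σ : Config) :
    hamiltonian θ γ h V σ = hamiltonian θ γ h I σ + hamiltonian θ γ h (V \ I) σ -
      crossEnergy γ I (V \ I) σ := by
  have hd : Disjoint I (V \ I) := Finset.disjoint_sdiff
  have hV : V = I ∪ V \ I := (Finset.union_sdiff_of_subset hI).symm
  have hsymm : crossEnergy γ (V \ I) I σ = crossEnergy γ I (V \ I) σ := by
    unfold crossEnergy
    rw [Finset.sum_comm]
    refine Finset.sum_congr rfl fun i _ => Finset.sum_congr rfl fun j _ => ?_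
    rw [kacJ_comm]
    ring
  have h1 : crossEnergy γ V V σ = crossEnergy γ I I σ + crossEnergy γ I (V \ I) σ +
      (crossEnergy γ (V \ I) I σ + crossEnergy γ (V \ I) (V \ I) σ) := by
    unfold crossEnergy
    nth_rw 1 [hV]
    rw [Finset.sum_union hd, ← Finset.sum_add_distrib, ← Finset.sum_add_distrib]
    congr 1 <;>
    · refine Finset.sum_congr rfl fun i _ => ?_
      nth_rw 1 [hV]
      rw [Finset.sum_union hd]
  have h2 : ∑ i ∈ V, h i * spin (σ i) =
      ∑ i ∈ I, h i * spin (σ i) + ∑ i ∈ V \ I, h i * spin (σ i) := by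
    nth_rw 1 [hV]
    rw [Finset.sum_union hd]
  unfold hamiltonian
  rw [h2]
  change -(1 / 2) * crossEnergy γ V V σ - _ = -(1 / 2) * crossEnergy γ I I σ - _ +
    (-(1 / 2) * crossEnergy γ (V \ I) (V \ I) σ - _) - _
  rw [h1, hsymm]
  ring

lemma hamiltonian_congr {V : Finset ℤ} {σ σ' : Config} (hσ : ∀ i ∈ V, σ i = σ' i) :
    hamiltonian θ γ h V σ = hamiltonian θ γ h V σ' := by
  unfold hamiltonian
  congr 2
  · exact Finset.sum_congr rfl fun i hi => Finset.sum_congr rfl fun j hj => by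
      rw [hσ i hi, hσ j hj]
  · exact Finset.sum_congr rfl fun i hi => by rw [hσ i hi]

/-- The Boltzmann weight. -/
noncomputable def boltz (V : Finset ℤ) (σ : Config) : ℝ := Real.exp (-β * hamiltonian θ γ h V σ)

lemma boltz_pos (V : Finset ℤ) (σ : Config) : 0 < boltz β θ γ h V σ := Real.exp_pos _

open Classical in
/-- The conditional probability of `F`, given the spins outside of `I`. -/
noncomputable def condProb (V I : Finset ℤ) (F : Set Config) (σ : Config) : ℝ :=
  (∑ a : I → Bool, if patch I σ a ∈ F then boltz β θ γ h V (patch I σ a) else 0) /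
    ∑ a : I → Bool, boltz β θ γ h V (patch I σ a)

lemma sum_boltz_pos (V I : Finset ℤ) (σ : Config) :
    0 < ∑ a : I → Bool, boltz β θ γ h V (patch I σ a) :=
  Finset.sum_pos (fun _ _ => boltz_pos _ _ _ _ _ _) Finset.univ_nonempty

lemma condProb_nonneg (V I : Finset ℤ) (F : Set Config) (σ : Config) :
    0 ≤ condProb β θ γ h V I F σ :=
  div_nonneg (Finset.sum_nonneg fun _ _ => by
    split_ifs <;> first | exact (boltz_pos _ _ _ _ _ _).le | rfl) (sum_boltz_pos _ _ _ _ _ _ _).le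

lemma condProb_le_one (V I : Finset ℤ) (F : Set Config) (σ : Config) :
    condProb β θ γ h V I F σ ≤ 1 :=
  div_le_one_of_le₀ (Finset.sum_le_sum fun _ _ => by
    split_ifs <;> first | exact (boltz_pos _ _ _ _ _ _).le | rfl) (sum_boltz_pos _ _ _ _ _ _ _).le

lemma condProb_patch (V I : Finset ℤ) (F : Set Config) (σ : Config) (a : I → Bool) :
    condProb β θ γ h V I F (patch I σ a) = condProb β θ γ h V I F σ := by
  unfold condProb
  congr 1 <;> exact Finset.sum_congr rfl fun x _ => by rw [patch_patch]

/-- The tower property of conditional probabilities. -/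
lemma condProb_eq_average {V I J : Finset ℤ} (hI : I ⊆ J) (F : Set Config) (σ : Config) :
    condProb β θ γ h V J F σ = (∑ s : J → Bool, boltz β θ γ h V (patch J σ s) *
      condProb β θ γ h V I F (patch J σ s)) / ∑ s : J → Bool, boltz β θ γ h V (patch J σ s) := by
  classical
  rw [condProb]
  congr 1
  refine sum_patch_congr hI (fun τ => if τ ∈ F then boltz β θ γ h V τ else 0)
    (fun τ => boltz β θ γ h V τ * condProb β θ γ h V I F τ) (fun τ => ?_) σ
  simp only [condProb_patch, ← Finset.sum_mul]
  rw [condProb, mul_div_cancel₀ _ (sum_boltz_pos β θ γ h V I τ).ne']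

/-- The spins in `I` do not interact with the outside of `J`. All terms of the energy that reach
beyond `J` form a common factor R, which cancels in the quotient. -/
lemma condProb_congr {V I J : Finset ℤ} (hI : I ⊆ J) (hJ : J ⊆ V)
    (hrange : ∀ i ∈ I, ∀ j ∉ J, kacJ (γ * ((i : ℝ) - (j : ℝ))) = 0) {F : Set Config}
    (hF : ∀ σ σ' : Config, (∀ i ∈ J, σ i = σ' i) → (σ ∈ F ↔ σ' ∈ F)) {σ σ' : Config}
    (hσ : ∀ i ∈ J, σ i = σ' i) :
    condProb β θ γ h V I F σ = condProb β θ γ h J I F σ' := by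
  classical
  have hagree : ∀ a : I → Bool, ∀ i ∈ J, patch I σ a i = patch I σ' a i := fun a i hi => by
    by_cases h : i ∈ I <;> simp [patch, h, hσ i hi]
  set R := Real.exp (-β * (hamiltonian θ γ h (V \ J) σ - crossEnergy γ (J \ I) (V \ J) σ)) with hR
  have hw : ∀ a : I → Bool,
      boltz β θ γ h V (patch I σ a) = R * boltz β θ γ h J (patch I σ' a) := fun a => by
    unfold boltz
    rw [hamiltonian_split θ γ h hJ, hamiltonian_congr θ γ h (hagree a), hR, ← Real.exp_add]
    congr 1
    have h1 : hamiltonian θ γ h (V \ J) (patch I σ a) = hamiltonian θ γ h (V \ J) σ :=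
      hamiltonian_congr θ γ h fun i hi => patch_of_notMem σ a fun hiI =>
        (Finset.mem_sdiff.1 hi).2 (hI hiI)
    have h2 : crossEnergy γ J (V \ J) (patch I σ a) = crossEnergy γ (J \ I) (V \ J) σ := by
      unfold crossEnergy
      rw [← Finset.sum_sdiff hI, Finset.sum_eq_zero (s := I) fun i hi =>
        Finset.sum_eq_zero fun j hj => by
          rw [hrange i hi j (Finset.mem_sdiff.1 hj).2]; ring, add_zero]
      refine Finset.sum_congr rfl fun i hi => Finset.sum_congr rfl fun j hj => ?_
      rw [patch_of_notMem σ a (Finset.mem_sdiff.1 hi).2,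
        patch_of_notMem σ a fun hjI => (Finset.mem_sdiff.1 hj).2 (hI hjI)]
    rw [h1, h2]
    ring
  unfold condProb
  simp only [hw, hF _ _ (hagree _)]
  have hR0 : R ≠ 0 := (Real.exp_pos _).ne'
  rw [← Finset.mul_sum]
  simp only [← mul_ite_zero]
  rw [← Finset.mul_sum, mul_div_mul_left _ _ hR0]

/-- The energy estimate which makes the boundary conditions comparable. -/
lemma abs_crossEnergy_le (hγ : 0 < γ) {E I J : Finset ℤ}
    (hE : ∀ i ∈ I, ∀ j ∈ J, kacJ (γ * ((i : ℝ) - (j : ℝ))) ≠ 0 → i ∈ E ∧ j ∈ E) (σ : Config) :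
    |crossEnergy γ I J σ| ≤ γ * (E.card : ℝ) ^ 2 := by
  have hspin : ∀ b, |spin b| = 1 := fun b => by cases b <;> simp [spin]
  unfold crossEnergy
  rw [← Finset.sum_product']
  refine (Finset.abs_sum_le_sum_abs _ _).trans ?_
  have h1 : ∀ p ∈ I ×ˢ J, |γ * kacJ (γ * ((p.1 : ℝ) - (p.2 : ℝ))) * spin (σ p.1) * spin (σ p.2)| ≤
      if p ∈ E ×ˢ E then γ else 0 := fun p hp => by
    rw [abs_mul, abs_mul, hspin, hspin, mul_one, mul_one, abs_mul, abs_of_pos hγ]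
    rw [Finset.mem_product] at hp
    by_cases h0 : kacJ (γ * ((p.1 : ℝ) - (p.2 : ℝ))) = 0
    · rw [h0, abs_zero, mul_zero]
      split_ifs <;> linarith
    · have := hE _ hp.1 _ hp.2 h0
      rw [if_pos (Finset.mem_product.2 this)]
      unfold kacJ
      split_ifs <;> simp [hγ.le]
  refine (Finset.sum_le_sum h1).trans ?_
  rw [← Finset.sum_filter, Finset.sum_const, nsmul_eq_mul, mul_comm]
  refine mul_le_mul_of_nonneg_left ?_ hγ.le
  have h2 := Finset.card_le_card (show (I ×ˢ J).filter (· ∈ E ×ˢ E) ⊆ E ×ˢ E from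
    fun p hp => (Finset.mem_filter.1 hp).2)
  rw [Finset.card_product] at h2
  rw [pow_two]
  exact_mod_cast h2

end

/-! ### The infinite volume Gibbs measure -/

/-- The symmetric interval of sites with `n` layers of width `R` on both sides. -/
noncomputable def layers (R n : ℕ) : Finset ℤ := Finset.Icc (-((n * R : ℕ) : ℤ)) ((n * R : ℕ) : ℤ)

lemma layers_subset {R m n : ℕ} (h : m ≤ n) : layers R m ⊆ layers R n := by
  have h1 : ((m * R : ℕ) : ℤ) ≤ ((n * R : ℕ) : ℤ) := by exact_mod_cast Nat.mul_le_mul_right R h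
  exact Finset.Icc_subset_Icc (by omega) h1

lemma abs_le_of_kacJ_ne_zero {γ : ℝ} {R : ℕ} (hγ : 0 < γ) (hR : 1 ≤ γ * R) {i j : ℤ}
    (h : kacJ (γ * ((i : ℝ) - (j : ℝ))) ≠ 0) : |i - j| ≤ R := by
  by_contra hcon
  rw [not_le] at hcon
  refine h ?_
  have h1 : (R : ℝ) < |(i : ℝ) - j| := by exact_mod_cast hcon
  unfold kacJ
  rw [if_neg]
  rw [abs_mul, abs_of_pos hγ, not_le]
  nlinarith

/-- The sites close to the boundary of `layers R n`. -/
noncomputable def boundaryLayer (R n : ℕ) : Finset ℤ :=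
  Finset.Icc (-((n * R : ℕ) : ℤ) - R) (-((n * R : ℕ) : ℤ) + R) ∪
    Finset.Icc (((n * R : ℕ) : ℤ) - R) (((n * R : ℕ) : ℤ) + R)

lemma card_boundaryLayer_le (R n : ℕ) : (boundaryLayer R n).card ≤ 2 * (2 * R + 1) := by
  unfold boundaryLayer
  refine (Finset.card_union_le _ _).trans ?_
  rw [Int.card_Icc, Int.card_Icc]
  omega

lemma mem_boundaryLayer {R n : ℕ} {i j : ℤ} (hi : i ∈ layers R n) (hj : j ∉ layers R n)
    (hij : |i - j| ≤ R) : i ∈ boundaryLayer R n ∧ j ∈ boundaryLayer R n := by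
  simp only [layers, boundaryLayer, Finset.mem_union, Finset.mem_Icc] at *
  rw [abs_le] at hij
  generalize ((n * R : ℕ) : ℤ) = m at *
  omega

lemma kacJ_eq_zero_of_layers {γ : ℝ} {R n : ℕ} (hγ : 0 < γ) (hR : 1 ≤ γ * R) {i j : ℤ}
    (hi : i ∈ layers R n) (hj : j ∉ layers R (n + 1)) :
    kacJ (γ * ((i : ℝ) - (j : ℝ))) = 0 := by
  by_contra h
  have h1 := abs_le_of_kacJ_ne_zero hγ hR h
  simp only [layers, Finset.mem_Icc, add_mul, one_mul] at *
  push_cast at *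
  rw [abs_le] at h1
  generalize ((n : ℤ) * R) = m at *
  omega

/-- The constant which controls the influence of the boundary conditions. -/
noncomputable def minorization (β γ : ℝ) (R : ℕ) : ℝ :=
  Real.exp (-(2 * (β * (γ * ((2 * (2 * R + 1) : ℕ) : ℝ) ^ 2))))

lemma minorization_pos (β γ : ℝ) (R : ℕ) : 0 < minorization β γ R := Real.exp_pos _

lemma minorization_le_one {β γ : ℝ} (hβ : 0 < β) (hγ : 0 < γ) (R : ℕ) :
    minorization β γ R ≤ 1 := by
  unfold minorization
  rw [Real.exp_le_one_iff]
  have : 0 ≤ 2 * (β * (γ * ((2 * (2 * R + 1) : ℕ) : ℝ) ^ 2)) := by positivity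
  linarith

section
variable {β θ γ : ℝ} {h : ℤ → ℝ} {R : ℕ}

/-- Only sites within R of the two end points of `J` interact across its boundary, so the weight
factorizes up to a constant that depends neither on n nor on V. -/
lemma boltz_patch_bounds (hβ : 0 < β) (hγ : 0 < γ) (hR : 1 ≤ γ * R) {n : ℕ} {J V : Finset ℤ}
    (hJ : J = layers R n) (hV : J ⊆ V) (σ : Config) (s : J → Bool) :
    Real.exp (-β * hamiltonian θ γ h (V \ J) σ) *
        boltz β θ γ h J (extend J s) ≤
      Real.exp (β * (γ * ((2 * (2 * R + 1) : ℕ) : ℝ) ^ 2)) *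
        boltz β θ γ h V (patch J σ s) ∧
    boltz β θ γ h V (patch J σ s) ≤
      Real.exp (β * (γ * ((2 * (2 * R + 1) : ℕ) : ℝ) ^ 2)) *
        (Real.exp (-β * hamiltonian θ γ h (V \ J) σ) *
          boltz β θ γ h J (extend J s)) := by
  have h1 : |crossEnergy γ J (V \ J) (patch J σ s)| ≤
      γ * ((2 * (2 * R + 1) : ℕ) : ℝ) ^ 2 := by
    refine (abs_crossEnergy_le γ hγ (E := boundaryLayer R n) (fun i hi j hj hij =>
      mem_boundaryLayer (hJ ▸ hi) (hJ ▸ (Finset.mem_sdiff.1 hj).2)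
        (abs_le_of_kacJ_ne_zero hγ hR hij)) _).trans ?_
    have := card_boundaryLayer_le R n
    gcongr
  have h2 : hamiltonian θ γ h J (patch J σ s) = hamiltonian θ γ h J (extend J s) :=
    hamiltonian_congr θ γ h fun i hi => by simp [patch, extend, hi]
  have h3 : hamiltonian θ γ h (V \ J) (patch J σ s) = hamiltonian θ γ h (V \ J) σ :=
    hamiltonian_congr θ γ h fun i hi => patch_of_notMem σ s (Finset.mem_sdiff.1 hi).2
  unfold boltz
  rw [hamiltonian_split θ γ h hV, h2, h3]
  rw [abs_le] at h1
  set C := γ * ((2 * (2 * R + 1) : ℕ) : ℝ) ^ 2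
  have h4 := mul_le_mul_of_nonneg_left h1.1 hβ.le
  have h5 := mul_le_mul_of_nonneg_left h1.2 hβ.le
  rw [← Real.exp_add, ← Real.exp_add, ← Real.exp_add, Real.exp_le_exp, Real.exp_le_exp]
  constructor <;> linarith

/-- The influence of the boundary conditions decays exponentially. -/
lemma exists_condProb_bounds (hβ : 0 < β) (hγ : 0 < γ) (hR : 1 ≤ γ * R) {n₀ : ℕ} {F : Set Config}
    (hF : ∀ σ σ' : Config, (∀ i ∈ layers R n₀, σ i = σ' i) → (σ ∈ F ↔ σ' ∈ F)) (k : ℕ) :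
    ∃ a, ∀ V, layers R (n₀ + k) ⊆ V → ∀ σ,
      a ≤ condProb β θ γ h V (layers R (n₀ + k)) F σ ∧
        condProb β θ γ h V (layers R (n₀ + k)) F σ ≤ a + (1 - minorization β γ R) ^ k := by
  induction k with
  | zero =>
    refine ⟨0, fun V _ σ => ⟨condProb_nonneg _ _ _ _ _ _ _ _, ?_⟩⟩
    rw [pow_zero, zero_add]
    exact condProb_le_one _ _ _ _ _ _ _ _
  | succ k ih =>
    obtain ⟨a, ha⟩ := ih
    set I := layers R (n₀ + k) with hI
    rw [show n₀ + (k + 1) = n₀ + k + 1 by ring]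
    set J := layers R (n₀ + k + 1) with hJ
    have hIJ : I ⊆ J := layers_subset (Nat.le_succ _)
    -- The reference average uses the free boundary weights in `J`, hence the new lower end is
    -- independent of V and σ.
    refine ⟨(1 - minorization β γ R) * a + minorization β γ R *
      ((∑ s : J → Bool, boltz β θ γ h J (extend J s) * condProb β θ γ h J I F (extend J s)) /
        ∑ s : J → Bool, boltz β θ γ h J (extend J s)), fun V hV σ => ?_⟩
    have hq : ∀ s : J → Bool,
        condProb β θ γ h V I F (patch J σ s) = condProb β θ γ h J I F (extend J s) := fun s =>
      condProb_congr β θ γ h hIJ hV (fun i hi j hj => kacJ_eq_zero_of_layers hγ hR hi hj)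
        (fun τ τ' hτ => hF τ τ' fun i hi => hτ i (layers_subset (by omega) hi))
        (fun i hi => by simp [patch, extend, hi])
    rw [condProb_eq_average β θ γ h hIJ F σ]
    simp only [hq]
    rw [pow_succ']
    refine average_bounds (fun s => boltz_pos _ _ _ _ _ _)
      (Real.exp_pos (β * (γ * ((2 * (2 * R + 1) : ℕ) : ℝ) ^ 2))) (minorization_pos β γ R)
      (Real.exp_pos (-β * hamiltonian θ γ h (V \ J) σ)) ?_
      (fun s => (boltz_patch_bounds hβ hγ hR hJ hV σ s).1)
      (fun s => (boltz_patch_bounds hβ hγ hR hJ hV σ s).2) fun s => ha J hIJ _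
    -- The minorization constant is M⁻², where M bounds the weights from above and from below.
    unfold minorization
    rw [← Real.exp_nat_mul, ← Real.exp_add, Real.exp_le_one_iff]
    push_cast
    linarith

lemma partitionFn_div_eq_condProb (Λ : Finset ℤ) (F : Set Config) :
    partitionFn β θ γ h Λ F / partitionFn β θ γ h Λ Set.univ =
      condProb β θ γ h Λ Λ F fun _ => true := by
  unfold partitionFn condProb boltz
  simp only [Set.mem_univ, if_true]
  rfl

/-- Convergence of the finite volume probabilities of local events. -/
lemma exists_tendsto_partitionFn_div (hβ : 0 < β) (hγ : 0 < γ) (A : Finset ℤ) {F : Set Config}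
    (hF : ∀ σ σ' : Config, (∀ i ∈ A, σ i = σ' i) → (σ ∈ F ↔ σ' ∈ F)) :
    ∃ x, Tendsto (fun L : ℕ => partitionFn β θ γ h (Finset.Icc (-(L : ℤ)) L) F /
      partitionFn β θ γ h (Finset.Icc (-(L : ℤ)) L) Set.univ) atTop (𝓝 x) := by
  obtain ⟨R, hR⟩ := exists_nat_ge (1 / γ)
  have hR1 : 1 ≤ γ * R := by rw [div_le_iff₀ hγ] at hR; linarith
  have hR0 : 0 < R := by
    rcases Nat.eq_zero_or_pos R with rfl | h
    · norm_num at hR1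
    · exact h
  obtain ⟨n₀, hn₀⟩ : ∃ n₀ : ℕ, A ⊆ layers R n₀ := by
    refine ⟨∑ i ∈ A, i.natAbs, fun i hi => ?_⟩
    have h1 : i.natAbs ≤ ∑ i ∈ A, i.natAbs :=
      Finset.single_le_sum (f := fun i : ℤ => i.natAbs) (fun _ _ => Nat.zero_le _) hi
    have h2 : i.natAbs ≤ (∑ i ∈ A, i.natAbs) * R := h1.trans (Nat.le_mul_of_pos_right _ hR0)
    rw [layers, Finset.mem_Icc]
    omega
  have hF' : ∀ σ σ' : Config, (∀ i ∈ layers R n₀, σ i = σ' i) → (σ ∈ F ↔ σ' ∈ F) :=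
    fun σ σ' hσ => hF σ σ' fun i hi => hσ i (hn₀ hi)
  refine cauchySeq_tendsto_of_complete ?_
  rw [Metric.cauchySeq_iff']
  intro ε hε
  have hm := minorization_pos β γ R
  have hm1 := minorization_le_one hβ hγ R
  obtain ⟨k, hk⟩ := exists_pow_lt_of_lt_one hε (show 1 - minorization β γ R < 1 by linarith)
  obtain ⟨a, ha⟩ := exists_condProb_bounds (θ := θ) (h := h) hβ hγ hR1 hF' k
  have hkey : ∀ L ≥ (n₀ + k) * R, a ≤ partitionFn β θ γ h (Finset.Icc (-(L : ℤ)) L) F /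
        partitionFn β θ γ h (Finset.Icc (-(L : ℤ)) L) Set.univ ∧
      partitionFn β θ γ h (Finset.Icc (-(L : ℤ)) L) F /
        partitionFn β θ γ h (Finset.Icc (-(L : ℤ)) L) Set.univ ≤
          a + (1 - minorization β γ R) ^ k := by
    intro L hL
    have hsub : layers R (n₀ + k) ⊆ Finset.Icc (-(L : ℤ)) L :=
      Finset.Icc_subset_Icc (by omega) (by omega)
    set Λ := Finset.Icc (-(L : ℤ)) L
    rw [partitionFn_div_eq_condProb, condProb_eq_average β θ γ h hsub]
    have hpos := sum_boltz_pos β θ γ h Λ Λ fun _ => true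
    rw [le_div_iff₀ hpos, div_le_iff₀ hpos, Finset.mul_sum, Finset.mul_sum]
    constructor <;> refine Finset.sum_le_sum fun s _ => ?_
    · rw [mul_comm]
      exact mul_le_mul_of_nonneg_left (ha Λ hsub _).1 (boltz_pos _ _ _ _ _ _).le
    · rw [mul_comm]
      exact mul_le_mul_of_nonneg_right (ha Λ hsub _).2 (boltz_pos _ _ _ _ _ _).le
  refine ⟨(n₀ + k) * R, fun L hL => ?_⟩
  have h1 := hkey L hL
  have h2 := hkey _ le_rfl
  rw [Real.dist_eq, abs_lt]
  constructor <;> linarith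

open Classical in
lemma gibbsMeasure_real (Λ : Finset ℤ) {F : Set Config} (hF : MeasurableSet F) :
    (gibbsMeasure β θ γ h Λ).real F =
      partitionFn β θ γ h Λ F / partitionFn β θ γ h Λ Set.univ := by
  have hZ := partitionFn_univ_pos β θ γ h Λ
  unfold gibbsMeasure
  rw [measureReal_def]
  simp only [Measure.coe_finsetSum, Finset.sum_apply, Measure.smul_apply, smul_eq_mul,
    Measure.dirac_apply' _ hF]
  rw [ENNReal.toReal_sum fun s _ => by
    by_cases hs : extend Λ s ∈ F <;> simp [hs]]
  rw [partitionFn.eq_1 β θ γ h Λ F, Finset.sum_div]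
  refine Finset.sum_congr rfl fun s _ => ?_
  by_cases hs : extend Λ s ∈ F
  · rw [if_pos hs, Set.indicator_of_mem hs, Pi.one_apply, mul_one,
      ENNReal.toReal_ofReal (div_nonneg (Real.exp_pos _).le hZ.le)]
  · rw [if_neg hs, Set.indicator_of_notMem hs, mul_zero, zero_div, ENNReal.toReal_zero]

lemma isClopen_of_local {A : Finset ℤ} {F : Set Config}
    (hF : ∀ σ σ' : Config, (∀ i ∈ A, σ i = σ' i) → (σ ∈ F ↔ σ' ∈ F)) : IsClopen F := by
  have h1 : F = A.restrict ⁻¹' (A.restrict '' F) := by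
    ext σ
    constructor
    · exact fun hσ => ⟨σ, hσ, rfl⟩
    · rintro ⟨σ', hσ', he⟩
      exact (hF σ' σ fun i hi => congr_fun he ⟨i, hi⟩).1 hσ'
  rw [h1]
  exact (isClopen_discrete _).preimage (by fun_prop)

lemma continuous_real_of_isClopen {F : Set Config} (hF : IsClopen F) :
    Continuous fun μ : ProbabilityMeasure Config => (μ : Measure Config).real F := by
  have h1 := ProbabilityMeasure.continuous_integral_boundedContinuousFunction
    (BoundedContinuousFunction.indicator F hF)
  refine h1.congr fun μ => ?_
  rw [← integral_indicator_one hF.isOpen.measurableSet]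
  rfl

/-- The space of probability measures on configurations is compact, so the sequence has a cluster
point. Cylinder events are clopen and their probabilities converge, so all cluster points agree on a
generating π-system. -/
theorem exists_isInfiniteVolumeGibbs (hβ : 0 < β) (hγ : 0 < γ) (θ : ℝ) (h : ℤ → ℝ) :
    ∃ μ, IsInfiniteVolumeGibbs β θ γ h μ := by
  set u : ℕ → ProbabilityMeasure Config := fun L => gibbs β θ γ h (Finset.Icc (-(L : ℤ)) L)
  obtain ⟨μ, hμ⟩ := exists_clusterPt_of_compactSpace (map u atTop)
  refine ⟨μ, tendsto_nhds_of_unique_mapClusterPt fun ν hν => ?_⟩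
  have hlim : ∀ F ∈ measurableCylinders (fun _ : ℤ => Bool), ∃ x, ∀ ν : ProbabilityMeasure Config,
      MapClusterPt ν atTop u → (ν : Measure Config).real F = x := by
    intro F hF
    obtain ⟨A, S, -, rfl⟩ := (mem_measurableCylinders _).1 hF
    have hloc : ∀ σ σ' : Config, (∀ i ∈ A, σ i = σ' i) →
        (σ ∈ cylinder A S ↔ σ' ∈ cylinder A S) := fun σ σ' hσ => by
      rw [mem_cylinder, mem_cylinder, show A.restrict σ = A.restrict σ' from
        funext fun i => hσ i i.2]
    have hclopen := isClopen_of_local hloc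
    obtain ⟨x, hx⟩ := exists_tendsto_partitionFn_div (θ := θ) (h := h) hβ hγ A hloc
    refine ⟨x, fun ν hν => ?_⟩
    have h1 := hν.continuousAt_comp (continuous_real_of_isClopen hclopen).continuousAt
    have h2 : Tendsto ((fun μ : ProbabilityMeasure Config =>
        (μ : Measure Config).real (cylinder A S)) ∘ u) atTop (𝓝 x) := by
      refine hx.congr fun L => ?_
      exact (gibbsMeasure_real _ hclopen.isOpen.measurableSet).symm
    exact eq_of_nhds_neBot (h1.clusterPt.neBot.mono (inf_le_inf_left _ h2))
  refine ProbabilityMeasure.toMeasure_injective (ext_of_generate_finite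
    (measurableCylinders fun _ : ℤ => Bool) generateFrom_measurableCylinders.symm
    isPiSystem_measurableCylinders (fun F hF => ?_) ?_)
  · obtain ⟨x, hx⟩ := hlim F hF
    have h1 := (hx ν hν).trans (hx μ hμ).symm
    rwa [measureReal_def, measureReal_def, ENNReal.toReal_eq_toReal_iff' (measure_ne_top _ _)
      (measure_ne_top _ _)] at h1
  · exact (measure_univ (μ := (ν : Measure Config))).trans
      (measure_univ (μ := (μ : Measure Config))).symm

/-- Bounds on the finite volume probabilities of a local event carry over to the limit. -/
lemma IsInfiniteVolumeGibbs.real_le {μ : ProbabilityMeasure Config}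
    (hμ : IsInfiniteVolumeGibbs β θ γ h μ) {A : Finset ℤ} {F : Set Config}
    (hF : ∀ σ σ' : Config, (∀ i ∈ A, σ i = σ' i) → (σ ∈ F ↔ σ' ∈ F)) {x : ℝ}
    (hx : ∀ᶠ L : ℕ in atTop, partitionFn β θ γ h (Finset.Icc (-(L : ℤ)) L) F ≤
      x * partitionFn β θ γ h (Finset.Icc (-(L : ℤ)) L) Set.univ) :
    (μ : Measure Config).real F ≤ x := by
  have hclopen := isClopen_of_local hF
  refine le_of_tendsto (((continuous_real_of_isClopen hclopen).tendsto μ).comp hμ) ?_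
  filter_upwards [hx] with L hL
  change (gibbsMeasure β θ γ h _).real F ≤ x
  rwa [gibbsMeasure_real _ hclopen.isOpen.measurableSet,
    div_le_iff₀ (partitionFn_univ_pos _ _ _ _ _)]

end

/-! ### Fluctuations of the random field -/

section
variable {Ω : Type*} [MeasurableSpace Ω] {P : Measure Ω} [IsProbabilityMeasure P] {h : ℤ → Ω → ℝ}

lemma IsBernoulliField.ae_eq (hh : IsBernoulliField P h) (i : ℤ) :
    ∀ᵐ ω ∂P, h i ω = 1 ∨ h i ω = -1 := by
  have hd : Disjoint {ω | h i ω = 1} {ω | h i ω = -1} := by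
    rw [Set.disjoint_left]
    intro ω h1 h2
    have h1' : h i ω = 1 := h1
    have h2' : h i ω = -1 := h2
    linarith
  have hm1 : MeasurableSet {ω | h i ω = 1} := hh.measurable i (measurableSet_singleton 1)
  have hm2 : MeasurableSet {ω | h i ω = -1} := hh.measurable i (measurableSet_singleton (-1))
  have h1 : P.real ({ω | h i ω = 1} ∪ {ω | h i ω = -1}) = 1 := by
    rw [measureReal_union hd hm2, hh.prob_one, hh.prob_neg_one]
    norm_num
  have h2 : P ({ω | h i ω = 1} ∪ {ω | h i ω = -1}) = 1 := by
    rwa [measureReal_def, ENNReal.toReal_eq_one_iff] at h1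
  exact (prob_compl_eq_zero_iff (hm1.union hm2)).2 h2

lemma IsBernoulliField.integral_eq_zero (hh : IsBernoulliField P h) (i : ℤ) :
    ∫ ω, h i ω ∂P = 0 := by
  have hm1 : MeasurableSet {ω | h i ω = 1} := hh.measurable i (measurableSet_singleton 1)
  have hm2 : MeasurableSet {ω | h i ω = -1} := hh.measurable i (measurableSet_singleton (-1))
  have h1 : h i =ᵐ[P] fun ω => Set.indicator {ω | h i ω = 1} (fun _ => (1 : ℝ)) ω -
      Set.indicator {ω | h i ω = -1} (fun _ => (1 : ℝ)) ω := by
    filter_upwards [hh.ae_eq i] with ω hω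
    rcases hω with h | h <;> simp [Set.indicator, h] <;> norm_num
  rw [integral_congr_ae h1, integral_sub ((integrable_const _).indicator hm1)
    ((integrable_const _).indicator hm2), integral_indicator_const _ hm1,
    integral_indicator_const _ hm2, hh.prob_one, hh.prob_neg_one]
  simp

lemma IsBernoulliField.measure_signed_sum_ge_le (hh : IsBernoulliField P h) (S : Finset ℤ)
    (b : ℤ → Bool) {T : ℝ} (hT : 0 ≤ T) :
    P.real {ω | T ≤ ∑ i ∈ S, spin (b i) * h i ω} ≤ Real.exp (-T ^ 2 / (2 * S.card)) := by
  have hspin : ∀ b, spin b = 1 ∨ spin b = -1 := fun b => by cases b <;> simp [spin]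
  have h1 : iIndepFun (fun i ω => spin (b i) * h i ω) P :=
    hh.indep.comp (fun i x => spin (b i) * x) fun i => measurable_const.mul measurable_id
  have h2 : ∀ i ∈ S, HasSubgaussianMGF (fun ω => spin (b i) * h i ω) 1 P := fun i _ => by
    have h3 := hasSubgaussianMGF_of_mem_Icc_of_integral_eq_zero (μ := P) (a := -1) (b := 1)
      (X := fun ω => spin (b i) * h i ω) ((hh.measurable i).const_mul _).aemeasurable ?_ ?_
    · convert h3 using 1
      ext
      push_cast
      norm_num
    · filter_upwards [hh.ae_eq i] with ω hω
      rcases hω with h | h <;> rcases hspin (b i) with h' | h' <;> rw [h, h'] <;> norm_num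
    · rw [integral_const_mul, hh.integral_eq_zero, mul_zero]
  have h3 := HasSubgaussianMGF.measure_sum_ge_le_of_iIndepFun h1 h2 hT
  simpa using h3

/-- A sum of absolute values is attained by one of the 2^|X| choices of block signs. For each choice
the signed sum is sub-Gaussian with variance proxy the number of sites. -/
lemma IsBernoulliField.measure_sum_abs_gt_le (hh : IsBernoulliField P h) {M : ℕ} (hM : 0 < M)
    (X : Finset ℤ) {T : ℝ} (hT : 0 ≤ T) :
    P.real {ω | T < ∑ x ∈ X, |∑ i ∈ siteBlock M x, h i ω|} ≤
      2 ^ X.card * Real.exp (-T ^ 2 / (2 * (X.card * M : ℕ))) := by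
  have hsub : {ω | T < ∑ x ∈ X, |∑ i ∈ siteBlock M x, h i ω|} ⊆ ⋃ s : X → Bool,
      {ω | T ≤ ∑ i ∈ blockSites M X, spin (extend X s (blockIndex M i)) * h i ω} := by
    intro ω hω
    rw [Set.mem_iUnion]
    refine ⟨fun x => decide (0 ≤ ∑ i ∈ siteBlock M x, h i ω), ?_⟩
    refine (show T < _ from hω).le.trans (le_of_eq ?_)
    rw [sum_blockSites hM]
    refine Finset.sum_congr rfl fun x hx => ?_
    rw [Finset.sum_congr rfl fun i hi => congrArg (fun y => spin (extend X
      (fun x => decide (0 ≤ ∑ i ∈ siteBlock M x, h i ω)) y) * h i ω) ((mem_siteBlock hM).1 hi),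
      ← Finset.mul_sum]
    simp only [extend, hx, dif_pos, spin, decide_eq_true_eq]
    split_ifs with h0
    · rw [abs_of_nonneg h0, one_mul]
    · rw [abs_of_neg (not_le.1 h0), neg_one_mul]
  refine (measureReal_mono hsub).trans ((measureReal_iUnion_fintype_le _).trans ?_)
  refine (Finset.sum_le_card_nsmul _ _ _ fun s _ => hh.measure_signed_sum_ge_le _ _ hT).trans ?_
  rw [card_blockSites hM, nsmul_eq_mul, Finset.card_univ, Fintype.card_fun, Fintype.card_bool,
    Fintype.card_coe]
  push_cast
  exact le_rfl

/-- With high probability the field is balanced in all the blocks. -/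
lemma IsBernoulliField.exists_balanced (hh : IsBernoulliField P h) {K Q p : ℕ} {γ δs : ℝ}
    (hK : 0 < K) (hQ : 0 < Q) (hγ0 : 0 < γ) (hγ4 : γ ≤ 1 / 4) (hδs : δs = γ * (2 * K))
    (hQδ : δs * (2 * Q) = 1) (hp : ((p : ℝ) + 2) * δs * Real.log (1 / γ) ≤ 1 / 64) :
    ∃ E : Set Ω, MeasurableSet E ∧ 1 - γ ^ 2 ≤ P.real E ∧ ∀ ω ∈ E, ∀ l : ℤ,
      -(1 / γ ^ p) ≤ (l : ℝ) → (l : ℝ) ≤ 1 / γ ^ p →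
      ∑ x ∈ siteBlock (2 * Q) l, |∑ i ∈ siteBlock (2 * K) x, h i ω| ≤
        2 / γ * Real.sqrt (γ / δs) := by
  have hK0 : (0 : ℝ) < K := by exact_mod_cast hK
  have hQ0 : (0 : ℝ) < Q := by exact_mod_cast hQ
  have hδs0 : 0 < δs := by rw [hδs]; positivity
  set T := 2 / γ * Real.sqrt (γ / δs) with hT
  have hT0 : 0 ≤ T := by positivity
  set m : ℤ := ⌊1 / γ ^ p⌋ with hm
  set B : ℤ → Set Ω := fun l =>
    {ω | T < ∑ x ∈ siteBlock (2 * Q) l, |∑ i ∈ siteBlock (2 * K) x, h i ω|} with hB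
  have hmeas : ∀ l, MeasurableSet (B l) := fun l => by
    refine measurableSet_lt measurable_const ?_
    refine Finset.measurable_sum _ fun x _ => ?_
    exact (Finset.measurable_sum _ fun i _ => hh.measurable i).abs
  have hBl : ∀ l, P.real (B l) ≤ γ ^ (p + 4) := fun l => by
    refine (hh.measure_sum_abs_gt_le (by omega : 0 < 2 * K) (siteBlock (2 * Q) l) hT0).trans ?_
    rw [card_siteBlock]
    -- A unit block has 1/γ sites, so T is scaled to make the exponent 2/δ* = 4Q; this beats the
    -- 2^(2Q) sign choices and leaves e^(-2Q).
    have h1 : T ^ 2 / (2 * (2 * Q * (2 * K) : ℕ)) = 2 * (2 * Q) := by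
      rw [hT, mul_pow, Real.sq_sqrt (by positivity)]
      have h2 : γ * (2 * K) * (2 * Q) = 1 := by rw [← hδs]; exact hQδ
      push_cast
      rw [hδs]
      field_simp
      nlinarith
    rw [neg_div, h1]
    have h3 : (2 : ℝ) ^ (2 * Q) ≤ Real.exp (2 * Q) := by
      have h4 : (2 : ℝ) ≤ Real.exp 1 := by linarith [Real.add_one_le_exp (1 : ℝ)]
      have h5 := pow_le_pow_left₀ (by norm_num) h4 (2 * Q)
      rw [← Real.exp_nat_mul] at h5
      push_cast at h5
      rwa [mul_one] at h5
    have h6 : (2 : ℝ) ^ (2 * Q) * Real.exp (-(2 * (2 * Q))) ≤ Real.exp (-(2 * Q)) := by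
      refine (mul_le_mul_of_nonneg_right h3 (Real.exp_pos _).le).trans (le_of_eq ?_)
      rw [← Real.exp_add]
      congr 1
      ring
    refine h6.trans ?_
    have hlog : 0 ≤ Real.log (1 / γ) := Real.log_nonneg (by rw [le_div_iff₀ hγ0]; linarith)
    -- The hypothesis on p gives 2Q ≥ 64 (p + 2) log(1/γ). The exponent p + 4 then covers the 3
    -- γ^(-p) unit blocks and leaves 3 γ⁴ ≤ γ².
    have h7 : ((p + 4 : ℕ) : ℝ) * Real.log (1 / γ) ≤ 2 * Q := by
      have h8 : ((p : ℝ) + 2) * Real.log (1 / γ) ≤ 1 / 64 * (2 * Q) := by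
        have := mul_le_mul_of_nonneg_right hp (by positivity : 0 ≤ 2 * (Q : ℝ))
        calc ((p : ℝ) + 2) * Real.log (1 / γ)
            = ((p : ℝ) + 2) * Real.log (1 / γ) * (δs * (2 * Q)) := by rw [hQδ, mul_one]
          _ = ((p : ℝ) + 2) * δs * Real.log (1 / γ) * (2 * Q) := by ring
          _ ≤ 1 / 64 * (2 * Q) := this
      have h9 : ((p + 4 : ℕ) : ℝ) * Real.log (1 / γ) ≤
          64 * (((p : ℝ) + 2) * Real.log (1 / γ)) := by
        rw [← mul_assoc]
        refine mul_le_mul_of_nonneg_right ?_ hlog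
        push_cast
        have : (0 : ℝ) ≤ p := Nat.cast_nonneg p
        linarith
      linarith
    rw [← Real.exp_log (pow_pos hγ0 (p + 4)), Real.log_pow, Real.exp_le_exp]
    rw [one_div, Real.log_inv] at h7
    linarith
  refine ⟨(⋃ l ∈ Finset.Icc (-m) m, B l)ᶜ,
    (Finset.measurableSet_biUnion _ fun l _ => hmeas l).compl, ?_, ?_⟩
  · rw [probReal_compl_eq_one_sub (Finset.measurableSet_biUnion _ fun l _ => hmeas l)]
    refine sub_le_sub_left ?_ _
    refine (measureReal_biUnion_finset_le _ _).trans
      ((Finset.sum_le_card_nsmul _ _ _ fun l _ => hBl l).trans ?_)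
    have hpow : 0 < γ ^ p := by positivity
    have hpow1 : 1 ≤ 1 / γ ^ p := by
      rw [le_div_iff₀ hpow, one_mul]
      exact pow_le_one₀ hγ0.le (by linarith)
    have hm1 : (m : ℝ) ≤ 1 / γ ^ p := Int.floor_le _
    have hm0 : 0 ≤ m := Int.floor_nonneg.2 (by positivity)
    have hcard : ((Finset.Icc (-m) m).card : ℝ) ≤ 3 * (1 / γ ^ p) := by
      rw [Int.card_Icc]
      have h1 : (((m + 1 - -m).toNat : ℤ) : ℝ) = ((m + 1 - -m : ℤ) : ℝ) := by
        rw [Int.toNat_of_nonneg (by omega)]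
      rw [Int.cast_natCast] at h1
      rw [h1]
      push_cast
      linarith
    rw [nsmul_eq_mul]
    calc _ ≤ 3 * (1 / γ ^ p) * γ ^ (p + 4) := by gcongr
      _ = 3 * γ ^ 2 * γ ^ 2 := by rw [pow_add]; field_simp
      _ ≤ 1 * γ ^ 2 := by
          refine mul_le_mul_of_nonneg_right ?_ (by positivity)
          nlinarith
      _ = γ ^ 2 := one_mul _
  · intro ω hω l hl₁ hl₂
    by_contra hcon
    refine hω ?_
    rw [Set.mem_iUnion₂]
    refine ⟨l, ?_, not_le.1 hcon⟩
    have h1 : l ≤ m := Int.le_floor.2 hl₂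
    have h2 : -l ≤ m := Int.le_floor.2 (by push_cast; linarith)
    rw [Finset.mem_Icc]
    omega

end

/-! ### The deviation estimate -/

section
variable {K : ℕ} {B : Bool → ℤ → Finset ℤ}

lemma CloseTo.congr {k q : ℕ} (hk : 0 < k) {ζ : ℝ} {D D' : ℤ → ℝ} {l : ℤ}
    (hD : ∀ x ∈ siteBlock (k * q) l, D x = D' x) : CloseTo k q ζ D l ↔ CloseTo k q ζ D' l := by
  unfold CloseTo
  refine forall₂_congr fun u hu => ?_
  rw [Finset.sum_congr rfl fun x hx => hD x ?_]
  rw [siteBlock_mul hk, blockSites, Finset.mem_biUnion]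
  exact ⟨u, hu, hx⟩

lemma HalfBlocks.closeTo_congr (hB : HalfBlocks K B) (hK : 0 < K) {k q : ℕ} (hk : 0 < k)
    {β θ v ζ : ℝ} {l₁ l₂ l : ℤ} (hl : l ∈ Finset.Icc l₁ l₂) {σ σ' : Config}
    (hσ : ∀ i ∈ Finset.Ioc ((l₁ - 1) * (2 * K * (k * q) : ℕ)) (l₂ * (2 * K * (k * q) : ℕ)),
      σ i = σ' i) :
    CloseTo k q ζ (profileDist K B β θ v σ) l ↔ CloseTo k q ζ (profileDist K B β θ v σ') l := by
  refine CloseTo.congr hk fun x hx => ?_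
  unfold profileDist
  have h1 : ∀ b, plusCount σ (B b x) = plusCount σ' (B b x) := fun b =>
    plusCount_congr fun i hi => hσ i <|
      siteBlock_subset_Ioc (by omega) rfl hl hx (hB.subset b x hi)
  simp only [h1]

lemma HalfBlocks.closeR14_local (hB : HalfBlocks K B) (hK : 0 < K) {k q : ℕ} (hk : 0 < k)
    {β θ v ζ₁ ζ₄ : ℝ} {l₁ l₂ : ℤ} (hl : l₁ ≤ l₂) {σ σ' : Config}
    (hσ : ∀ i ∈ Finset.Ioc ((l₁ - 1) * (2 * K * (k * q) : ℕ)) (l₂ * (2 * K * (k * q) : ℕ)),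
      σ i = σ' i) :
    σ ∈ closeR14 K k q B β θ v ζ₁ ζ₄ l₁ l₂ ↔ σ' ∈ closeR14 K k q B β θ v ζ₁ ζ₄ l₁ l₂ := by
  refine and_congr (hB.closeTo_congr hK hk (Finset.mem_Icc.2 ⟨le_rfl, hl⟩) hσ)
    (and_congr (hB.closeTo_congr hK hk (Finset.mem_Icc.2 ⟨hl, le_rfl⟩) hσ)
      (forall₂_congr fun l hl => hB.closeTo_congr hK hk (Finset.mem_Icc.2 ?_) hσ))
  exact ⟨by linarith [hl.1], by linarith [hl.2]⟩

lemma HalfBlocks.closeR5_local (hB : HalfBlocks K B) (hK : 0 < K) {k q : ℕ} (hk : 0 < k)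
    {β θ v ζ₅ : ℝ} {l₁ l₂ : ℤ} (l₀ : ℕ) {σ σ' : Config}
    (hσ : ∀ i ∈ Finset.Ioc ((l₁ - 1) * (2 * K * (k * q) : ℕ)) (l₂ * (2 * K * (k * q) : ℕ)),
      σ i = σ' i) :
    σ ∈ closeR5 K k q B β θ v ζ₅ (l₁ + l₀) (l₂ - l₀) ↔
      σ' ∈ closeR5 K k q B β θ v ζ₅ (l₁ + l₀) (l₂ - l₀) := by
  refine forall₂_congr fun l hl => hB.closeTo_congr hK hk (Finset.mem_Icc.2 ?_) hσ
  have h0 : (0 : ℤ) ≤ l₀ := Int.natCast_nonneg _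
  exact ⟨by linarith [hl.1], by linarith [hl.2]⟩

end

/-! ### The deviation estimate for admissible parameters -/

section
variable {β θ ζ₀ c η ρ lam r γ δs δ κ ζ₁ ζ₄ ζ₅ : ℝ} {h : ℤ → ℝ} {K k q Q p l₀ : ℕ}
  {ηbar l₁ l₂ : ℤ}

lemma inter_R145_compl : R14 β θ γ δs δ ζ₁ ζ₄ h ηbar l₁ l₂ ∩
      (R145 β θ γ δs δ ζ₁ ζ₄ ζ₅ h ηbar l₁ l₂ l₀)ᶜ =
    R14 β θ γ δs δ ζ₁ ζ₄ h ηbar l₁ l₂ ∩ (R5 β θ γ δs δ ζ₅ h ηbar (l₁ + l₀) (l₂ - l₀))ᶜ := by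
  unfold R145
  rw [Set.compl_inter, Set.inter_union_distrib_left, Set.inter_compl_self, Set.empty_union]

/-- The parameters of the model and of the coarse graining for which the deviation estimate is
proved. -/
structure Admissible (β θ γ δs δ ζ₀ ζ₁ ζ₄ ζ₅ : ℝ) (h : ℤ → ℝ) (K k q Q p : ℕ) : Prop where
  region : TwoPhaseRegion β θ
  K_pos : 0 < K
  Q_pos : 0 < Q
  two_le_k : 2 ≤ k
  kq_eq : k * q = 2 * Q
  gamma_eq : γ = 1 / (2 * Q * (2 * K : ℕ))
  gamma_le : γ ≤ 1 / 4
  deltas_eq : δs = γ * (2 * K)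
  delta_eq : δ = k * δs
  inv_delta : 1 / δ = q
  delta_lt : δ < 1
  ratio_le : γ / δs ≤ 1 / 83521
  log_le : ((p : ℝ) + 2) * δs * Real.log (1 / γ) ≤ 1 / 64
  zeta_lt_m : ζ₀ < mTilde β θ
  zeta_four : ζ₄ ≤ ζ₀
  zeta_one : ζ₁ < ζ₄
  zeta_five : ζ₅ < ζ₁
  le_zeta_five : 8 * γ / δs ≤ ζ₅
  field : ∀ i, h i = 1 ∨ h i = -1

lemma Admissible.gamma_pos (ha : Admissible β θ γ δs δ ζ₀ ζ₁ ζ₄ ζ₅ h K k q Q p) : 0 < γ := by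
  have hK0 : (0 : ℝ) < K := by exact_mod_cast ha.K_pos
  have hQ0 : (0 : ℝ) < Q := by exact_mod_cast ha.Q_pos
  rw [ha.gamma_eq]
  push_cast
  positivity

lemma Admissible.q_pos (ha : Admissible β θ γ δs δ ζ₀ ζ₁ ζ₄ ζ₅ h K k q Q p) : 0 < q := by
  rcases Nat.eq_zero_or_pos q with rfl | hq
  · have := ha.kq_eq
    have := ha.Q_pos
    omega
  · exact hq

lemma Admissible.four_div_le (ha : Admissible β θ γ δs δ ζ₀ ζ₁ ζ₄ ζ₅ h K k q Q p) :
    4 / (K : ℝ) ≤ ζ₅ := by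
  have hK0 : (0 : ℝ) < K := by exact_mod_cast ha.K_pos
  have hγ0 := ha.gamma_pos
  refine le_trans (le_of_eq ?_) ha.le_zeta_five
  rw [ha.deltas_eq]
  field_simp
  norm_num

lemma Admissible.R14_eq (ha : Admissible β θ γ δs δ ζ₀ ζ₁ ζ₄ ζ₅ h K k q Q p)
    (hη : ηbar = 1 ∨ ηbar = -1) : R14 β θ γ δs δ ζ₁ ζ₄ h ηbar l₁ l₂ =
      closeR14 K k q (halfBlock γ δs h) β θ (ηbar * mTilde β θ) ζ₁ ζ₄ l₁ l₂ :=
  R14_eq_closeR14 ha.gamma_pos ha.K_pos ha.deltas_eq ha.field (by have := ha.two_le_k; omega)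
    ha.q_pos ha.delta_eq ha.inv_delta
    (by linarith [ha.zeta_one, ha.zeta_four, ha.zeta_lt_m])
    (by linarith [ha.zeta_four, ha.zeta_lt_m]) (mTilde_pos ha.region) hη _ _

lemma Admissible.R5_eq (ha : Admissible β θ γ δs δ ζ₀ ζ₁ ζ₄ ζ₅ h K k q Q p)
    (hη : ηbar = 1 ∨ ηbar = -1) : R5 β θ γ δs δ ζ₅ h ηbar l₁ l₂ =
      closeR5 K k q (halfBlock γ δs h) β θ (ηbar * mTilde β θ) ζ₅ l₁ l₂ :=
  R5_eq_closeR5 ha.gamma_pos ha.K_pos ha.deltas_eq ha.field (by have := ha.two_le_k; omega)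
    ha.q_pos ha.delta_eq ha.inv_delta
    (by linarith [ha.zeta_five, ha.zeta_one, ha.zeta_four, ha.zeta_lt_m])
    (mTilde_pos ha.region) hη _ _

lemma Admissible.sites_eq_Ioc (ha : Admissible β θ γ δs δ ζ₀ ζ₁ ζ₄ ζ₅ h K k q Q p) (l₁ l₂ : ℤ) :
    sites γ ((l₁ : ℝ) - 1) l₂ =
      Finset.Ioc ((l₁ - 1) * (2 * K * (k * q) : ℕ)) (l₂ * (2 * K * (k * q) : ℕ)) := by
  have hK0 : (0 : ℝ) < K := by exact_mod_cast ha.K_pos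
  have hQ0 : (0 : ℝ) < Q := by exact_mod_cast ha.Q_pos
  refine sites_unit_eq ?_ l₁ l₂
  rw [ha.gamma_eq, ha.kq_eq]
  push_cast
  field_simp

lemma Admissible.siteBlock_subset (ha : Admissible β θ γ δs δ ζ₀ ζ₁ ζ₄ ζ₅ h K k q Q p)
    (l₁ l₂ : ℤ) : ∀ l ∈ Finset.Icc l₁ l₂, ∀ y ∈ siteBlock (2 * Q) l,
      siteBlock (2 * K) y ⊆ sites γ ((l₁ : ℝ) - 1) l₂ := fun l hl y hy => by
  rw [ha.sites_eq_Ioc, ha.kq_eq]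
  exact siteBlock_subset_Ioc (by have := ha.K_pos; omega) rfl hl hy

lemma Admissible.bad_local (ha : Admissible β θ γ δs δ ζ₀ ζ₁ ζ₄ ζ₅ h K k q Q p)
    (hη : ηbar = 1 ∨ ηbar = -1) (hl : l₁ ≤ l₂) {σ σ' : Config}
    (hσ : ∀ i ∈ sites γ ((l₁ : ℝ) - 1) l₂, σ i = σ' i) :
    σ ∈ R14 β θ γ δs δ ζ₁ ζ₄ h ηbar l₁ l₂ ∩
        (R5 β θ γ δs δ ζ₅ h ηbar (l₁ + l₀) (l₂ - l₀))ᶜ ↔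
      σ' ∈ R14 β θ γ δs δ ζ₁ ζ₄ h ηbar l₁ l₂ ∩
        (R5 β θ γ δs δ ζ₅ h ηbar (l₁ + l₀) (l₂ - l₀))ᶜ := by
  rw [ha.sites_eq_Ioc] at hσ
  have hB := halfBlocks_halfBlock ha.gamma_pos ha.deltas_eq ha.field
  have hk : 0 < k := by have := ha.two_le_k; omega
  rw [ha.R14_eq hη, ha.R5_eq hη]
  exact and_congr (hB.closeR14_local ha.K_pos hk hl hσ)
    (not_congr (hB.closeR5_local ha.K_pos hk l₀ hσ))

lemma Admissible.partitionFn_good_pos (ha : Admissible β θ γ δs δ ζ₀ ζ₁ ζ₄ ζ₅ h K k q Q p)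
    (hη : ηbar = 1 ∨ ηbar = -1) (hl : l₁ ≤ l₂) :
    0 < Z00 β θ γ h l₁ l₂ (R145 β θ γ δs δ ζ₁ ζ₄ ζ₅ h ηbar l₁ l₂ l₀) := by
  unfold R145 Z00
  rw [ha.R14_eq hη, ha.R5_eq hη]
  exact (halfBlocks_halfBlock ha.gamma_pos ha.deltas_eq ha.field).partitionFn_close_pos ha.K_pos
    (by have := ha.two_le_k; omega) ha.kq_eq ha.four_div_le ha.zeta_five.le ha.zeta_one.le γ h hl
    l₀ _ (ha.siteBlock_subset l₁ l₂)

/-- The deviation estimate in a finite volume. -/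
lemma Admissible.partitionFn_bad_le (ha : Admissible β θ γ δs δ ζ₀ ζ₁ ζ₄ ζ₅ h K k q Q p)
    (hη : ηbar = 1 ∨ ηbar = -1)
    (hC : ∀ v, v = mTilde β θ ∨ v = -mTilde β θ → ContractionConstants β θ v ζ₀ c η ρ lam r)
    (hκ : 0 < κ) (hκ1 : κ * ζ₀ * 2 ≤ ρ * (1 - lam))
    (hκ2 : κ * ζ₀ * (32 * β ^ 2 * ((1 + 1 / η) / (1 - ρ))) ≤ 1)
    (hE : 0 ≤ rateExponent β θ κ ζ₀ γ δs δ ζ₄ ζ₅ l₀)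
    (hl₁ : -(1 / γ ^ p) ≤ (l₁ : ℝ)) (hl₂ : (l₂ : ℝ) ≤ 1 / γ ^ p)
    (hbal : ∀ l : ℤ, -(1 / γ ^ p) ≤ (l : ℝ) → (l : ℝ) ≤ 1 / γ ^ p →
      ∑ x ∈ siteBlock (2 * Q) l, |∑ i ∈ siteBlock (2 * K) x, h i| ≤ 2 / γ * Real.sqrt (γ / δs))
    {Λ : Finset ℤ} (hΛ : sites γ ((l₁ : ℝ) - 1) l₂ ⊆ Λ) :
    partitionFn β θ γ h Λ (R14 β θ γ δs δ ζ₁ ζ₄ h ηbar l₁ l₂ ∩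
        (R5 β θ γ δs δ ζ₅ h ηbar (l₁ + l₀) (l₂ - l₀))ᶜ) ≤
      3 * γ ^ 2 * Real.exp (-(β / γ) * rateExponent β θ κ ζ₀ γ δs δ ζ₄ ζ₅ l₀) *
        partitionFn β θ γ h Λ (R14 β θ γ δs δ ζ₁ ζ₄ h ηbar l₁ l₂) := by
  have hv : (ηbar : ℝ) * mTilde β θ = mTilde β θ ∨ (ηbar : ℝ) * mTilde β θ = -mTilde β θ := by
    rcases hη with rfl | rfl <;> simp
  have hK0 : (0 : ℝ) < K := by exact_mod_cast ha.K_pos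
  have h5 : 0 < ζ₅ := lt_of_lt_of_le (by positivity) ha.four_div_le
  obtain ⟨h', hh', hsum⟩ := exists_idealField ha.gamma_pos ha.K_pos ha.deltas_eq ha.field
  rw [ha.R14_eq hη, ha.R5_eq hη]
  refine (halfBlocks_halfBlock ha.gamma_pos ha.deltas_eq ha.field).partitionFn_union_le ha.K_pos
    ha.Q_pos (by have := ha.two_le_k; omega) ha.kq_eq ha.region.one_lt.le ha.region.theta_pos
    ha.gamma_eq ha.deltas_eq ha.delta_eq ha.delta_lt (hC _ hv) hκ hκ1 hκ2 ha.ratio_le ha.log_le h5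
    ha.zeta_five ha.zeta_one ha.zeta_four hE l₁ l₂ hl₁ hl₂ h h' hh' Λ
    (fun l hl y hy => (ha.siteBlock_subset l₁ l₂ l hl y hy).trans hΛ) fun l hl => ?_
  rw [Finset.mem_Icc] at hl
  have h1 : (l₁ : ℝ) ≤ l := by exact_mod_cast hl.1
  have h2 : (l : ℝ) ≤ l₂ := by exact_mod_cast hl.2
  exact (Finset.sum_le_sum fun x _ => hsum x).trans (hbal l (hl₁.trans h1) (h2.trans hl₂))

/-- The deviation estimate for the Gibbs measure and for the partition functions. -/
lemma Admissible.deviation_le (ha : Admissible β θ γ δs δ ζ₀ ζ₁ ζ₄ ζ₅ h K k q Q p)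
    (hη : ηbar = 1 ∨ ηbar = -1)
    (hC : ∀ v, v = mTilde β θ ∨ v = -mTilde β θ → ContractionConstants β θ v ζ₀ c η ρ lam r)
    (hκ : 0 < κ) (hκ1 : κ * ζ₀ * 2 ≤ ρ * (1 - lam))
    (hκ2 : κ * ζ₀ * (32 * β ^ 2 * ((1 + 1 / η) / (1 - ρ))) ≤ 1) (hl : l₁ ≤ l₂)
    (hl₁ : -(1 / γ ^ p) ≤ (l₁ : ℝ)) (hl₂ : (l₂ : ℝ) ≤ 1 / γ ^ p)
    (hbal : ∀ l : ℤ, -(1 / γ ^ p) ≤ (l : ℝ) → (l : ℝ) ≤ 1 / γ ^ p →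
      ∑ x ∈ siteBlock (2 * Q) l, |∑ i ∈ siteBlock (2 * K) x, h i| ≤ 2 / γ * Real.sqrt (γ / δs))
    {μ : ProbabilityMeasure Config} (hμ : IsInfiniteVolumeGibbs β θ γ h μ) :
    (μ : Measure Config).real (R14 β θ γ δs δ ζ₁ ζ₄ h ηbar l₁ l₂ ∩
        (R145 β θ γ δs δ ζ₁ ζ₄ ζ₅ h ηbar l₁ l₂ l₀)ᶜ) ≤
      2 / γ ^ p * Real.exp (-(β / γ) * rateExponent β θ κ ζ₀ γ δs δ ζ₄ ζ₅ l₀) ∧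
    (0 ≤ rateExponent β θ κ ζ₀ γ δs δ ζ₄ ζ₅ l₀ →
      0 < Z00 β θ γ h l₁ l₂ (R145 β θ γ δs δ ζ₁ ζ₄ ζ₅ h ηbar l₁ l₂ l₀) ∧
      Z00 β θ γ h l₁ l₂ (R14 β θ γ δs δ ζ₁ ζ₄ h ηbar l₁ l₂ ∩
          (R145 β θ γ δs δ ζ₁ ζ₄ ζ₅ h ηbar l₁ l₂ l₀)ᶜ) /
        Z00 β θ γ h l₁ l₂ (R145 β θ γ δs δ ζ₁ ζ₄ ζ₅ h ηbar l₁ l₂ l₀) ≤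
        2 / γ ^ p * Real.exp (-(β / γ) * rateExponent β θ κ ζ₀ γ δs δ ζ₄ ζ₅ l₀)) := by
  have hγ0 := ha.gamma_pos
  have hγ4 := ha.gamma_le
  have hβ : 0 < β := by linarith [ha.region.one_lt]
  rw [inter_R145_compl]
  set E := rateExponent β θ κ ζ₀ γ δs δ ζ₄ ζ₅ l₀ with hEdef
  have hpow : 2 ≤ 2 / γ ^ p := by
    rw [le_div_iff₀ (pow_pos hγ0 p)]
    have := pow_le_one₀ (n := p) hγ0.le (by linarith)
    linarith
  have hγ2 : 6 * γ ^ 2 ≤ 1 := by nlinarith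
  have he := Real.exp_pos (-(β / γ) * E)
  set e := Real.exp (-(β / γ) * E) with he_def
  constructor
  -- For a negative rate the right side is at least 2, and nothing has to be proved.
  · rcases le_or_gt 0 E with hE | hE
    · refine hμ.real_le (fun σ σ' hσ => ha.bad_local hη hl hσ) ?_
      obtain ⟨L₀, hL₀⟩ : ∃ L₀ : ℕ, sites γ ((l₁ : ℝ) - 1) l₂ ⊆ Finset.Icc (-(L₀ : ℤ)) L₀ := by
        refine ⟨∑ i ∈ sites γ ((l₁ : ℝ) - 1) l₂, i.natAbs, fun i hi => ?_⟩
        have := Finset.single_le_sum (f := fun i : ℤ => i.natAbs) (fun _ _ => Nat.zero_le _) hi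
        rw [Finset.mem_Icc]
        omega
      filter_upwards [eventually_ge_atTop L₀] with L hL
      have hsub : Finset.Icc (-(L₀ : ℤ)) L₀ ⊆ Finset.Icc (-(L : ℤ)) L :=
        Finset.Icc_subset_Icc (by omega) (by omega)
      refine (ha.partitionFn_bad_le hη hC hκ hκ1 hκ2 hE hl₁ hl₂ hbal (hL₀.trans hsub)).trans ?_
      refine mul_le_mul ?_ (partitionFn_mono _ _ _ _ _ (Set.subset_univ _))
        (partitionFn_nonneg _ _ _ _ _ _) (by positivity)
      refine mul_le_mul_of_nonneg_right ?_ he.le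
      linarith
    · refine measureReal_le_one.trans ?_
      have h1 : 1 ≤ e := by
        rw [he_def, Real.one_le_exp_iff]
        have : 0 < β / γ := by positivity
        nlinarith
      nlinarith
  · intro hE
    have hpos := ha.partitionFn_good_pos (l₀ := l₀) hη hl
    refine ⟨hpos, ?_⟩
    have hbad := ha.partitionFn_bad_le hη hC hκ hκ1 hκ2 hE hl₁ hl₂ hbal subset_rfl
    have hadd := partitionFn_inter_add β θ γ h (sites γ ((l₁ : ℝ) - 1) l₂)
      (R14 β θ γ δs δ ζ₁ ζ₄ h ηbar l₁ l₂) (R5 β θ γ δs δ ζ₅ h ηbar (l₁ + l₀) (l₂ - l₀))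
    rw [div_le_iff₀ hpos]
    unfold Z00 R145 at *
    rw [← hadd, ← he_def] at hbad
    set G := partitionFn β θ γ h (sites γ ((l₁ : ℝ) - 1) l₂) (R14 β θ γ δs δ ζ₁ ζ₄ h ηbar l₁ l₂ ∩
      R5 β θ γ δs δ ζ₅ h ηbar (l₁ + l₀) (l₂ - l₀))
    set Z := partitionFn β θ γ h (sites γ ((l₁ : ℝ) - 1) l₂) (R14 β θ γ δs δ ζ₁ ζ₄ h ηbar l₁ l₂ ∩
      (R5 β θ γ δs δ ζ₅ h ηbar (l₁ + l₀) (l₂ - l₀))ᶜ)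
    have hZ : 0 ≤ Z := partitionFn_nonneg _ _ _ _ _ _
    have he1 : e ≤ 1 := by
      rw [he_def, Real.exp_le_one_iff]
      have : 0 < β / γ := by positivity
      nlinarith
    -- The partition function of `R14` splits into the good part G and the bad part Z; the bad part
    -- on the right is absorbed on the left at the cost of a factor 2.
    have h1 : 3 * γ ^ 2 * e ≤ 1 / 2 := by nlinarith
    have h2 : 3 * γ ^ 2 * e * Z ≤ 1 / 2 * Z := mul_le_mul_of_nonneg_right h1 hZ
    have h3 : Z ≤ 6 * γ ^ 2 * e * G := by linarith
    refine h3.trans (mul_le_mul_of_nonneg_right (mul_le_mul_of_nonneg_right ?_ he.le) hpos.le)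
    linarith

end

end RFKac

theorem theorem6p4 (β θ : ℝ) (hβθ : TwoPhaseRegion β θ) :
    ∃ γ₀ d₀ ζ₀ : ℝ, (0 < γ₀ ∧ γ₀ < 1) ∧ (0 < d₀ ∧ d₀ < 1) ∧ (0 < ζ₀ ∧ ζ₀ < 1) ∧
      0 < alphaRate β θ ζ₀ ∧
      ∀ {Ω : Type*} [MeasurableSpace Ω] (P : Measure Ω) [IsProbabilityMeasure P]
        (h : ℤ → Ω → ℝ), IsBernoulliField P h →
      ∀ γ δs : ℝ, 0 < γ → γ ≤ γ₀ → (∃ n : ℕ, γ = ((2 : ℝ) ^ n)⁻¹) →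
        0 < δs → γ / δs ≤ d₀ → (∃ M : ℕ, δs / γ = 2 * (M : ℝ)) →
      ∀ p : ℕ, ((p : ℝ) + 2) * δs * Real.log (1 / γ) ≤ 1 / 64 →
      ∃ ΩRE : Set Ω, MeasurableSet ΩRE ∧ 1 - γ ^ 2 ≤ P.real ΩRE ∧
        ∀ ω ∈ ΩRE, ∃ μ : ProbabilityMeasure Config,
          IsInfiniteVolumeGibbs β θ γ (fun i => h i ω) μ ∧
          ∀ κ : ℝ, IsGrowthConstant β θ κ →
          ∀ ηbar : ℤ, ηbar = 1 ∨ ηbar = -1 →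
          ∀ (l₀ : ℕ) (δ ζ₁ ζ₄ ζ₅ : ℝ), δs < δ → δ < 1 →
            (∃ k : ℕ, 2 ≤ k ∧ δ = (k : ℝ) * δs) → (∃ q : ℕ, 1 / δ = (q : ℝ)) →
            ζ₄ ≤ ζ₀ → ζ₁ < ζ₄ → ζ₅ < ζ₁ → 8 * γ / δs ≤ ζ₅ →
          ∀ l₁ l₂ : ℤ, 4 * (l₀ : ℤ) + 10 ≤ l₂ - l₁ →
            -(1 / γ ^ p) ≤ (l₁ : ℝ) → (l₂ : ℝ) ≤ 1 / γ ^ p →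
            (μ : Measure Config).real
                (R14 β θ γ δs δ ζ₁ ζ₄ (fun i => h i ω) ηbar l₁ l₂ ∩
                  (R145 β θ γ δs δ ζ₁ ζ₄ ζ₅ (fun i => h i ω) ηbar l₁ l₂ l₀)ᶜ) ≤
              2 / γ ^ p * Real.exp (-(β / γ) * rateExponent β θ κ ζ₀ γ δs δ ζ₄ ζ₅ l₀) ∧
            (0 ≤ rateExponent β θ κ ζ₀ γ δs δ ζ₄ ζ₅ l₀ →
              0 < Z00 β θ γ (fun i => h i ω) l₁ l₂
                  (R145 β θ γ δs δ ζ₁ ζ₄ ζ₅ (fun i => h i ω) ηbar l₁ l₂ l₀) ∧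
              Z00 β θ γ (fun i => h i ω) l₁ l₂
                  (R14 β θ γ δs δ ζ₁ ζ₄ (fun i => h i ω) ηbar l₁ l₂ ∩
                    (R145 β θ γ δs δ ζ₁ ζ₄ ζ₅ (fun i => h i ω) ηbar l₁ l₂ l₀)ᶜ) /
                Z00 β θ γ (fun i => h i ω) l₁ l₂
                  (R145 β θ γ δs δ ζ₁ ζ₄ ζ₅ (fun i => h i ω) ηbar l₁ l₂ l₀) ≤
                2 / γ ^ p * Real.exp (-(β / γ) * rateExponent β θ κ ζ₀ γ δs δ ζ₄ ζ₅ l₀)) := by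
  obtain ⟨ζ₀, c, η, ρ, lam, r, hα, hζm, hC₁, hC₂, hκ⟩ := exists_constants hβθ
  refine ⟨1 / 4, 1 / 83521, ζ₀, by norm_num, by norm_num, ⟨hC₁.zeta_pos, hC₁.zeta_lt⟩, hα, ?_⟩
  intro Ω _ P _ h hh γ δs hγ0 hγ4 ⟨n, hn⟩ hδs0 hd ⟨K, hM⟩ p hp
  have hβ : 0 < β := by linarith [hβθ.one_lt]
  have hδs : δs = γ * (2 * K) := by rw [← hM]; field_simp
  have hK : 0 < K := by
    rcases Nat.eq_zero_or_pos K with rfl | h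
    · rw [Nat.cast_zero, mul_zero, mul_zero] at hδs
      exact absurd hδs hδs0.ne'
    · exact h
  obtain ⟨E, hE, hPE, hbal⟩ : ∃ E : Set Ω, MeasurableSet E ∧ 1 - γ ^ 2 ≤ P.real E ∧
      ∀ ω ∈ E, ∀ Q : ℕ, δs * (2 * Q) = 1 → ∀ l : ℤ,
        -(1 / γ ^ p) ≤ (l : ℝ) → (l : ℝ) ≤ 1 / γ ^ p →
        ∑ x ∈ siteBlock (2 * Q) l, |∑ i ∈ siteBlock (2 * K) x, h i ω| ≤
          2 / γ * Real.sqrt (γ / δs) := by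
    -- The event must be chosen before δ. If some admissible δ exists, Q is determined by δ* alone;
    -- if there is no such Q, the requirement is empty and the whole space can be taken.
    by_cases hQ : ∃ Q : ℕ, δs * (2 * Q) = 1
    · obtain ⟨Q, hQ⟩ := hQ
      have hQ0 : 0 < Q := by
        rcases Nat.eq_zero_or_pos Q with rfl | h
        · norm_num at hQ
        · exact h
      obtain ⟨E, hE, hPE, hbal⟩ := hh.exists_balanced hK hQ0 hγ0 hγ4 hδs hQ hp
      refine ⟨E, hE, hPE, fun ω hω Q' hQ' => ?_⟩
      have h1 : (Q' : ℝ) = Q := by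
        have h2 := mul_left_cancel₀ hδs0.ne' (hQ'.trans hQ.symm)
        linarith
      rw [Nat.cast_injective h1]
      exact hbal ω hω
    · refine ⟨Set.univ, MeasurableSet.univ, ?_, fun ω _ Q hQ' => absurd ⟨Q, hQ'⟩ hQ⟩
      rw [probReal_univ]
      linarith [sq_nonneg γ]
  have hmeas : MeasurableSet {ω | ∀ i, h i ω = 1 ∨ h i ω = -1} := by
    rw [Set.ofPred_forall]
    exact MeasurableSet.iInter fun i => (hh.measurable i (measurableSet_singleton 1)).union
      (hh.measurable i (measurableSet_singleton (-1)))
  -- Intersecting with the event of full measure where all h_i are ±1 gives pointwise control of the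
  -- field without changing the probability.
  refine ⟨E ∩ {ω | ∀ i, h i ω = 1 ∨ h i ω = -1}, hE.inter hmeas, ?_, ?_⟩
  · refine hPE.trans (le_of_eq (measureReal_congr ?_))
    filter_upwards [ae_all_iff.2 hh.ae_eq] with ω hω
    exact propext ⟨fun h => ⟨h, hω⟩, fun h => h.1⟩
  · rintro ω ⟨hωE, hω⟩
    obtain ⟨μ, hμ⟩ := exists_isInfiniteVolumeGibbs hβ hγ0 θ fun i => h i ω
    refine ⟨μ, hμ, ?_⟩
    intro κ hκg ηbar hη l₀ δ ζ₁ ζ₄ ζ₅ _ hδ1 ⟨k, hk, hδ⟩ ⟨q, hq⟩ h40 h14 h51 h5 l₁ l₂ hl hl₁ hl₂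
    obtain ⟨Q, hQ, hkq, hγQ⟩ := exists_scales hn hδs0 hM hk hδ hq
    have hQδ : δs * (2 * Q) = 1 := by
      have hK0 : (0 : ℝ) < K := by exact_mod_cast hK
      have hQ0 : (0 : ℝ) < Q := by exact_mod_cast hQ
      rw [hδs, hγQ]
      push_cast
      field_simp
    have ha : Admissible β θ γ δs δ ζ₀ ζ₁ ζ₄ ζ₅ (fun i => h i ω) K k q Q p :=
      ⟨hβθ, hK, hQ, hk, hkq, hγQ, hγ4, hδs, hδ, hq, hδ1, hd, hp, hζm, h40, h14, h51, h5, hω⟩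
    refine ha.deviation_le (c := c) (η := η) (ρ := ρ) (lam := lam) (r := r) hη (fun v hv => ?_)
      hκg.1 (hκ κ hκg).1 (hκ κ hκg).2 (by omega) hl₁ hl₂ (hbal ω hωE Q hQδ) hμ
    rcases hv with rfl | rfl
    · exact hC₁
    · exact hC₂
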